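/- **Conventions.** Let $\widetilde{\mathbb N}=\mathbb N\cup\{\infty\}$ be the one-point compactification of $\mathbb N$. A $C^*$-algebra over $\widetilde{\mathbb N}$ is a $C^*$-algebra $\mathfrak A$ together with a continuous map $\mathrm{Prim}(\mathfrak A)\to\widetilde{\mathbb N}$, equivalently, together with a map $U\mapsto\mathfrak A(U)$ from the open subsets of $\widetilde{\mathbb N}$ to the closed two-sided ideals of $\mathfrak A$ that preserves arbitrary suprema and finite infima (so $\mathfrak A(\emptyset)=0$, $\mathfrak A(\widetilde{\mathbb N})=\mathfrak A$). Its fiber at $x$ is $\mathfrak A(x)=\mathfrak A/\mathfrak A(\widetilde{\mathbb N}\setminus\{x\})$. A $*$-homomorphism $\phi:\mathfrak A\to\mathfrak B$ between such algebras is $\widetilde{\mathbb N}$-equivariant if $\phi(\mathfrak A(U))\subseteq\mathfrak B(U)$ for all open $U$; it then induces $\phi_x:\mathfrak A(x)\to\mathfrak B(x)$. A $*$-homomorphism $\phi:\mathfrak A\to\mathfrak B$ is full if for every nonzero $a\in\mathfrak A$ the closed two-sided ideal generated by $\phi(a)$ is $\mathfrak B$. Total $K$-theory is $\underline K(\mathfrak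 A)=\bigoplus_{p}\bigoplus_{i=0,1}KK(\mathbb I_p^i,\mathfrak A)$, where $p$ runs over $0$ and all prime powers, $\mathbb I_0=\mathbb C$, $\mathbb I_p$ is the mapping cone of the unital $*$-homomorphism $\mathbb C\to M_p(\mathbb C)$ for $p\neq0$, $\mathbb I_p^0=\mathbb I_p$ and $\mathbb I_p^1=C_0(\mathbb R)\otimes\mathbb I_p$. $\mathbb K$ denotes the compact operators on a separable infinite-dimensional Hilbert space, and $\mathfrak A$ is stable if $\mathfrak A\cong\mathfrak A\otimes\mathbb K$. A class $\mathcal C$ of $C^*$-algebras has the *partial-isometry uniqueness property* if for all $\mathfrak A,\mathfrak B\in\mathcal C$, all full $*$-homomorphisms $\phi,\psi:\mathfrak A\to\mathfrak B\otimes\mathbb K$ with $\underline K(\phi)=\underline K(\psi)$, and every nonzero projection $e\in\mathfrak A$, there is a sequence $(v_n)$ in $\mathfrak B\otimes\mathbb K$ with $v_n^*v_n=\phi(e)$, $v_nv_n^*=\psi(e)$ for all $n$, and $\lim_{n}\|v_n\phi(x)v_n^*-\psi(x)\|=0$ for all $x\in e\mathfrak Ae$. **Theorem.** For each $n\in\mathbb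 N$ let $\mathcal C_n$ be a class of $C^*$-algebras with the partial-isometry uniqueness property. Let $\mathfrak A_1$ be a separable $C^*$-algebra over $\widetilde{\mathbb N}$ of real rank zero such that $\mathfrak A_1(\infty)$ is an AF-algebra and $\mathfrak A_1(n)\in\mathcal C_n$ for every $n\in\mathbb N$. Let $\mathfrak A_2$ be a separable $C^*$-algebra over $\widetilde{\mathbb N}$ such that $\mathfrak A_2$ is stable and $\mathfrak A_2(n)\in\mathcal C_n$ for every $n\in\mathbb N$. Let $\phi,\psi:\mathfrak A_1\to\mathfrak A_2$ be $\widetilde{\mathbb N}$-equivariant $*$-homomorphisms such that 1. $\underline K(\phi_n)=\underline K(\psi_n)$ for every $n\in\mathbb N$; 2. $\phi_n$ and $\psi_n$ are full $*$-homomorphisms for every $n\in\mathbb N$; 3. for every projection $e\in\mathfrak A_1$ the projections $\phi(e)$ and $\psi(e)$ are Murray–von Neumann equivalent in $\mathfrak A_2$. Then $\phi$ and $\psi$ are approximately unitarily equivalent: there is a sequence of unitaries $u_n$ in the multiplier algebra $\mathcal M(\mathfrak A_2)$ with $\lim_{n}\|u_n\phi(a)u_n^*-\psi(a)\|=0$ for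 all $a\in\mathfrak A_1$. -/

import Mathlib

open Filter Topology
universe u v

namespace FiberedCStar

section ClosedIdeals

/-- A closed two-sided ideal of a C⋆-algebra.  (Closed two-sided ideals of a C⋆-algebra are
automatically linear subspaces and closed under the adjoint.) -/
structure ClosedIdeal (A : Type u) [NonUnitalCStarAlgebra A] extends Submodule ℂ A where
  mul_mem_left' : ∀ (x : A) {a : A}, a ∈ carrier → x * a ∈ carrier
  mul_mem_right' : ∀ (x : A) {a : A}, a ∈ carrier → a * x ∈ carrier
  star_mem' : ∀ {a : A}, a ∈ carrier → star a ∈ carrier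
  isClosed' : IsClosed carrier

namespace ClosedIdeal

variable {A : Type u} [NonUnitalCStarAlgebra A]

instance : Membership A (ClosedIdeal A) := ⟨fun I a => a ∈ I.toSubmodule⟩

/-- Closed ideals are ordered by inclusion. -/
instance : LE (ClosedIdeal A) := ⟨fun I J => ∀ a : A, a ∈ I → a ∈ J⟩

variable (I : ClosedIdeal A)

instance isClosed_toSubmodule : IsClosed (I.toSubmodule : Set A) := I.isClosed'

/-- The closed ideal `I` as a C⋆-subalgebra. -/
def toSubalgebra : NonUnitalStarSubalgebra ℂ A :=
  { I.toSubmodule with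
    mul_mem' := fun {_ _} _ hb => I.mul_mem_left' _ hb
    star_mem' := fun ha => I.star_mem' ha }

instance isClosed_toSubalgebra : IsClosed (I.toSubalgebra : Set A) := I.isClosed'

/-- The quotient of a C⋆-algebra by a closed two-sided ideal. -/
def Quotient : Type u := A ⧸ I.toSubmodule

namespace Quotient

noncomputable instance : NormedAddCommGroup I.Quotient :=
  inferInstanceAs (NormedAddCommGroup (A ⧸ I.toSubmodule))

noncomputable instance : NormedSpace ℂ I.Quotient :=
  inferInstanceAs (NormedSpace ℂ (A ⧸ I.toSubmodule))

instance : CompleteSpace I.Quotient :=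
  inferInstanceAs (CompleteSpace (A ⧸ I.toSubmodule))

/-- The quotient map. -/
def mk : A →ₗ[ℂ] I.Quotient := I.toSubmodule.mkQ

lemma mk_surjective : Function.Surjective (mk I) := I.toSubmodule.mkQ_surjective

lemma mk_eq_mk {a b : A} : mk I a = mk I b ↔ a - b ∈ I :=
  Submodule.Quotient.eq I.toSubmodule

lemma norm_mk_le (a : A) : ‖mk I a‖ ≤ ‖a‖ := Submodule.Quotient.norm_mk_le _ a

lemma exists_lift (x : I.Quotient) {ε : ℝ} (hε : 0 < ε) : ∃ a, mk I a = x ∧ ‖a‖ < ‖x‖ + ε :=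
  Submodule.Quotient.norm_mk_lt x hε

instance : Mul I.Quotient :=
  ⟨Quotient.map₂ (· * ·) (by
    intro a b hab c d hcd
    have hab' : a - b ∈ I.toSubmodule := (Submodule.quotientRel_def _).1 hab
    have hcd' : c - d ∈ I.toSubmodule := (Submodule.quotientRel_def _).1 hcd
    refine (Submodule.quotientRel_def _).2 ?_
    have : a * c - b * d = (a - b) * c + b * (c - d) := by
      simp [sub_mul, mul_sub]
    rw [this]
    exact I.toSubmodule.add_mem (I.mul_mem_right' _ hab') (I.mul_mem_left' _ hcd'))⟩

instance : Star I.Quotient :=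
  ⟨Quotient.map star (by
    intro a b hab
    have hab' : a - b ∈ I.toSubmodule := (Submodule.quotientRel_def _).1 hab
    refine (Submodule.quotientRel_def _).2 ?_
    rw [← star_sub]
    exact I.star_mem' hab')⟩

lemma mk_mul (a b : A) : mk I (a * b) = mk I a * mk I b := rfl

lemma mk_star (a : A) : mk I (star a) = star (mk I a) := rfl

noncomputable instance : NonUnitalRing I.Quotient :=
  { (inferInstance : AddCommGroup I.Quotient), (inferInstance : Mul I.Quotient) with
    left_distrib := by
      intro x y z
      obtain ⟨a, rfl⟩ := mk_surjective I x
      obtain ⟨b, rfl⟩ := mk_surjective I y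
      obtain ⟨c, rfl⟩ := mk_surjective I z
      rw [← map_add, ← mk_mul, ← mk_mul, ← mk_mul, mul_add, map_add]
    right_distrib := by
      intro x y z
      obtain ⟨a, rfl⟩ := mk_surjective I x
      obtain ⟨b, rfl⟩ := mk_surjective I y
      obtain ⟨c, rfl⟩ := mk_surjective I z
      rw [← map_add, ← mk_mul, ← mk_mul, ← mk_mul, add_mul, map_add]
    zero_mul := by
      intro x
      obtain ⟨a, rfl⟩ := mk_surjective I x
      rw [← map_zero (mk I), ← mk_mul, zero_mul]
    mul_zero := by
      intro x
      obtain ⟨a, rfl⟩ := mk_surjective I x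
      rw [← map_zero (mk I), ← mk_mul, mul_zero]
    mul_assoc := by
      intro x y z
      obtain ⟨a, rfl⟩ := mk_surjective I x
      obtain ⟨b, rfl⟩ := mk_surjective I y
      obtain ⟨c, rfl⟩ := mk_surjective I z
      simp only [← mk_mul, mul_assoc] }

noncomputable instance : NonUnitalNormedRing I.Quotient :=
  { (inferInstance : NormedAddCommGroup I.Quotient), (inferInstance : NonUnitalRing I.Quotient) with
    norm_mul_le := by
      intro x y
      refine le_of_forall_pos_le_add fun ε hε => ?_
      have hlim : Tendsto (fun δ : ℝ => (‖x‖ + δ) * (‖y‖ + δ)) (𝓝[>] 0) (𝓝 (‖x‖ * ‖y‖)) := by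
        have : Tendsto (fun δ : ℝ => (‖x‖ + δ) * (‖y‖ + δ)) (𝓝 0)
            (𝓝 ((‖x‖ + 0) * (‖y‖ + 0))) := by
          apply Continuous.tendsto; fun_prop
        simpa using this.mono_left nhdsWithin_le_nhds
      obtain ⟨δ, hδ, hδ0⟩ := ((hlim.eventually (gt_mem_nhds (lt_add_of_pos_right _ hε))).and
        self_mem_nhdsWithin).exists
      obtain ⟨a, rfl, ha⟩ := exists_lift I x hδ0
      obtain ⟨b, rfl, hb⟩ := exists_lift I y hδ0
      rw [← mk_mul]
      calc ‖mk I (a * b)‖ ≤ ‖a * b‖ := norm_mk_le I _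
        _ ≤ ‖a‖ * ‖b‖ := norm_mul_le _ _
        _ ≤ (‖mk I a‖ + δ) * (‖mk I b‖ + δ) := by gcongr
        _ ≤ _ := hδ.le }

instance : StarRing I.Quotient where
  star_involutive := by
    intro x
    obtain ⟨a, rfl⟩ := mk_surjective I x
    rw [← mk_star, ← mk_star, star_star]
  star_mul := by
    intro x y
    obtain ⟨a, rfl⟩ := mk_surjective I x
    obtain ⟨b, rfl⟩ := mk_surjective I y
    simp only [← mk_mul, ← mk_star, star_mul]
  star_add := by
    intro x y
    obtain ⟨a, rfl⟩ := mk_surjective I x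
    obtain ⟨b, rfl⟩ := mk_surjective I y
    simp only [← map_add, ← mk_star, star_add]

/-- Approximate units of `I` compute the quotient norm. -/
lemma exists_approx {j : A} (hj : j ∈ I) {ε : ℝ} (hε : 0 < ε) :
    ∃ k ∈ I, ‖j - j * k‖ < ε ∧ ∀ b : A, ‖b - b * k‖ ≤ ‖b‖ ∧ ‖b - star k * b‖ ≤ ‖b‖ := by
  let := CStarAlgebra.spectralOrder I.toSubalgebra
  have := CStarAlgebra.spectralOrderedRing I.toSubalgebra
  have hl := CStarAlgebra.increasingApproximateUnit I.toSubalgebra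
  have := hl.neBot
  let j' : I.toSubalgebra := ⟨j, hj⟩
  have h1 : ∀ᶠ k : I.toSubalgebra in CStarAlgebra.approximateUnit I.toSubalgebra,
      ‖j' - j' * k‖ < ε := by
    have := (tendsto_const_nhds (x := j')).sub (hl.tendsto_mul_left j') |>.norm
    rw [sub_self, norm_zero] at this
    exact this.eventually (gt_mem_nhds hε)
  obtain ⟨k, hk, hk0, hk1⟩ := (h1.and (hl.eventually_nonneg.and hl.eventually_norm)).exists
  refine ⟨k, k.2, hk, ?_⟩
  let := CStarAlgebra.spectralOrder A
  have := CStarAlgebra.spectralOrderedRing A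
  let := CStarAlgebra.spectralOrder (Unitization ℂ A)
  have := CStarAlgebra.spectralOrderedRing (Unitization ℂ A)
  have hk0A : (0 : A) ≤ (k : A) := by
    obtain ⟨b, hb⟩ := CStarAlgebra.nonneg_iff_eq_star_mul_self.1 hk0
    have : (k : A) = star (b : A) * (b : A) := by
      have := congrArg (Subtype.val) hb
      exact this
    rw [this]
    exact star_mul_self_nonneg _
  have hk0U : (0 : Unitization ℂ A) ≤ ((k : A) : Unitization ℂ A) := by
    obtain ⟨b, hb⟩ := CStarAlgebra.nonneg_iff_eq_star_mul_self.1 hk0A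
    rw [hb, Unitization.inr_mul, Unitization.inr_star]
    exact star_mul_self_nonneg _
  have hk1U : ((k : A) : Unitization ℂ A) ≤ 1 := by
    rw [← CStarAlgebra.norm_le_one_iff_of_nonneg _ hk0U, Unitization.norm_inr]
    exact hk1
  have hn : ‖(1 : Unitization ℂ A) - ((k : A) : Unitization ℂ A)‖ ≤ 1 := by
    rw [CStarAlgebra.norm_le_one_iff_of_nonneg _ (sub_nonneg.2 hk1U)]
    exact sub_le_self _ hk0U
  have hksa : star (k : A) = k := (IsSelfAdjoint.of_nonneg hk0A).star_eq
  intro b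
  constructor
  · rw [← Unitization.norm_inr (𝕜 := ℂ)]
    have : ((b - b * k : A) : Unitization ℂ A) = b * (1 - ((k : A) : Unitization ℂ A)) := by
      rw [mul_sub, mul_one, Unitization.inr_sub, Unitization.inr_mul]
    rw [this]
    calc _ ≤ ‖(b : Unitization ℂ A)‖ * ‖(1 : Unitization ℂ A) - ((k : A) : Unitization ℂ A)‖ :=
          norm_mul_le _ _
      _ ≤ ‖(b : Unitization ℂ A)‖ * 1 := by gcongr
      _ = ‖b‖ := by rw [mul_one, Unitization.norm_inr]
  · rw [hksa, ← Unitization.norm_inr (𝕜 := ℂ)]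
    have : ((b - k * b : A) : Unitization ℂ A) = (1 - ((k : A) : Unitization ℂ A)) * b := by
      rw [sub_mul, one_mul, Unitization.inr_sub, Unitization.inr_mul]
    rw [this]
    calc _ ≤ ‖(1 : Unitization ℂ A) - ((k : A) : Unitization ℂ A)‖ * ‖(b : Unitization ℂ A)‖ :=
          norm_mul_le _ _
      _ ≤ 1 * ‖(b : Unitization ℂ A)‖ := by gcongr
      _ = ‖b‖ := by rw [one_mul, Unitization.norm_inr]

noncomputable instance : NonUnitalCStarAlgebra I.Quotient :=
  { (inferInstance : NonUnitalNormedRing I.Quotient), (inferInstance : StarRing I.Quotient),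
    (inferInstance : CompleteSpace I.Quotient), (inferInstance : NormedSpace ℂ I.Quotient) with
    norm_mul_self_le := by
      intro x
      refine le_of_forall_pos_le_add fun ε hε => ?_
      obtain ⟨a, rfl⟩ := mk_surjective I x
      obtain ⟨c, hc, hcn⟩ := exists_lift I (star (mk I a) * mk I a) (half_pos hε)
      have hj : star a * a - c ∈ I := by
        rw [← mk_eq_mk, hc]; rfl
      obtain ⟨k, hkI, hk, hkb⟩ := exists_approx I hj (half_pos hε)
      have hmk : mk I a = mk I (a - a * k) := by
        rw [mk_eq_mk, sub_sub_cancel]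
        exact I.mul_mem_left' _ hkI
      rw [hmk]
      calc ‖mk I (a - a * k)‖ * ‖mk I (a - a * k)‖ ≤ ‖a - a * k‖ * ‖a - a * k‖ := by
            gcongr <;> exact norm_mk_le I _
        _ = ‖star (a - a * k) * (a - a * k)‖ := CStarRing.norm_star_mul_self.symm
        _ = ‖(star a * a - star a * a * k) - star k * (star a * a - star a * a * k)‖ := by
            congr 1
            simp only [star_sub, star_mul, sub_mul, mul_sub, mul_assoc]
            abel
        _ ≤ ‖star a * a - star a * a * k‖ := (hkb _).2
        _ = ‖(c - c * k) + ((star a * a - c) - (star a * a - c) * k)‖ := by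
            congr 1
            simp only [sub_mul]; abel
        _ ≤ ‖c - c * k‖ + ‖(star a * a - c) - (star a * a - c) * k‖ := norm_add_le _ _
        _ ≤ ‖c‖ + ε / 2 := add_le_add (hkb c).1 hk.le
        _ ≤ ‖star (mk I a) * mk I a‖ + ε := by linarith
        _ = _ := by rw [hmk]
    smul_assoc := by
      intro z x y
      obtain ⟨a, rfl⟩ := mk_surjective I x
      obtain ⟨b, rfl⟩ := mk_surjective I y
      simp only [smul_eq_mul, ← map_smul, ← mk_mul, smul_mul_assoc]
    smul_comm := by
      intro z x y
      obtain ⟨a, rfl⟩ := mk_surjective I x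
      obtain ⟨b, rfl⟩ := mk_surjective I y
      simp only [smul_eq_mul, ← map_smul, ← mk_mul, mul_smul_comm]
    star_smul := by
      intro z x
      obtain ⟨a, rfl⟩ := mk_surjective I x
      simp only [← map_smul, ← mk_star, star_smul] }

variable {I}

/-- The ⋆-homomorphism of quotients induced by a ⋆-homomorphism that maps `I` into `J`. -/
noncomputable def map {B : Type u} [NonUnitalCStarAlgebra B] {J : ClosedIdeal B}
    (φ : A →⋆ₙₐ[ℂ] B) (h : ∀ a ∈ I, φ a ∈ J) : I.Quotient →⋆ₙₐ[ℂ] J.Quotient where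
  toFun := I.toSubmodule.mapQ J.toSubmodule (φ : A →ₗ[ℂ] B) h
  map_smul' z x := map_smul (I.toSubmodule.mapQ J.toSubmodule (φ : A →ₗ[ℂ] B) h) z x
  map_zero' := map_zero (I.toSubmodule.mapQ J.toSubmodule (φ : A →ₗ[ℂ] B) h)
  map_add' x y := map_add (I.toSubmodule.mapQ J.toSubmodule (φ : A →ₗ[ℂ] B) h) x y
  map_mul' x y := by
    obtain ⟨a, rfl⟩ := mk_surjective I x
    obtain ⟨b, rfl⟩ := mk_surjective I y
    exact congrArg (mk J) (map_mul φ a b)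
  map_star' x := by
    obtain ⟨a, rfl⟩ := mk_surjective I x
    exact congrArg (mk J) (map_star φ a)

lemma map_mk {B : Type u} [NonUnitalCStarAlgebra B] {J : ClosedIdeal B}
    (φ : A →⋆ₙₐ[ℂ] B) (h : ∀ a ∈ I, φ a ∈ J) (a : A) : map φ h (mk I a) = mk J (φ a) := rfl

end Quotient
end ClosedIdeal
end ClosedIdeals

section Over

open OnePoint

/-- A C⋆-algebra over a (sober) topological space `X`: a C⋆-algebra `A` with a map `U ↦ A(U)`
from the open subsets of `X` to the closed ideals of `A` which preserves arbitrary suprema and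
finite infima; in particular `A(∅) = 0` and `A(X) = A`. -/
structure AlgebraOver (X : Type v) [TopologicalSpace X] (A : Type u)
    [NonUnitalCStarAlgebra A] where
  ideal : TopologicalSpace.Opens X → ClosedIdeal A
  mem_ideal_top : ∀ a : A, a ∈ ideal ⊤
  mem_ideal_inf : ∀ (U V : TopologicalSpace.Opens X) (a : A),
    a ∈ ideal (U ⊓ V) ↔ a ∈ ideal U ∧ a ∈ ideal V
  /-- `A(⋃ U)` is the smallest closed ideal that contains every `A(U)`. -/
  isLUB_ideal_sSup : ∀ S : Set (TopologicalSpace.Opens X),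
    IsLUB (ideal '' S) (ideal (sSup S))

namespace AlgebraOver

variable {X : Type v} [TopologicalSpace X] [T1Space X]
variable {A B : Type u} [NonUnitalCStarAlgebra A] [NonUnitalCStarAlgebra B]

/-- The ideal `A(X ∖ {x})`. -/
def idealCompl (𝔄 : AlgebraOver X A) (x : X) : ClosedIdeal A :=
  𝔄.ideal ⟨{x}ᶜ, isOpen_compl_singleton⟩

/-- The fibre `A(x) = A(X) / A(X ∖ {x})` at the closed point `x`. -/
abbrev Fiber (𝔄 : AlgebraOver X A) (x : X) : Type u := (𝔄.idealCompl x).Quotient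

/-- A ⋆-homomorphism is `X`-equivariant if it maps `A(U)` into `B(U)` for every open `U`. -/
def Equivariant {X : Type v} [TopologicalSpace X] (𝔄 : AlgebraOver X A) (𝔅 : AlgebraOver X B)
    (φ : A →⋆ₙₐ[ℂ] B) : Prop :=
  ∀ (U : TopologicalSpace.Opens X) (a : A), a ∈ 𝔄.ideal U → φ a ∈ 𝔅.ideal U

/-- The map `φₓ : A(x) → B(x)` induced by an equivariant ⋆-homomorphism `φ`. -/
noncomputable def Equivariant.fiberMap {𝔄 : AlgebraOver X A} {𝔅 : AlgebraOver X B}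
    {φ : A →⋆ₙₐ[ℂ] B} (h : Equivariant 𝔄 𝔅 φ) (x : X) : 𝔄.Fiber x →⋆ₙₐ[ℂ] 𝔅.Fiber x :=
  ClosedIdeal.Quotient.map φ (h _)

end AlgebraOver

end Over

section Properties

variable {A B : Type u} [NonUnitalCStarAlgebra A] [NonUnitalCStarAlgebra B]

/-- An element is full if no proper closed ideal contains it. -/
def IsFullElement (a : A) : Prop := ∀ I : ClosedIdeal A, a ∈ I → ∀ x : A, x ∈ I

/-- A ⋆-homomorphism is full if it maps every nonzero element to a full element. -/
def IsFullHom (φ : A →⋆ₙₐ[ℂ] B) : Prop := ∀ a : A, a ≠ 0 → IsFullElement (φ a)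

/-- Murray–von Neumann equivalence of projections. -/
def MurrayVonNeumannEquiv (p q : A) : Prop := ∃ v : A, star v * v = p ∧ v * star v = q

/-- Real rank zero: the invertible self-adjoint elements of the unitization are dense in its
self-adjoint elements. -/
def RealRankZero (A : Type u) [NonUnitalCStarAlgebra A] : Prop :=
  ∀ a : Unitization ℂ A, IsSelfAdjoint a → ∀ ε : ℝ, 0 < ε →
    ∃ b : Unitization ℂ A, IsSelfAdjoint b ∧ IsUnit b ∧ ‖a - b‖ < ε

/-- AF-algebras: the closure of an increasing sequence of finite-dimensional C⋆-subalgebras is the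
whole algebra. -/
def IsAF (A : Type u) [NonUnitalCStarAlgebra A] : Prop :=
  ∃ S : ℕ → NonUnitalStarSubalgebra ℂ A, Monotone S ∧
    (∀ n, FiniteDimensional ℂ (S n)) ∧ Dense (⋃ n, (S n : Set A))

/-- Approximate unitary equivalence, with unitaries in the multiplier algebra of `B`. -/
def ApproxUnitarilyEquivalent (φ ψ : A →⋆ₙₐ[ℂ] B) : Prop :=
  ∃ u : ℕ → unitary (DoubleCentralizer ℂ B), ∀ a : A,
    Tendsto (fun n => ‖(u n : DoubleCentralizer ℂ B) * DoubleCentralizer.coe ℂ (φ a) *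
      star (u n : DoubleCentralizer ℂ B) - DoubleCentralizer.coe ℂ (ψ a)‖) atTop (𝓝 0)

end Properties

section Stabilization

/-- An identification of the C⋆-algebra `T` with the C⋆-tensor product `B ⊗ 𝕂` of `B` and the
compact operators `𝕂` on `ℓ²(ℕ)`; here `unit i j b` is `b ⊗ e i j` for the matrix units `e i j`
of `𝕂`.  The finite sums of such elements form a copy of `⋃ₙ Mₙ(B)`, on which there is only one
C⋆-norm, so that these data determine `T` up to isomorphism. -/
structure CompactTensor (B T : Type u) [NonUnitalCStarAlgebra B] [NonUnitalCStarAlgebra T] where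
  unit : ℕ → ℕ → B →ₗ[ℂ] T
  unit_mul_unit : ∀ i j k l a b,
    unit i j a * unit k l b = if j = k then unit i l (a * b) else 0
  star_unit : ∀ i j b, star (unit i j b) = unit j i (star b)
  unit_injective : ∀ i j, Function.Injective (unit i j)
  dense_span : Dense (Submodule.span ℂ {t : T | ∃ i j b, t = unit i j b} : Set T)

/-- `T ≅ B ⊗ 𝕂`. -/
def IsCompactTensor (B T : Type u) [NonUnitalCStarAlgebra B] [NonUnitalCStarAlgebra T] : Prop :=
  Nonempty (CompactTensor B T)

/-- `A` is stable if `A ≅ A ⊗ 𝕂`. -/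
def IsStable (A : Type u) [NonUnitalCStarAlgebra A] : Prop := IsCompactTensor A A

end Stabilization

section Existence
open scoped ENNReal
variable (B : Type u) [NonUnitalCStarAlgebra B]

attribute [local instance] CStarAlgebra.spectralOrder CStarAlgebra.spectralOrderedRing

/-- The matrix with the entry `b` at `(i, j)` and zeros elsewhere. -/
def matrixSingle (n i j : ℕ) (b : B) : CStarMatrix (Fin n) (Fin n) B :=
  CStarMatrix.ofMatrix fun k l => if (k : ℕ) = i ∧ (l : ℕ) = j then b else 0

variable {B}

lemma matrixSingle_apply (n i j : ℕ) (b : B) (k l : Fin n) :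
    matrixSingle B n i j b k l = if (k : ℕ) = i ∧ (l : ℕ) = j then b else 0 := rfl

lemma star_matrixSingle (n i j : ℕ) (b : B) :
    star (matrixSingle B n i j b) = matrixSingle B n j i (star b) := by
  ext k l
  rw [CStarMatrix.star_apply, matrixSingle_apply, matrixSingle_apply]
  simp [apply_ite star, and_comm]

lemma matrixSingle_mul (n i j k l : ℕ) (a b : B) (hj : j < n) :
    matrixSingle B n i j a * matrixSingle B n k l b =
      if j = k then matrixSingle B n i l (a * b) else 0 := by
  ext s t
  rw [CStarMatrix.mul_apply, Finset.sum_eq_single ⟨j, hj⟩]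
  · by_cases hjk : j = k
    · subst hjk
      simp only [matrixSingle_apply]
      by_cases h1 : (s : ℕ) = i <;> by_cases h2 : (t : ℕ) = l <;> simp [h1, h2, matrixSingle_apply]
    · simp [matrixSingle_apply, hjk]
  · intro m _ hm
    have : (m : ℕ) ≠ j := fun h => hm (Fin.ext h)
    simp [matrixSingle_apply, this]
  · simp

lemma matrixSingle_mul_of_le (n i j k l : ℕ) (a b : B) (hj : n ≤ j) :
    matrixSingle B n i j a * matrixSingle B n k l b = 0 := by
  ext s t
  rw [CStarMatrix.mul_apply]
  refine Finset.sum_eq_zero fun m _ => ?_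
  have : (m : ℕ) ≠ j := by have := m.2; omega
  simp [matrixSingle_apply, this]

lemma norm_matrixSingle_le (n i j : ℕ) (b : B) : ‖matrixSingle B n i j b‖ ≤ ‖b‖ := by
  by_cases hi : i < n; swap
  · have : matrixSingle B n i j b = 0 := by
      ext s t
      have : (s : ℕ) ≠ i := by have := s.2; omega
      simp [matrixSingle_apply, this]
    rw [this, norm_zero]; exact norm_nonneg _
  let f : B →⋆ₙₐ[ℂ] CStarMatrix (Fin n) (Fin n) B :=
    { toFun := fun b => matrixSingle B n j j b
      map_smul' := fun z b => by ext; simp [matrixSingle_apply]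
      map_zero' := by ext; simp [matrixSingle_apply]
      map_add' := fun a b => by
        ext
        simp only [matrixSingle_apply, CStarMatrix.add_apply]
        split_ifs <;> simp
      map_mul' := fun a b => by
        by_cases hj : j < n
        · rw [matrixSingle_mul _ _ _ _ _ _ _ hj, if_pos rfl]
        · rw [matrixSingle_mul_of_le _ _ _ _ _ _ _ (not_lt.1 hj)]
          ext s t
          have : (s : ℕ) ≠ j := by have := s.2; omega
          simp [matrixSingle_apply, this]
      map_star' := fun a => (star_matrixSingle n j j a).symm }
  have h : ‖matrixSingle B n i j b‖ * ‖matrixSingle B n i j b‖ ≤ ‖b‖ * ‖b‖ := by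
    rw [← CStarRing.norm_star_mul_self, ← CStarRing.norm_star_mul_self (x := b),
      star_matrixSingle, matrixSingle_mul _ _ _ _ _ _ _ hi, if_pos rfl]
    exact NonUnitalStarAlgHom.norm_apply_le f (star b * b)
  exact abs_le_of_sq_le_sq' (by simpa only [sq] using h) (norm_nonneg _) |>.2

/-- Sequences `xₙ ∈ Mₙ(B)` that are bounded. -/
abbrev MatrixSeq (B : Type u) [NonUnitalCStarAlgebra B] : Type u :=
  lp (fun n : ℕ => CStarMatrix (Fin n) (Fin n) B) ∞

/-- The bounded sequence of the matrices with the single entry `b` at `(i, j)`. -/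
noncomputable def seqSingle (i j : ℕ) : B →ₗ[ℂ] MatrixSeq B where
  toFun b := ⟨fun n => matrixSingle B n i j b, memℓp_infty ⟨‖b‖, by
    rintro _ ⟨n, rfl⟩; exact norm_matrixSingle_le n i j b⟩⟩
  map_add' a b := by
    ext n s t
    simp only [matrixSingle_apply, lp.coeFn_add, Pi.add_apply, CStarMatrix.add_apply]
    split_ifs <;> simp
  map_smul' z b := by
    ext n s t
    simp [matrixSingle_apply]

lemma seqSingle_apply (i j : ℕ) (b : B) (n : ℕ) :
  (seqSingle i j b : ∀ n : ℕ, CStarMatrix (Fin n) (Fin n) B) n = matrixSingle B n i j b := rfl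

/-- The ideal of the sequences that converge to zero. -/
def nullSeq (B : Type u) [NonUnitalCStarAlgebra B] : ClosedIdeal (MatrixSeq B) where
  carrier := {x | Tendsto (fun n => ‖x n‖) atTop (𝓝 0)}
  add_mem' := by
    intro x y hx hy
    refine squeeze_zero (fun _ => norm_nonneg _) (fun n => norm_add_le (x n) (y n)) ?_
    simpa using Tendsto.add hx hy
  zero_mem' := by simp
  smul_mem' := by
    intro c x hx
    have := Tendsto.const_mul ‖c‖ hx
    simpa [norm_smul] using this
  mul_mem_left' := by
    intro x a ha
    refine squeeze_zero (fun _ => norm_nonneg _) (fun n => ?_) (by simpa using Tendsto.const_mul ‖x‖ ha)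
    calc ‖(x * a) n‖ ≤ ‖x n‖ * ‖a n‖ := norm_mul_le (x n) (a n)
      _ ≤ ‖x‖ * ‖a n‖ := by gcongr; exact lp.norm_apply_le_norm ENNReal.top_ne_zero x n
  mul_mem_right' := by
    intro x a ha
    refine squeeze_zero (fun _ => norm_nonneg _) (fun n => ?_) (by simpa using Tendsto.mul_const ‖x‖ ha)
    calc ‖(a * x) n‖ ≤ ‖a n‖ * ‖x n‖ := norm_mul_le (a n) (x n)
      _ ≤ ‖a n‖ * ‖x‖ := by gcongr; exact lp.norm_apply_le_norm ENNReal.top_ne_zero x n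
  star_mem' := by
    intro a ha
    refine ha.congr fun n => ?_
    exact (norm_star (a n)).symm
  isClosed' := by
    rw [← isSeqClosed_iff_isClosed]
    intro s x hs hx
    refine Metric.tendsto_atTop.2 fun ε hε => ?_
    obtain ⟨m, hm⟩ := (Metric.tendsto_atTop.1 hx (ε / 2) (half_pos hε))
    obtain ⟨N, hN⟩ := Metric.tendsto_atTop.1 (hs m) (ε / 2) (half_pos hε)
    refine ⟨N, fun n hn => ?_⟩
    have h1 := hN n hn
    have h2 := hm m le_rfl
    simp only [Real.dist_eq, sub_zero, abs_norm] at h1 ⊢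
    rw [dist_comm, dist_eq_norm] at h2
    have h3 : ‖(x - s m) n‖ ≤ ‖x - s m‖ := lp.norm_apply_le_norm ENNReal.top_ne_zero _ n
    calc ‖x n‖ = ‖(x - s m) n + s m n‖ := by
          congr 1; simp
      _ ≤ ‖(x - s m) n‖ + ‖s m n‖ := norm_add_le _ _
      _ < ε := by linarith

/-- The image of `b ⊗ e i j`. -/
noncomputable def quotSingle (i j : ℕ) : B →ₗ[ℂ] (nullSeq B).Quotient :=
  (ClosedIdeal.Quotient.mk (nullSeq B)).comp (seqSingle i j)

lemma quotSingle_mul (i j k l : ℕ) (a b : B) : quotSingle i j a * quotSingle k l b =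
    if j = k then quotSingle i l (a * b) else 0 := by
  have h : quotSingle i j a * quotSingle k l b =
      ClosedIdeal.Quotient.mk (nullSeq B) (if j = k then seqSingle i l (a * b) else 0) := by
    change ClosedIdeal.Quotient.mk (nullSeq B) (seqSingle i j a * seqSingle k l b) = _
    rw [ClosedIdeal.Quotient.mk_eq_mk]
    refine tendsto_const_nhds.congr' ?_
    filter_upwards [eventually_gt_atTop j] with n hn
    have := matrixSingle_mul n i j k l a b hn
    rw [eq_comm, norm_eq_zero]
    change matrixSingle B n i j a * matrixSingle B n k l b -
      ((if j = k then seqSingle i l (a * b) else 0 : MatrixSeq B) n) = 0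
    rw [this, sub_eq_zero]
    split_ifs <;> rfl
  rw [h]
  split_ifs
  · rfl
  · exact map_zero _

lemma star_quotSingle (i j : ℕ) (b : B) :
    star (quotSingle i j b) = quotSingle j i (star b) := by
  change ClosedIdeal.Quotient.mk (nullSeq B) (star (seqSingle i j b)) = _
  refine congrArg (ClosedIdeal.Quotient.mk (nullSeq B)) ?_
  refine lp.ext (funext fun n => ?_)
  exact star_matrixSingle n i j b

lemma quotSingle_injective (i j : ℕ) : Function.Injective (quotSingle (B := B) i j) := by
  rw [injective_iff_map_eq_zero]
  intro b hb
  have hb' : quotSingle i j b = ClosedIdeal.Quotient.mk (nullSeq B) 0 := by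
    rw [hb, map_zero]
  have h := (ClosedIdeal.Quotient.mk_eq_mk _).1 hb'
  rw [sub_zero] at h
  have h' : Tendsto (fun n => ‖matrixSingle B n i j b‖) atTop (𝓝 0) := h
  have : ‖b‖ ≤ 0 := by
    refine ge_of_tendsto h' ?_
    filter_upwards [eventually_gt_atTop i, eventually_gt_atTop j] with n hi hj
    have := CStarMatrix.norm_entry_le_norm (M := matrixSingle B n i j b) (i := ⟨i, hi⟩)
      (j := ⟨j, hj⟩)
    simpa [matrixSingle_apply] using this
  exact norm_le_zero_iff.1 this

/-- The linear span of the `b ⊗ e i j`, as a ⋆-subalgebra. -/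
noncomputable def finiteMatrices (B : Type u) [NonUnitalCStarAlgebra B] :
    NonUnitalStarSubalgebra ℂ (nullSeq B).Quotient :=
  { Submodule.span ℂ {t | ∃ i j b, t = quotSingle (B := B) i j b} with
    mul_mem' := by
      intro x y hx hy
      change x * y ∈ Submodule.span ℂ _
      induction hx using Submodule.span_induction with
      | mem x hx =>
        obtain ⟨i, j, a, rfl⟩ := hx
        induction hy using Submodule.span_induction with
        | mem y hy =>
          obtain ⟨k, l, b, rfl⟩ := hy
          rw [quotSingle_mul]
          split_ifs
          · exact Submodule.subset_span ⟨_, _, _, rfl⟩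
          · exact Submodule.zero_mem _
        | zero => rw [mul_zero]; exact Submodule.zero_mem _
        | add y z _ _ hy hz => rw [mul_add]; exact Submodule.add_mem _ hy hz
        | smul c y _ hy => rw [mul_smul_comm]; exact Submodule.smul_mem _ _ hy
      | zero => rw [zero_mul]; exact Submodule.zero_mem _
      | add y z _ _ hy hz => rw [add_mul]; exact Submodule.add_mem _ hy hz
      | smul c y _ hy => rw [smul_mul_assoc]; exact Submodule.smul_mem _ _ hy
    star_mem' := by
      intro x hx
      change star x ∈ Submodule.span ℂ _
      induction hx using Submodule.span_induction with
      | mem x hx =>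
        obtain ⟨i, j, a, rfl⟩ := hx
        rw [star_quotSingle]
        exact Submodule.subset_span ⟨_, _, _, rfl⟩
      | zero => rw [star_zero]; exact Submodule.zero_mem _
      | add y z _ _ hy hz => rw [star_add]; exact Submodule.add_mem _ hy hz
      | smul c y _ hy => rw [star_smul]; exact Submodule.smul_mem _ _ hy }

/-- A concrete model of `B ⊗ 𝕂`: the inductive limit of the algebras `Mₙ(B)`. -/
noncomputable abbrev Stabilization (B : Type u) [NonUnitalCStarAlgebra B] : Type u :=
  (finiteMatrices B).topologicalClosure

instance : IsClosed ((finiteMatrices B).topologicalClosure : Set (nullSeq B).Quotient) :=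
  (finiteMatrices B).isClosed_topologicalClosure

/-- Every C⋆-algebra `B` has a realization of `B ⊗ 𝕂`. -/
lemma isCompactTensor_stabilization : IsCompactTensor B (Stabilization B) := by
  have hmem : ∀ i j (b : B), quotSingle i j b ∈ (finiteMatrices B).topologicalClosure :=
    fun i j b => (finiteMatrices B).le_topologicalClosure (Submodule.subset_span ⟨i, j, b, rfl⟩)
  let un : ℕ → ℕ → B →ₗ[ℂ] Stabilization B := fun i j =>
    { toFun := fun b => ⟨quotSingle i j b, hmem i j b⟩
      map_add' := fun a b => Subtype.ext (map_add _ a b)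
      map_smul' := fun z b => Subtype.ext (map_smul _ z b) }
  refine ⟨⟨un, ?_, ?_, ?_, ?_⟩⟩
  · intro i j k l a b
    refine Subtype.ext ((quotSingle_mul i j k l a b).trans ?_)
    split_ifs <;> rfl
  · intro i j b
    exact Subtype.ext (star_quotSingle i j b)
  · intro i j a b h
    exact quotSingle_injective i j (congrArg Subtype.val h)
  · intro x
    rw [closure_subtype]
    refine closure_mono ?_ x.2
    intro y hy
    change y ∈ Submodule.span ℂ {t | ∃ i j b, t = quotSingle (B := B) i j b} at hy
    induction hy using Submodule.span_induction with
    | mem y hy =>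
      obtain ⟨i, j, b, rfl⟩ := hy
      exact ⟨un i j b, Submodule.subset_span ⟨_, _, _, rfl⟩, rfl⟩
    | zero => exact ⟨0, Submodule.zero_mem _, rfl⟩
    | add y z _ _ hy hz =>
      obtain ⟨a, ha, rfl⟩ := hy
      obtain ⟨b, hb, rfl⟩ := hz
      exact ⟨a + b, Submodule.add_mem _ ha hb, rfl⟩
    | smul c y _ hy =>
      obtain ⟨a, ha, rfl⟩ := hy
      exact ⟨c • a, Submodule.smul_mem _ _ ha, rfl⟩

end Existence

section KK

open scoped ComplexOrder

/-- A (right) Hilbert module over the C⋆-algebra `B`, with an inner product that is linear in the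
second variable. -/
structure HilbertModule (B : Type u) [NonUnitalCStarAlgebra B] where
  carrier : Type u
  [normedAddCommGroup : NormedAddCommGroup carrier]
  [normedSpace : NormedSpace ℂ carrier]
  [completeSpace : CompleteSpace carrier]
  /-- `act x b` is `x · b`. -/
  act : carrier → B → carrier
  add_act : ∀ x y b, act (x + y) b = act x b + act y b
  act_add : ∀ x b c, act x (b + c) = act x b + act x c
  act_mul : ∀ x b c, act x (b * c) = act (act x b) c
  smul_act : ∀ (z : ℂ) x b, act (z • x) b = z • act x b
  act_smul : ∀ (z : ℂ) x b, act x (z • b) = z • act x b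
  inner : carrier → carrier → B
  inner_add : ∀ x y z, inner x (y + z) = inner x y + inner x z
  inner_smul : ∀ (z : ℂ) x y, inner x (z • y) = z • inner x y
  inner_act : ∀ x y b, inner x (act y b) = inner x y * b
  star_inner : ∀ x y, star (inner x y) = inner y x
  inner_self_nonneg : ∀ x, ∃ b : B, inner x x = star b * b
  norm_sq : ∀ x, ‖x‖ ^ 2 = ‖inner x x‖

attribute [instance] HilbertModule.normedAddCommGroup HilbertModule.normedSpace
  HilbertModule.completeSpace

namespace HilbertModule

variable {B : Type u} [NonUnitalCStarAlgebra B] (E : HilbertModule B)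

/-- Bounded operators on the underlying Banach space of `E`. -/
abbrev Op : Type u := E.carrier →L[ℂ] E.carrier

/-- `T` is the adjoint of `S`. -/
def IsAdjoint (S T : E.Op) : Prop := ∀ x y, E.inner (S x) y = E.inner x (T y)

/-- The compact operators on `E`: the closed linear span of the operators
`z ↦ x · ⟨y, z⟩`. -/
def compacts : Set E.Op :=
  closure (Submodule.span ℂ {S : E.Op | ∃ x y, ∀ z, S z = E.act x (E.inner y z)} : Set E.Op)

/-- `E` is countably generated. -/
def CountablyGenerated : Prop :=
  ∃ g : ℕ → E.carrier, Dense (Submodule.span ℂ {x : E.carrier | ∃ n b, x = E.act (g n) b} :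
    Set E.carrier)

end HilbertModule

/-- A Kasparov `(D, B)`-module for trivially graded C⋆-algebras `D` and `B`: a countably generated
Hilbert `B`-module `E` with grading operator `γ`, a representation of `D` by even adjointable
operators, and an odd adjointable operator `F` such that `[F, d]`, `(F² - 1) d` and `(F - F⋆) d`
are compact for every `d` in `D`. -/
structure KasparovModule (D : Type) (B : Type u) [NonUnitalCStarAlgebra D]
    [NonUnitalCStarAlgebra B] where
  E : HilbertModule B
  countablyGenerated : E.CountablyGenerated
  γ : E.Op
  γ_sq : γ * γ = 1
  γ_adjoint : E.IsAdjoint γ γ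
  rep : D →ₙₐ[ℂ] E.Op
  rep_adjoint : ∀ d, E.IsAdjoint (rep d) (rep (star d))
  rep_even : ∀ d, γ * rep d = rep d * γ
  F : E.Op
  Fstar : E.Op
  F_adjoint : E.IsAdjoint F Fstar
  F_odd : γ * F = -(F * γ)
  commutator_mem : ∀ d, F * rep d - rep d * F ∈ E.compacts
  sq_sub_one_mem : ∀ d, (F * F - 1) * rep d ∈ E.compacts
  sub_adjoint_mem : ∀ d, (F - Fstar) * rep d ∈ E.compacts

namespace KasparovModule

variable {D : Type} [NonUnitalCStarAlgebra D]
variable {A B : Type u} [NonUnitalCStarAlgebra A] [NonUnitalCStarAlgebra B]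

/-- `y` is (unitarily equivalent to) the push-forward `x ⊗_f B` of `x` along `f : A → B`.
The map `T` is `e ↦ e ⊗ 1`; its inner products determine `x ⊗_f B`, being spanned by the
elements `(T e) · b`, up to unitary equivalence, and the operators on it are determined by
`F (e ⊗ 1) = (F e) ⊗ 1` and so on. -/
def IsPushforward (f : A →⋆ₙₐ[ℂ] B) (x : KasparovModule D A) (y : KasparovModule D B) : Prop :=
  ∃ T : x.E.carrier →ₗ[ℂ] y.E.carrier,
    (∀ e e', y.E.inner (T e) (T e') = f (x.E.inner e e')) ∧
    Dense (Submodule.span ℂ {z : y.E.carrier | ∃ e b, z = y.E.act (T e) b} :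
      Set y.E.carrier) ∧
    (∀ e, y.γ (T e) = T (x.γ e)) ∧
    (∀ d e, y.rep d (T e) = T (x.rep d e)) ∧
    (∀ e, y.F (T e) = T (x.F e))

/-- Evaluation at `t`, as a ⋆-homomorphism `C([0,1], B) → B`. -/
def evalAt (B : Type u) [NonUnitalCStarAlgebra B] (t : unitInterval) :
    C(unitInterval, B) →⋆ₙₐ[ℂ] B where
  toFun f := f t
  map_smul' _ _ := rfl
  map_zero' := rfl
  map_add' _ _ := rfl
  map_mul' _ _ := rfl
  map_star' _ := rfl

/-- `x` and `y` are the two ends of a Kasparov `(D, C([0,1], B))`-module. -/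
def Homotopic (x y : KasparovModule D B) : Prop :=
  ∃ z : KasparovModule D C(unitInterval, B),
    IsPushforward (evalAt B 0) z x ∧ IsPushforward (evalAt B 1) z y

end KasparovModule

/-- The set underlying the Kasparov group `KK(D, B)`: Kasparov modules up to homotopy. -/
def KKGroup (D : Type) (B : Type u) [NonUnitalCStarAlgebra D] [NonUnitalCStarAlgebra B] :
    Type (u + 1) :=
  Quot (KasparovModule.Homotopic (D := D) (B := B))

/-- `φ` and `ψ` induce the same map `KK(D, A) → KK(D, B)`: the classes of the push-forwards of
every Kasparov `(D, A)`-module along `φ` and along `ψ` are equal. -/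
def AgreeOnKK (D : Type) [NonUnitalCStarAlgebra D] {A B : Type u} [NonUnitalCStarAlgebra A]
    [NonUnitalCStarAlgebra B] (φ ψ : A →⋆ₙₐ[ℂ] B) : Prop :=
  ∀ (x : KasparovModule D A) (y z : KasparovModule D B),
    KasparovModule.IsPushforward φ x y → KasparovModule.IsPushforward ψ x z →
      (Quot.mk _ y : KKGroup D B) = Quot.mk _ z

/-- The suspension `C₀(ℝ, D)` of `D`. -/
abbrev Suspension (D : Type) [NonUnitalCStarAlgebra D] : Type := ZeroAtInftyContinuousMap ℝ D

/-- The C⋆-algebra `ℂ × C([0,1], Mₚ(ℂ))`. -/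
def ConeAmbient (p : ℕ) : Type := ℂ × C(unitInterval, CStarMatrix (Fin p) (Fin p) ℂ)

noncomputable instance (p : ℕ) : NonUnitalCStarAlgebra (ConeAmbient p) :=
  inferInstanceAs
    (NonUnitalCStarAlgebra (ℂ × C(unitInterval, CStarMatrix (Fin p) (Fin p) ℂ)))

/-- The mapping cone of the unital ⋆-homomorphism `ℂ → Mₚ(ℂ)`: the pairs `(z, f)` in
`ℂ × C([0,1], Mₚ(ℂ))` with `f(0) = 0` and `f(1) = z 1`. -/
noncomputable def mappingCone (p : ℕ) : NonUnitalStarSubalgebra ℂ (ConeAmbient p) where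
  carrier := {x | x.2 0 = 0 ∧ x.2 1 = x.1 • 1}
  add_mem' := by
    rintro x y ⟨hx, hx'⟩ ⟨hy, hy'⟩
    refine ⟨?_, ?_⟩
    · change x.2 0 + y.2 0 = 0
      rw [hx, hy, add_zero]
    · change x.2 1 + y.2 1 = (x.1 + y.1) • 1
      rw [hx', hy', add_smul]
  zero_mem' := ⟨rfl, (zero_smul ℂ _).symm⟩
  mul_mem' := by
    rintro x y ⟨hx, hx'⟩ ⟨hy, hy'⟩
    refine ⟨?_, ?_⟩
    · change x.2 0 * y.2 0 = 0
      rw [hx, zero_mul]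
    · change x.2 1 * y.2 1 = (x.1 * y.1) • 1
      rw [hx', hy', smul_mul_assoc, one_mul, smul_smul]
  smul_mem' := by
    rintro c x ⟨hx, hx'⟩
    refine ⟨?_, ?_⟩
    · change c • x.2 0 = 0
      rw [hx, smul_zero]
    · change c • x.2 1 = (c • x.1) • 1
      rw [hx', smul_assoc]
  star_mem' := by
    rintro x ⟨hx, hx'⟩
    refine ⟨?_, ?_⟩
    · change star (x.2 0) = 0
      rw [hx, star_zero]
    · change star (x.2 1) = star x.1 • 1
      rw [hx', star_smul, star_one]

instance isClosed_mappingCone (p : ℕ) : IsClosed (mappingCone p : Set (ConeAmbient p)) := by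
  have h : ∀ t : unitInterval, Continuous
      fun x : ℂ × C(unitInterval, CStarMatrix (Fin p) (Fin p) ℂ) => x.2 t := fun t =>
    (continuous_eval_const t).comp continuous_snd
  exact (isClosed_eq (h 0) continuous_const).inter
    (isClosed_eq (h 1) (continuous_fst.smul continuous_const))

/-- `K̲(φ) = K̲(ψ)`, that is, `φ` and `ψ` induce the same map on total K-theory: on the groups
`Kᵢ(A; ℤ/p) = KK(𝕀ₚⁱ, A)` for `i = 0, 1` and `p` zero or a prime power.  Here `𝕀₀ = ℂ`, `𝕀ₚ` is
the mapping cone of `ℂ → Mₚ(ℂ)` for `p ≠ 0`, and `𝕀ₚ⁰ = 𝕀ₚ`, `𝕀ₚ¹ = C₀(ℝ, 𝕀ₚ)`. -/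
def AgreeOnTotalK {A B : Type u} [NonUnitalCStarAlgebra A] [NonUnitalCStarAlgebra B]
    (φ ψ : A →⋆ₙₐ[ℂ] B) : Prop :=
  (AgreeOnKK ℂ φ ψ ∧ AgreeOnKK (Suspension ℂ) φ ψ) ∧
  ∀ p : ℕ, IsPrimePow p →
    AgreeOnKK (mappingCone p) φ ψ ∧ AgreeOnKK (Suspension (mappingCone p)) φ ψ

end KK

/-- The partial-isometry uniqueness property of a class `C` of C⋆-algebras: for `A` and `B` in the
class, full ⋆-homomorphisms `φ, ψ : A → B ⊗ 𝕂` that agree on total K-theory, and every nonzero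
projection `e` of `A`, the restrictions of `φ` and `ψ` to `eAe` are approximately conjugate by
partial isometries from `φ(e)` to `ψ(e)`.  Here `T` is any realization of `B ⊗ 𝕂`; one exists by
`isCompactTensor_stabilization`, and all of them are isomorphic. -/
def HasUniquenessProperty (C : ∀ (A : Type u) [NonUnitalCStarAlgebra A], Prop) : Prop :=
  ∀ (A B T : Type u) [NonUnitalCStarAlgebra A] [NonUnitalCStarAlgebra B]
    [NonUnitalCStarAlgebra T], C A → C B → IsCompactTensor B T →
    ∀ φ ψ : A →⋆ₙₐ[ℂ] T, IsFullHom φ → IsFullHom ψ → AgreeOnTotalK φ ψ →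
    ∀ e : A, IsStarProjection e → e ≠ 0 →
    ∃ v : ℕ → T, (∀ n, star (v n) * v n = φ e ∧ v n * star (v n) = ψ e) ∧
      ∀ a : A, Tendsto (fun n => ‖v n * φ (e * a * e) * star (v n) - ψ (e * a * e)‖)
        atTop (𝓝 0)

end FiberedCStar

open FiberedCStar

/-! By separability it suffices to find, for a finite set `F` and `ε > 0`, one unitary multiplier
that conjugates `φ` to `ψ` on `F` up to `ε` (`approxUnitarilyEquivalent_of_finset`). The base space
is cut into the points `0, …, N - 1` and the clopen tail `{N, …, ∞}`, and an algebra over it splits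
accordingly into a direct sum of ideals (`ClosedIdeal.exists_decomposition`). On each summand one
seeks a partial isometry in the corresponding ideal of the target that carries `φ` to `ψ` on `F` and
whose initial projection almost preserves `φ(F)` under compression (`Intertwines`). Such partial
isometries on different summands are orthogonal, so finitely many of them add up
(`Intertwines.glue`).

On the tail, the norm in the fibre at `∞` is the limit of the norms over the tails
(`AlgebraOver.eventually_norm_tail_lt`), so a relation that is exact at `∞` is almost satisfied far
out and can be corrected by functional calculus. Since the fibre is AF, `F` is close there to a
finite-dimensional algebra, whose matrix units lift (`exists_lift_matrixUnits`). On the span of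
matrix units, equivalences between the images of the diagonal projections suffice to intertwine two
homomorphisms (`MatrixUnits.exists_intertwiner`), and these are provided by the Murray–von Neumann
hypothesis. This determines `N`.

At a point `n < N` the ideal of `{n}` is isometric to the fibre. Real rank zero provides a
projection that is almost a unit for `F`, and the uniqueness property applies to its corner
(`intertwines_point`). Quotients of stable algebras are stable (`IsStable.quotient`), so the fibre
of the target serves as its own stabilization.

It remains to replace the resulting partial isometry `v` by a unitary (`exists_unitary_multiplier`).
Stability makes room: `v` is approximately a product of two approximate partial isometries whose
squares almost vanish, passing through a copy of its range that has been shifted away. If `y² = 0`,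
the self-adjoint partial isometry `y + star y` has an obvious extension to a unitary, and an
approximate version of this is enough. -/

namespace FiberedCStar

/-! ### Perturbation of approximate projections and partial isometries -/

section FunctionalCalculus

variable {A B : Type u} [NonUnitalCStarAlgebra A] [NonUnitalCStarAlgebra B]

lemma continuous_hom (π : A →⋆ₙₐ[ℂ] B) : Continuous π :=
  AddMonoidHomClass.continuous_of_bound π 1 fun a => by
    rw [one_mul]; exact NonUnitalStarAlgHom.norm_apply_le π a

lemma norm_le_one_of_isStarProjection {p : A} (hp : IsStarProjection p) : ‖p‖ ≤ 1 := by
  have h : ‖p‖ * ‖p‖ = ‖p‖ := by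
    rw [← CStarRing.norm_star_mul_self, hp.isSelfAdjoint.star_eq, hp.isIdempotentElem.eq]
  nlinarith [norm_nonneg p]

lemma eq_zero_of_isStarProjection {p : A} (hp : IsStarProjection p) (h1 : ‖p‖ < 1) : p = 0 := by
  have h : ‖p‖ * ‖p‖ = ‖p‖ := by
    rw [← CStarRing.norm_star_mul_self, hp.isSelfAdjoint.star_eq, hp.isIdempotentElem.eq]
  have : ‖p‖ = 0 := by nlinarith [norm_nonneg p]
  exact norm_eq_zero.1 this

/-- A continuous function that is `0` below `1/4` and `1` above `1/2`. -/
noncomputable def cutoff (t : ℝ) : ℝ := max 0 (min 1 (4 * t - 1))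

lemma continuous_cutoff : Continuous cutoff := by unfold cutoff; fun_prop

lemma cutoff_of_le {t : ℝ} (ht : t ≤ 1 / 4) : cutoff t = 0 := by
  unfold cutoff
  exact max_eq_left ((min_le_right _ _).trans (by linarith))

lemma cutoff_of_ge {t : ℝ} (ht : 1 / 2 ≤ t) : cutoff t = 1 := by
  unfold cutoff
  rw [min_eq_left (by linarith)]; norm_num

@[simp] lemma cutoff_zero : cutoff 0 = 0 := cutoff_of_le (by norm_num)

/-- Since `3/16 = 1/4 · 3/4`, the bound `t² - t > -3/16` says that `(t - 1/4)(t - 3/4) > 0`. -/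
lemma gap_of_norm_lt {h : A} (hs : IsSelfAdjoint h) (hn : ‖h * h - h‖ < 3 / 16) {t : ℝ}
    (ht : t ∈ quasispectrum ℝ h) : t < 1 / 4 ∨ 3 / 4 < t := by
  have h1 : cfcₙ (fun t : ℝ => t * t - t) h = h * h - h := by
    rw [cfcₙ_sub (fun t : ℝ => t * t) (fun t : ℝ => t) h, cfcₙ_mul (fun t : ℝ => t) (fun t => t) h,
      cfcₙ_id' ℝ h]
  have h2 := norm_apply_le_norm_cfcₙ (fun t : ℝ => t * t - t) h ht
  rw [h1] at h2
  have h3 := (abs_lt.1 (h2.trans_lt hn)).1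
  by_contra! hc
  nlinarith [mul_nonneg (sub_nonneg.2 hc.1) (sub_nonneg.2 hc.2)]

lemma isStarProjection_cutoff {h : A} (hs : IsSelfAdjoint h) (hn : ‖h * h - h‖ < 3 / 16) :
    IsStarProjection (cfcₙ cutoff h) := by
  have hc := continuous_cutoff
  refine ⟨?_, cfcₙ_predicate _ _⟩
  change cfcₙ cutoff h * cfcₙ cutoff h = _
  rw [← cfcₙ_mul cutoff cutoff h hc.continuousOn (by simp) hc.continuousOn (by simp)]
  refine cfcₙ_congr fun t ht => ?_
  rcases gap_of_norm_lt hs hn ht with h | h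
  · simp [cutoff_of_le h.le]
  · simp [cutoff_of_ge (show 1 / 2 ≤ t by linarith)]

/-- The cutoff fixes `0` and `1`; hence correcting `h` to a projection does not disturb an image
that already is one. -/
lemma map_cutoff (π : A →⋆ₙₐ[ℂ] B) {h : A} (hs : IsSelfAdjoint h) (hp : IsStarProjection (π h)) :
    π (cfcₙ cutoff h) = π h := by
  have hc := continuous_cutoff
  have hcont : Continuous π := continuous_hom π
  rw [NonUnitalStarAlgHomClass.map_cfcₙ (S := ℂ) π cutoff h hc.continuousOn (by simp) hcont hs
    hp.isSelfAdjoint]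
  conv_rhs => rw [← cfcₙ_id' ℝ (π h) hp.isSelfAdjoint]
  refine cfcₙ_congr fun t ht => ?_
  rcases hp.isIdempotentElem.quasispectrum_subset ℝ ht with rfl | rfl
  · simp
  · exact cutoff_of_ge (by norm_num)

/-- The factorization passes orthogonality on: `h * x = 0` forces `cfcₙ cutoff h * x = 0`. -/
lemma exists_cutoff_eq_mul {h : A} (hs : IsSelfAdjoint h) : ∃ k, cfcₙ cutoff h = k * h := by
  have hc := continuous_cutoff
  have hk : Continuous fun t : ℝ => cutoff t / max t (1 / 4) := by
    refine hc.div (by fun_prop) fun t => ?_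
    have : (1 / 4 : ℝ) ≤ max t (1 / 4) := le_max_right _ _
    linarith
  refine ⟨cfcₙ (fun t : ℝ => cutoff t / max t (1 / 4)) h, ?_⟩
  conv_rhs => enter [2]; rw [← cfcₙ_id' ℝ h hs]
  rw [← cfcₙ_mul _ _ h hk.continuousOn (by simp)]
  refine cfcₙ_congr fun t _ => ?_
  rcases le_total t (1 / 4) with h | h
  · simp [cutoff_of_le h]
  · rw [max_eq_left h]
    field_simp

/-- The function `t ↦ 1 / √t`, cut off near `0`. -/
noncomputable def invSqrtCutoff (t : ℝ) : ℝ := cutoff t / √(max t (1 / 4))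

lemma continuous_invSqrtCutoff : Continuous invSqrtCutoff := by
  unfold invSqrtCutoff
  refine continuous_cutoff.div (by fun_prop) fun t => ?_
  have : (1 / 4 : ℝ) ≤ max t (1 / 4) := le_max_right _ _
  exact (Real.sqrt_pos.2 (by linarith)).ne'

@[simp] lemma invSqrtCutoff_zero : invSqrtCutoff 0 = 0 := by simp [invSqrtCutoff]

/-- Polar decomposition inside a non-unital algebra: `k` plays the role of `(star y * y)^(-1/2)`,
truncated near `0`. The second conclusion is what makes it suitable for lifting: the correction is
invisible under any `π` for which `π y` is already an exact partial isometry with initial projection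
`π p`. -/
lemma exists_polar {y p : A} (hp : IsStarProjection p) (hy : y * p = y)
    (hn : ‖star y * y - p‖ ≤ 1 / 8) :
    ∃ k : A, star (y * k) * (y * k) = p ∧ ∀ {B : Type u} [NonUnitalCStarAlgebra B]
      (π : A →⋆ₙₐ[ℂ] B), star (π y) * π y = π p → π (y * k) = π y := by
  have hc := continuous_cutoff
  have hg := continuous_invSqrtCutoff
  set h := star y * y with hh
  have hs : IsSelfAdjoint h := IsSelfAdjoint.star_mul_self y
  have hpn := norm_le_one_of_isStarProjection hp
  have hhp : h * p = h := by rw [hh, mul_assoc, hy]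
  have hph : p * h = h := by
    have := congrArg star hhp
    rwa [star_mul, hs.star_eq, hp.isSelfAdjoint.star_eq] at this
  have hhn : ‖h‖ ≤ 9 / 8 := by
    calc ‖h‖ = ‖(h - p) + p‖ := by rw [sub_add_cancel]
      _ ≤ _ := norm_add_le _ _
      _ ≤ 9 / 8 := by linarith
  have hn' : ‖h * h - h‖ < 3 / 16 := by
    calc ‖h * h - h‖ = ‖h * (h - p)‖ := by rw [mul_sub, hhp]
      _ ≤ ‖h‖ * ‖h - p‖ := norm_mul_le _ _
      _ ≤ 9 / 8 * (1 / 8) := by gcongr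
      _ < _ := by norm_num
  have hP := isStarProjection_cutoff hs hn'
  set P := cfcₙ cutoff h with hPdef
  have hPp : P * p = P := by
    obtain ⟨k, hk⟩ := exists_cutoff_eq_mul hs
    rw [hPdef, hk, mul_assoc, hhp]
  have hpP : p * P = P := by
    have := congrArg star hPp
    rwa [star_mul, hP.isSelfAdjoint.star_eq, hp.isSelfAdjoint.star_eq] at this
  have hproj : IsStarProjection (p - P) := by
    refine ⟨?_, hp.isSelfAdjoint.sub hP.isSelfAdjoint⟩
    change (p - P) * (p - P) = p - P
    rw [sub_mul, mul_sub, mul_sub, hp.isIdempotentElem.eq, hPp, hpP, hP.isIdempotentElem.eq]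
    abel
  have hsmall : ‖h - P * h‖ ≤ 1 / 4 := by
    have : h - P * h = cfcₙ (fun t : ℝ => t - cutoff t * t) h := by
      rw [cfcₙ_sub (fun t : ℝ => t) (fun t : ℝ => cutoff t * t) h (by fun_prop) rfl
        (by fun_prop) (by simp), cfcₙ_mul cutoff (fun t => t) h hc.continuousOn (by simp),
        cfcₙ_id' ℝ h]
    rw [this]
    refine norm_cfcₙ_le fun t ht => ?_
    rcases gap_of_norm_lt hs hn' ht with h4 | h4
    · have h0 : 0 ≤ t := by
        let := CStarAlgebra.spectralOrder A
        have := CStarAlgebra.spectralOrderedRing A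
        exact quasispectrum_nonneg_of_nonneg h (star_mul_self_nonneg y) t ht
      rw [cutoff_of_le h4.le, Real.norm_eq_abs, zero_mul, sub_zero, abs_of_nonneg h0]
      exact h4.le
    · simp [cutoff_of_ge (show 1 / 2 ≤ t by linarith)]
  -- `P` is a subprojection of `p`, and projections of norm less than `1` vanish, so an estimate of
  -- `p - P` gives equality.
  have hPeq : P = p := by
    have h1 : p - P = (p - P) * (p - h) + (h - P * h) := by
      rw [mul_sub, sub_mul, sub_mul, hp.isIdempotentElem.eq, hPp, hph]; abel
    have h2 : ‖p - P‖ ≤ 1 / 2 := by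
      calc ‖p - P‖ ≤ ‖(p - P) * (p - h)‖ + ‖h - P * h‖ := by
            conv_lhs => rw [h1]
            exact norm_add_le _ _
        _ ≤ ‖p - P‖ * ‖p - h‖ + 1 / 4 := add_le_add (norm_mul_le _ _) hsmall
        _ ≤ 1 * (1 / 8) + 1 / 4 := by
            rw [norm_sub_rev p h]
            gcongr
            exact norm_le_one_of_isStarProjection hproj
        _ ≤ _ := by norm_num
    exact (sub_eq_zero.1 (eq_zero_of_isStarProjection hproj (by linarith))).symm
  refine ⟨cfcₙ invSqrtCutoff h, ?_, ?_⟩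
  · have hks : IsSelfAdjoint (cfcₙ invSqrtCutoff h) := cfcₙ_predicate _ _
    rw [star_mul, hks.star_eq, mul_assoc, ← mul_assoc (star y), ← hh, ← hPeq, hPdef]
    conv_lhs => enter [2, 1]; rw [← cfcₙ_id' ℝ h hs]
    rw [← cfcₙ_mul _ _ h (by fun_prop) rfl hg.continuousOn (by simp),
      ← cfcₙ_mul _ _ h hg.continuousOn (by simp) (by fun_prop) (by simp)]
    refine cfcₙ_congr fun t _ => ?_
    simp only [invSqrtCutoff]
    rcases le_total t (1 / 4) with h4 | h4
    · simp [cutoff_of_le h4]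
    · have ht : 0 < t := by linarith
      rw [max_eq_left h4]
      have h5 : √t * √t = t := Real.mul_self_sqrt ht.le
      have h6 : √t ≠ 0 := (Real.sqrt_pos.2 ht).ne'
      have h7 : cutoff t * cutoff t = cutoff t ∨ t < 1 / 2 := by
        rcases le_or_gt (1 / 2) t with h | h
        · simp [cutoff_of_ge h]
        · exact Or.inr h
      rcases gap_of_norm_lt hs hn' (t := t) (by assumption) with h | h
      · linarith
      · rw [cutoff_of_ge (by linarith)]
        field_simp
        nlinarith
  · intro B _ π hπ
    have hπp : IsStarProjection (π p) := hp.map π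
    have hπh : π h = π p := by rw [hh, map_mul, map_star, hπ]
    have hcont : Continuous π := continuous_hom π
    rw [map_mul, NonUnitalStarAlgHomClass.map_cfcₙ (S := ℂ) π invSqrtCutoff h hg.continuousOn (by simp)
      hcont hs (hπh ▸ hπp.isSelfAdjoint), hπh]
    have : cfcₙ invSqrtCutoff (π p) = π p := by
      conv_rhs => rw [← cfcₙ_id' ℝ (π p) hπp.isSelfAdjoint]
      refine cfcₙ_congr fun t ht => ?_
      rcases hπp.isIdempotentElem.quasispectrum_subset ℝ ht with rfl | rfl
      · simp
      · simp [invSqrtCutoff, cutoff_of_ge (show (1 / 2 : ℝ) ≤ 1 by norm_num)]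
        norm_num
    rw [this, ← map_mul, hy]

end FunctionalCalculus

end FiberedCStar

namespace FiberedCStar

/-! ### Approximate units of projections from real rank zero -/

section RealRankZero

attribute [local instance] CStarAlgebra.spectralOrder CStarAlgebra.spectralOrderedRing

/-- Cutting down by a spectral projection of an invertible self-adjoint element close to
`a - δ`. -/
lemma exists_spectral_projection {M : Type u} [CStarAlgebra M] {a b : M} (ha : 0 ≤ a)
    (hb : IsSelfAdjoint b) (hu : IsUnit b) {δ : ℝ}
    (hab : ‖a - algebraMap ℝ M δ - b‖ ≤ δ) :
    ∃ E : M, IsStarProjection E ∧ (∃ c, E * b = star c * c) ∧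
      ‖(1 - E) * a * (1 - E)‖ ≤ 2 * δ := by
  have h0 : (0 : ℝ) ∉ spectrum ℝ b := spectrum.zero_notMem ℝ hu
  -- The spectrum of the invertible `b` misses `0`, where alone the indicator function of `(0, ∞)`
  -- jumps.
  have hf : ContinuousOn (fun t : ℝ => if 0 < t then (1 : ℝ) else 0) (spectrum ℝ b) := by
    intro t ht
    have ht0 : t ≠ 0 := fun h => h0 (h ▸ ht)
    refine ContinuousAt.continuousWithinAt ?_
    rcases lt_or_gt_of_ne ht0 with h | h
    · refine continuousAt_const.congr (f := fun _ => (0 : ℝ)) ?_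
      filter_upwards [gt_mem_nhds h] with s hs
      rw [if_neg hs.not_gt]
    · refine continuousAt_const.congr (f := fun _ => (1 : ℝ)) ?_
      filter_upwards [lt_mem_nhds h] with s hs
      rw [if_pos hs]
  set f : ℝ → ℝ := fun t => if 0 < t then (1 : ℝ) else 0 with hfdef
  have hE : IsStarProjection (cfc f b) := by
    refine ⟨?_, cfc_predicate _ _⟩
    change cfc f b * cfc f b = cfc f b
    rw [← cfc_mul f f b hf hf]
    refine cfc_congr fun t _ => ?_
    simp only [hfdef]; split_ifs <;> simp
  set E := cfc f b with hEdef
  have hEb : E * b = cfc (fun t : ℝ => f t * t) b := by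
    rw [cfc_mul f (fun t => t) b hf, cfc_id' ℝ b]
  have hpos : 0 ≤ E * b := by
    rw [hEb]
    refine cfc_nonneg fun t _ => ?_
    simp only [hfdef]; split_ifs with h
    · simpa using h.le
    · simp
  have hneg : (1 - E) * b ≤ 0 := by
    have : (1 - E) * b = cfc (fun t : ℝ => t - f t * t) b := by
      rw [cfc_sub (fun t : ℝ => t) (fun t : ℝ => f t * t) b (by fun_prop)
        (hf.mul continuousOn_id), cfc_id' ℝ b, ← hEb, sub_mul, one_mul]
    rw [this]
    refine cfc_nonpos _ _ fun t _ => ?_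
    simp only [hfdef]; split_ifs with h
    · simp
    · simpa using h
  have hcomm : E * b = b * E := by
    rw [← (IsSelfAdjoint.of_nonneg hpos).star_eq, star_mul, hb.star_eq, hE.isSelfAdjoint.star_eq]
  have hE' := hE.one_sub
  refine ⟨E, hE, CStarAlgebra.nonneg_iff_eq_star_mul_self.1 hpos, ?_⟩
  have hcompr : (1 - E) * b * (1 - E) ≤ 0 := by
    have : (1 - E) * b * (1 - E) = (1 - E) * b := by
      rw [mul_assoc, mul_sub, mul_one, ← hcomm, mul_sub, ← mul_assoc (1 - E) E,
        hE.one_sub_mul_self, zero_mul, sub_zero]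
    rw [this]; exact hneg
  have hδ : 0 ≤ δ := (norm_nonneg _).trans hab
  have hsa : IsSelfAdjoint (a - algebraMap ℝ M δ - b) :=
    ((IsSelfAdjoint.of_nonneg ha).sub (IsSelfAdjoint.algebraMap M (IsSelfAdjoint.all δ))).sub hb
  -- Compression by `1 - E` makes `b` nonpositive, so this inequality leaves at most `2 * δ` of `a`.
  have hle : a ≤ b + algebraMap ℝ M (2 * δ) := by
    have h1 : a - algebraMap ℝ M δ - b ≤ algebraMap ℝ M δ :=
      hsa.le_algebraMap_norm_self.trans (algebraMap_mono M hab)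
    have h2 : algebraMap ℝ M (2 * δ) = algebraMap ℝ M δ + algebraMap ℝ M δ := by
      rw [two_mul, map_add]
    rw [h2]
    have h3 := add_le_add_left h1 (b + algebraMap ℝ M δ)
    calc a = a - algebraMap ℝ M δ - b + (b + algebraMap ℝ M δ) := by abel
      _ ≤ algebraMap ℝ M δ + (b + algebraMap ℝ M δ) := h3
      _ = _ := by abel
  have hconj := star_left_conjugate_le_conjugate hle (1 - E)
  rw [hE'.isSelfAdjoint.star_eq] at hconj
  have hE1 : (1 - E) ≤ 1 := by
    have : (0 : M) ≤ E := hE.nonneg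
    exact sub_le_self _ this
  have hup : (1 - E) * a * (1 - E) ≤ algebraMap ℝ M (2 * δ) := by
    refine hconj.trans ?_
    rw [mul_add, add_mul]
    have h4 : (1 - E) * algebraMap ℝ M (2 * δ) * (1 - E) ≤ algebraMap ℝ M (2 * δ) := by
      rw [← Algebra.commutes, mul_assoc, hE'.isIdempotentElem.eq, ← Algebra.smul_def,
        Algebra.algebraMap_eq_smul_one]
      exact smul_le_smul_of_nonneg_left hE1 (by positivity)
    calc _ ≤ 0 + algebraMap ℝ M (2 * δ) := add_le_add hcompr h4
      _ = _ := zero_add _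
  have hnn : 0 ≤ (1 - E) * a * (1 - E) := by
    have := star_left_conjugate_nonneg ha (1 - E)
    rwa [hE'.isSelfAdjoint.star_eq] at this
  exact (CStarAlgebra.norm_le_iff_le_algebraMap _ (by positivity) hnn).2 hup

variable {A : Type u} [NonUnitalCStarAlgebra A]

lemma exists_approx_unit (F : Finset A) {ε : ℝ} (hε : 0 < ε) :
    ∃ k : A, 0 ≤ k ∧ ‖k‖ ≤ 1 ∧ (∀ f ∈ F, ‖f - k * f‖ < ε) ∧ ∀ f ∈ F, ‖f - f * k‖ < ε := by
  have hl := CStarAlgebra.increasingApproximateUnit A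
  have := hl.neBot
  have h1 : ∀ᶠ k : A in CStarAlgebra.approximateUnit A, ∀ f ∈ F, ‖f - k * f‖ < ε := by
    rw [Filter.eventually_all_finset]
    intro f _
    have := (tendsto_const_nhds (x := f)).sub (hl.tendsto_mul_right f) |>.norm
    rw [sub_self, norm_zero] at this
    exact this.eventually (gt_mem_nhds hε)
  have h2 : ∀ᶠ k : A in CStarAlgebra.approximateUnit A, ∀ f ∈ F, ‖f - f * k‖ < ε := by
    rw [Filter.eventually_all_finset]
    intro f _
    have := (tendsto_const_nhds (x := f)).sub (hl.tendsto_mul_left f) |>.norm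
    rw [sub_self, norm_zero] at this
    exact this.eventually (gt_mem_nhds hε)
  obtain ⟨k, hk1, hk2, hk0, hk⟩ :=
    (h1.and (h2.and (hl.eventually_nonneg.and hl.eventually_norm))).exists
  exact ⟨k, hk0, hk, hk1, hk2⟩

/-- With an approximate unit element `k`, a positive spectral projection of an invertible
perturbation of `k * star k - δ` almost acts as a unit on `k`, hence on `F`. The shift by `δ` keeps
this projection inside `A`. -/
lemma RealRankZero.exists_projection_left (hA : RealRankZero A) (F : Finset A) {ε : ℝ}
    (hε : 0 < ε) : ∃ e : A, IsStarProjection e ∧ ∀ f ∈ F, ‖f - e * f‖ < ε := by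
  obtain ⟨k, hk0, hk1, hkF, -⟩ := exists_approx_unit F (ε := ε / 3) (by positivity)
  let M := Unitization ℂ A
  let a : M := ((k * star k : A) : M)
  have ha : 0 ≤ a := by
    have : a = (k : M) * star (k : M) := by
      simp only [a, Unitization.inr_mul, Unitization.inr_star]
    rw [this]; exact mul_star_self_nonneg _
  obtain ⟨C, hC⟩ : ∃ C : ℝ, 0 < C ∧ ∀ f ∈ F, ‖f‖ ≤ C := by
    refine ⟨1 + ∑ f ∈ F, ‖f‖, by positivity, fun f hf => ?_⟩
    have := Finset.single_le_sum (f := fun f : A => ‖f‖) (fun f _ => norm_nonneg f) hf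
    linarith
  obtain ⟨η, hη, hη'⟩ : ∃ η : ℝ, 0 < η ∧ η * C < ε / 3 :=
    ⟨ε / 6 / C, by have := hC.1; positivity, by
      rw [div_mul_cancel₀ _ hC.1.ne']; linarith⟩
  -- Chosen so that `‖k - e * k‖² = ‖(1 - E) * a * (1 - E)‖ ≤ 2 * δ = η²`.
  let δ : ℝ := η ^ 2 / 2
  have hδ : 0 < δ := by positivity
  obtain ⟨b, hb, hu, hab⟩ := hA (a - algebraMap ℝ M δ)
    ((IsSelfAdjoint.of_nonneg ha).sub (IsSelfAdjoint.algebraMap M (IsSelfAdjoint.all δ))) δ hδ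
  obtain ⟨E, hE, ⟨c, hc⟩, hEa⟩ := exists_spectral_projection ha hb hu hab.le
  -- The scalar part of `a - δ` is `-δ`, and `b` is strictly closer to it than `δ`.
  have hbfst : b.fst.re < 0 := by
    have h1 : ‖(a - algebraMap ℝ M δ - b).fst‖ ≤ ‖a - algebraMap ℝ M δ - b‖ := by
      rw [Unitization.norm_def]
      simp [Unitization.splitMul_apply, Prod.norm_def]
    have h2 : (a - algebraMap ℝ M δ - b).fst = -(δ : ℂ) - b.fst := by
      have h3 : (algebraMap ℝ M δ).fst = (δ : ℂ) := (Unitization.fstHom ℂ A).commutes (δ : ℂ)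
      rw [sub_eq_add_neg, sub_eq_add_neg, Unitization.fst_add, Unitization.fst_add,
        Unitization.fst_neg, Unitization.fst_neg, h3, Unitization.fst_inr, zero_add,
        ← sub_eq_add_neg]
    rw [h2] at h1
    have h3 := (Complex.abs_re_le_norm _).trans_lt (h1.trans_lt hab)
    simp only [Complex.sub_re, Complex.neg_re, Complex.ofReal_re] at h3
    have := (abs_lt.1 h3).1
    linarith
  -- The scalar part of `E` is `0` or `1`; the value `1` would give `b`, whose scalar part is
  -- negative, the scalar part of the positive element `star c * c`.
  have hEfst : E.fst = 0 := by
    have hid : E.fst * E.fst = E.fst := by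
      rw [← Unitization.fst_mul, hE.isIdempotentElem.eq]
    have hEb : E.fst * b.fst = star c.fst * c.fst := by
      rw [← Unitization.fst_mul, hc, Unitization.fst_mul, Unitization.fst_star]
    by_contra hne
    have h1 : E.fst = 1 := by
      have : E.fst * E.fst = E.fst * 1 := by rw [hid, mul_one]
      exact mul_left_cancel₀ hne this
    rw [h1, one_mul] at hEb
    have h2 : b.fst.re = ‖c.fst‖ ^ 2 := by
      rw [hEb, Complex.star_def, ← Complex.normSq_eq_conj_mul_self, Complex.ofReal_re,
        Complex.normSq_eq_norm_sq]
    nlinarith [sq_nonneg ‖c.fst‖]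
  have hEe : E = ((E.snd : A) : M) := by
    ext
    · simpa using hEfst
    · simp
  set e := E.snd
  have hinj : Function.Injective ((↑) : A → M) := Unitization.inr_injective
  have he : IsStarProjection e := by
    refine ⟨hinj ?_, hinj ?_⟩
    · rw [Unitization.inr_mul, ← hEe]; exact hE.isIdempotentElem
    · rw [Unitization.inr_star, ← hEe]; exact hE.isSelfAdjoint
  refine ⟨e, he, fun f hf => ?_⟩
  have hkn : ‖k - e * k‖ ≤ η := by
    have h1 : ((k - e * k : A) : M) = (1 - E) * (k : M) := by
      rw [sub_mul, one_mul, Unitization.inr_sub, Unitization.inr_mul, ← hEe]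
    have h2 : ‖k - e * k‖ * ‖k - e * k‖ ≤ η ^ 2 := by
      rw [← Unitization.norm_inr (𝕜 := ℂ), h1, ← CStarRing.norm_self_mul_star, star_mul,
        hE.one_sub.isSelfAdjoint.star_eq]
      have h3 : (1 - E) * (k : M) * (star (k : M) * (1 - E)) = (1 - E) * a * (1 - E) := by
        simp only [a, Unitization.inr_mul, Unitization.inr_star, mul_assoc]
      rw [h3]
      refine hEa.trans (le_of_eq ?_)
      simp only [δ]; ring
    nlinarith [norm_nonneg (k - e * k)]
  have hen := norm_le_one_of_isStarProjection he
  have h4 : f - e * f = (k - e * k) * f + ((f - k * f) - e * (f - k * f)) := by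
    simp only [sub_mul, mul_sub, mul_assoc]; abel
  have h5 := hkF f hf
  calc ‖f - e * f‖ ≤ ‖(k - e * k) * f‖ + (‖f - k * f‖ + ‖e * (f - k * f)‖) := by
        rw [h4]
        exact (norm_add_le _ _).trans (add_le_add_right (norm_sub_le _ _) _)
    _ ≤ η * C + (‖f - k * f‖ + 1 * ‖f - k * f‖) := by
        gcongr
        · exact (norm_mul_le _ _).trans (by gcongr; exact hC.2 f hf)
        · exact (norm_mul_le _ _).trans (by gcongr)
    _ < ε := by linarith

lemma RealRankZero.exists_projection (hA : RealRankZero A) (F : Finset A) {ε : ℝ}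
    (hε : 0 < ε) : ∃ e : A, IsStarProjection e ∧ ∀ f ∈ F, ‖f - e * f * e‖ < ε := by
  classical
  obtain ⟨e, he, heF⟩ := hA.exists_projection_left (F ∪ F.image star) (half_pos hε)
  refine ⟨e, he, fun f hf => ?_⟩
  have h1 := heF f (Finset.mem_union_left _ hf)
  have h2 := heF (star f) (Finset.mem_union_right _ (Finset.mem_image_of_mem _ hf))
  have h3 : ‖f - f * e‖ < ε / 2 := by
    rw [← norm_star, star_sub, star_mul, he.isSelfAdjoint.star_eq]; exact h2
  have hen := norm_le_one_of_isStarProjection he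
  calc ‖f - e * f * e‖ = ‖(f - e * f) + e * (f - f * e)‖ := by
        congr 1; simp only [mul_sub, mul_assoc]; abel
    _ ≤ ‖f - e * f‖ + ‖e‖ * ‖f - f * e‖ := (norm_add_le _ _).trans (by gcongr; exact norm_mul_le _ _)
    _ ≤ ‖f - e * f‖ + 1 * ‖f - f * e‖ := by gcongr
    _ < ε := by linarith

end RealRankZero

end FiberedCStar

namespace FiberedCStar

/-! ### Matrix units in finite-dimensional C⋆-algebras -/

section FiniteDimensional

/-- A nonzero projection `p` with `p D p = ℂ p`. -/
structure IsMinimalProjection {D : Type u} [NonUnitalCStarAlgebra D] (p : D) : Prop where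
  proj : IsStarProjection p
  ne_zero : p ≠ 0
  corner : ∀ d, ∃ c : ℂ, p * d * p = c • p

variable {D : Type u} [NonUnitalCStarAlgebra D]

lemma finite_quasispectrum_of_finiteDimensional [FiniteDimensional ℂ D] (h : D) :
    (quasispectrum ℝ h).Finite := by
  rw [Unitization.quasispectrum_eq_spectrum_inr' ℝ ℂ h]
  have : FiniteDimensional ℂ (Unitization ℂ D) :=
    (Unitization.linearEquiv ℂ ℂ D).symm.finiteDimensional
  have : FiniteDimensional ℝ (Unitization ℂ D) := FiniteDimensional.complexToReal _
  set a : Unitization ℂ D := (h : Unitization ℂ D)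
  have hint : IsIntegral ℝ a := Algebra.IsIntegral.isIntegral a
  refine ((minpoly ℝ a).roots.toFinset.finite_toSet).subset fun t ht => ?_
  have h1 := spectrum.subset_polynomial_aeval a (minpoly ℝ a) ⟨t, ht, rfl⟩
  rw [minpoly.aeval] at h1
  have h2 : (minpoly ℝ a).eval t = 0 := by simpa using h1
  simpa using ⟨minpoly.ne_zero hint, h2⟩

/-- The spectrum is finite, so the indicator function of a nonzero eigenvalue is continuous on it.
The factorization `P = k * h` shows that right units of `h` are right units of `P`. -/
lemma exists_eigenprojection [FiniteDimensional ℂ D] {h : D} (hs : IsSelfAdjoint h)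
    (h0 : h ≠ 0) : ∃ P k : D, ∃ t : ℝ, IsStarProjection P ∧ P ≠ 0 ∧ P = k * h ∧ h * P = t • P := by
  have hfin := finite_quasispectrum_of_finiteDimensional h
  have hcont : ∀ f : ℝ → ℝ, ContinuousOn f (quasispectrum ℝ h) := by
    intro f
    have := hfin.to_subtype
    rw [continuousOn_iff_continuous_domRestrict]
    exact continuous_of_discreteTopology
  obtain ⟨t, ht, ht0⟩ : ∃ t ∈ quasispectrum ℝ h, t ≠ 0 := by
    by_contra! hc
    exact h0 (CFC.eq_zero_of_quasispectrum_eq_zero (R := ℝ) h hc hs)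
  set f : ℝ → ℝ := fun s => if s = t then 1 else 0 with hf
  have hf0 : f 0 = 0 := if_neg ht0.symm
  have hmul : h * cfcₙ f h = t • cfcₙ f h := by
    conv_lhs => enter [1]; rw [← cfcₙ_id' ℝ h hs]
    rw [← cfcₙ_mul _ f h (by fun_prop) rfl (hcont _) hf0, ← cfcₙ_smul t f h (hcont _) hf0]
    refine cfcₙ_congr fun s _ => ?_
    by_cases hst : s = t <;> simp [hf, hst]
  refine ⟨cfcₙ f h, cfcₙ (fun s => t⁻¹ * f s) h, t, ⟨?_, cfcₙ_predicate _ _⟩, ?_, ?_, hmul⟩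
  · change cfcₙ f h * cfcₙ f h = cfcₙ f h
    rw [← cfcₙ_mul f f h (hcont _) hf0 (hcont _) hf0]
    refine cfcₙ_congr fun s _ => ?_
    by_cases hst : s = t <;> simp [hf, hst]
  · intro hz
    have := norm_apply_le_norm_cfcₙ f h ht (hcont _) hf0 hs
    rw [hz] at this
    norm_num [hf] at this
  · conv_rhs => enter [2]; rw [← cfcₙ_id' ℝ h hs]
    rw [← cfcₙ_mul _ _ h (hcont _) (by simp [hf0]) (by fun_prop) rfl]
    refine cfcₙ_congr fun s _ => ?_
    by_cases hst : s = t
    · simp [hf, hst, ht0]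
    · simp [hf, hst]

/-- The compression `d ↦ p d p`. -/
noncomputable def compression (p : D) : D →ₗ[ℂ] D :=
  (LinearMap.mulRight ℂ p).comp (LinearMap.mulLeft ℂ p)

lemma compression_apply (p d : D) : compression p d = p * d * p := rfl

-- A nonzero projection `p` whose corner has least dimension is minimal: an eigenprojection `P` of a
-- nonzero self-adjoint element of `p D p` has a corner contained in that of `p`, so the corners
-- coincide and `P = p`.
open scoped ComplexStarModule in
lemma exists_isMinimalProjection [FiniteDimensional ℂ D] [Nontrivial D] :
    ∃ p : D, IsMinimalProjection p := by
  classical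
  have hex : ∃ n : ℕ, ∃ p : D, IsStarProjection p ∧ p ≠ 0 ∧
      Module.finrank ℂ (LinearMap.range (compression p)) = n := by
    obtain ⟨d, hd⟩ := exists_ne (0 : D)
    have hd' : star d * d ≠ 0 := fun h => hd (CStarRing.star_mul_self_eq_zero_iff d |>.1 h)
    obtain ⟨P, k, t, hP, hP0, -⟩ := exists_eigenprojection (IsSelfAdjoint.star_mul_self d) hd'
    exact ⟨_, P, hP, hP0, rfl⟩
  obtain ⟨p, hp, hp0, hpn⟩ := Nat.find_spec hex
  have hsa : ∀ h : D, IsSelfAdjoint h → ∃ c : ℂ, p * h * p = c • p := by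
    intro h hh
    set g := p * h * p with hg
    have hgs : IsSelfAdjoint g := by
      rw [isSelfAdjoint_iff, hg, star_mul, star_mul, hh.star_eq, hp.isSelfAdjoint.star_eq,
        mul_assoc]
    by_cases hg0 : g = 0
    · exact ⟨0, by rw [hg0, zero_smul]⟩
    obtain ⟨P, k, t, hP, hP0, hPk, hPt⟩ := exists_eigenprojection hgs hg0
    have hgp : g * p = g := by rw [hg, mul_assoc, hp.isIdempotentElem.eq]
    have hPp : P * p = P := by rw [hPk, mul_assoc, hgp]
    have hpP : p * P = P := by
      have := congrArg star hPp
      rwa [star_mul, hP.isSelfAdjoint.star_eq, hp.isSelfAdjoint.star_eq] at this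
    have hle : LinearMap.range (compression P) ≤ LinearMap.range (compression p) := by
      rintro _ ⟨d, rfl⟩
      refine ⟨P * d * P, ?_⟩
      rw [compression_apply, compression_apply, mul_assoc, mul_assoc, hPp, ← mul_assoc,
        ← mul_assoc, hpP]
    have hmem : p ∈ LinearMap.range (compression P) := by
      have heq := Submodule.eq_of_le_of_finrank_le hle
        (hpn.trans_le (Nat.find_min' hex ⟨P, hP, hP0, rfl⟩))
      rw [heq]
      exact ⟨p, by rw [compression_apply, hp.isIdempotentElem.eq, hp.isIdempotentElem.eq]⟩
    obtain ⟨d, hd⟩ := hmem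
    have hpeq : p = P := by
      rw [← hPp]
      conv_rhs => rw [← hd]
      conv_lhs => rw [← hd]
      rw [compression_apply, ← mul_assoc, ← mul_assoc, hP.isIdempotentElem.eq]
    refine ⟨(t : ℂ), ?_⟩
    rw [← hgp]
    conv_lhs => rw [hpeq, hPt, ← hpeq]
    rfl
  refine ⟨p, hp, hp0, fun d => ?_⟩
  obtain ⟨a, ha⟩ := hsa (ℜ d) (ℜ d).2
  obtain ⟨b, hb⟩ := hsa (ℑ d) (ℑ d).2
  refine ⟨a + Complex.I * b, ?_⟩
  conv_lhs => rw [← realPart_add_I_smul_imaginaryPart d]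
  rw [mul_add, add_mul, mul_smul_comm, smul_mul_assoc, ha, hb, add_smul, mul_smul]

/-- Orthogonal projections `p i`, and partial isometries `x i` from `p (r i)` into `p i`. -/
structure MatrixUnits {ι : Type} (r : ι → ι) (p x : ι → D) : Prop where
  proj : ∀ i, IsStarProjection (p i)
  orth : ∀ i j, i ≠ j → p i * p j = 0
  left : ∀ i, p i * x i = x i
  star_mul_self : ∀ i, star (x i) * x i = p (r i)

/-- The subalgebra of the elements orthogonal to a self-adjoint element. -/
def annihilator (Q : D) : NonUnitalStarSubalgebra ℂ D where
  carrier := {d | d * Q = 0 ∧ Q * d = 0 ∧ d * star Q = 0 ∧ star Q * d = 0}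
  add_mem' := by
    rintro a b ⟨h1, h2, h3, h4⟩ ⟨h1', h2', h3', h4'⟩
    simp [add_mul, mul_add, *]
  zero_mem' := by simp
  mul_mem' := by
    rintro a b ⟨h1, h2, h3, h4⟩ ⟨h1', h2', h3', h4'⟩
    refine ⟨?_, ?_, ?_, ?_⟩
    · rw [mul_assoc, h1', mul_zero]
    · rw [← mul_assoc, h2, zero_mul]
    · rw [mul_assoc, h3', mul_zero]
    · rw [← mul_assoc, h4, zero_mul]
  smul_mem' := by
    rintro c a ⟨h1, h2, h3, h4⟩
    simp [smul_mul_assoc, mul_smul_comm, *]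
  star_mem' := by
    rintro a ⟨h1, h2, h3, h4⟩
    refine ⟨?_, ?_, ?_, ?_⟩
    · have := congrArg star h4; simpa using this
    · have := congrArg star h3; simpa using this
    · have := congrArg star h2; simpa using this
    · have := congrArg star h1; simpa using this

lemma mem_annihilator {Q d : D} (hQ : IsSelfAdjoint Q) :
    d ∈ annihilator Q ↔ d * Q = 0 ∧ Q * d = 0 := by
  change _ ∧ _ ∧ _ ∧ _ ↔ _
  rw [hQ.star_eq]
  tauto

lemma isStarProjection_sum {ι : Type} (s : Finset ι) {p : ι → D}
    (hp : ∀ i ∈ s, IsStarProjection (p i))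
    (ho : ∀ i ∈ s, ∀ j ∈ s, i ≠ j → p i * p j = 0) : IsStarProjection (∑ i ∈ s, p i) := by
  refine ⟨?_, ?_⟩
  · change _ * _ = _
    rw [Finset.sum_mul_sum]
    refine Finset.sum_congr rfl fun i hi => ?_
    rw [Finset.sum_eq_single_of_mem i hi fun j hj hij => ho i hi j hj hij.symm]
    exact (hp i hi).isIdempotentElem
  · rw [isSelfAdjoint_iff, star_sum]
    exact Finset.sum_congr rfl fun i hi => (hp i hi).isSelfAdjoint

/-- A maximal orthogonal family of minimal projections sums up to a unit. -/
lemma exists_minimal_family [FiniteDimensional ℂ D] : ∃ (m : ℕ) (p : Fin m → D),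
    (∀ i, IsMinimalProjection (p i)) ∧ (∀ i j, i ≠ j → p i * p j = 0) ∧
      ∀ d, (∑ i, p i) * d = d := by
  classical
  let P : ℕ → Prop := fun m => ∃ p : Fin m → D,
    (∀ i, IsMinimalProjection (p i)) ∧ (∀ i j, i ≠ j → p i * p j = 0)
  have hbound : ∀ m, P m → m ≤ Module.finrank ℂ D := by
    rintro m ⟨p, hp, ho⟩
    have hli : LinearIndependent ℂ p := by
      rw [Fintype.linearIndependent_iff]
      intro g hg i
      have h1 : p i * ∑ j, g j • p j = g i • p i := by
        rw [Finset.mul_sum, Finset.sum_eq_single i]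
        · rw [mul_smul_comm, (hp i).proj.isIdempotentElem.eq]
        · intro j _ hj
          rw [mul_smul_comm, ho i j hj.symm, smul_zero]
        · simp
      rw [hg, mul_zero] at h1
      exact (smul_eq_zero.1 h1.symm).resolve_right (hp i).ne_zero
    simpa using hli.fintype_card_le_finrank
  -- Orthogonal nonzero projections are linearly independent, so the size of such families is
  -- bounded and a maximal `m` exists.
  obtain ⟨m, hm, hm'⟩ : ∃ m, P m ∧ ¬ P (m + 1) := by
    by_contra! hc
    have : ∀ m, P m := fun m => Nat.rec ⟨Fin.elim0, fun i => i.elim0, fun i => i.elim0⟩ hc m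
    have := hbound _ (this (Module.finrank ℂ D + 1))
    omega
  obtain ⟨p, hp, ho⟩ := hm
  refine ⟨m, p, hp, ho, ?_⟩
  set Q := ∑ i, p i with hQ
  have hQp : IsStarProjection Q :=
    isStarProjection_sum _ (fun i _ => (hp i).proj) fun i _ j _ => ho i j
  have hpQ : ∀ i, p i * Q = p i := by
    intro i
    rw [hQ, Finset.mul_sum, Finset.sum_eq_single i]
    · exact (hp i).proj.isIdempotentElem
    · exact fun j _ hj => ho i j hj.symm
    · simp
  have hQp' : ∀ i, Q * p i = p i := by
    intro i
    have := congrArg star (hpQ i)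
    rwa [star_mul, hQp.isSelfAdjoint.star_eq, (hp i).proj.isSelfAdjoint.star_eq] at this
  have hE : ∀ d ∈ annihilator Q, d = 0 := by
    by_contra! hc
    obtain ⟨d, hd, hd0⟩ := hc
    have : IsClosed (annihilator Q : Set D) :=
      Submodule.closed_of_finiteDimensional (annihilator Q).toSubmodule
    have : Nontrivial (annihilator Q) :=
      ⟨⟨d, hd⟩, 0, fun h => hd0 (congrArg Subtype.val h)⟩
    have : FiniteDimensional ℂ (annihilator Q) :=
      inferInstanceAs (FiniteDimensional ℂ (annihilator Q).toSubmodule)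
    obtain ⟨e, he⟩ := exists_isMinimalProjection (D := annihilator Q)
    have heP : IsStarProjection (e : D) :=
      ⟨congrArg Subtype.val he.proj.isIdempotentElem, congrArg Subtype.val he.proj.isSelfAdjoint⟩
    obtain ⟨he1, he2⟩ := (mem_annihilator hQp.isSelfAdjoint).1 e.2
    -- Minimality in the annihilator implies minimality in `D`, as `e * d * e` lies in the
    -- annihilator for every `d` in `D`.
    have hemin : IsMinimalProjection (e : D) := by
      refine ⟨heP, fun h => he.ne_zero (Subtype.ext h), fun d => ?_⟩
      have hmem : (e : D) * d * e ∈ annihilator Q := by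
        rw [mem_annihilator hQp.isSelfAdjoint]
        constructor
        · rw [mul_assoc, he1, mul_zero]
        · rw [← mul_assoc, ← mul_assoc, he2, zero_mul, zero_mul]
      obtain ⟨c, hc⟩ := he.corner ⟨_, hmem⟩
      refine ⟨c, ?_⟩
      have h1 : (e : D) * (e * d * e) * e = c • (e : D) := congrArg Subtype.val hc
      rw [← h1, ← mul_assoc, ← mul_assoc, heP.isIdempotentElem.eq, mul_assoc _ (e : D),
        heP.isIdempotentElem.eq]
    refine hm' ⟨Fin.snoc p (e : D), ?_, ?_⟩
    · intro i
      refine Fin.lastCases ?_ (fun i => ?_) i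
      · simpa using hemin
      · simpa using hp i
    · intro i j
      refine Fin.lastCases ?_ (fun i => ?_) i <;> refine Fin.lastCases ?_ (fun j => ?_) j
      · simp
      · intro _
        simp only [Fin.snoc_last, Fin.snoc_castSucc]
        rw [← hQp' j, ← mul_assoc, he1, zero_mul]
      · intro _
        simp only [Fin.snoc_last, Fin.snoc_castSucc]
        rw [← hpQ i, mul_assoc, he2, mul_zero]
      · intro hij
        simp only [Fin.snoc_castSucc]
        exact ho i j fun h => hij (by rw [h])
  intro d
  have hz : Q * (d - Q * d) = 0 := by
    rw [mul_sub, ← mul_assoc, hQp.isIdempotentElem.eq, sub_self]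
  -- The element `d - Q * d` is annihilated by `Q` only from the left; multiplying by its adjoint
  -- makes this two-sided.
  have h2 := hE ((d - Q * d) * star (d - Q * d)) (by
    rw [mem_annihilator hQp.isSelfAdjoint]
    refine ⟨?_, by rw [← mul_assoc, hz, zero_mul]⟩
    have := congrArg star hz
    rw [star_mul, hQp.isSelfAdjoint.star_eq, star_zero] at this
    rw [mul_assoc, this, mul_zero])
  rw [CStarRing.mul_star_self_eq_zero_iff] at h2
  exact (sub_eq_zero.1 h2).symm

/-- By minimality `star y * y` is a scalar multiple of `q`, and the scalar is positive; hence `y`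
can be normalized to `x`. Then `x * star x` is a nonzero idempotent multiple of `p`, so it equals
`p`. -/
lemma exists_partialIsometry {p q d : D} (hp : IsMinimalProjection p) (hq : IsMinimalProjection q)
    (h : p * d * q ≠ 0) : ∃ x : D, star x * x = q ∧ x * star x = p := by
  set y := p * d * q with hy
  have hpy : p * y = y := by rw [hy, ← mul_assoc, ← mul_assoc, hp.proj.isIdempotentElem.eq]
  obtain ⟨c, hc⟩ : ∃ c : ℂ, star y * y = c • q := by
    obtain ⟨c, hc⟩ := hq.corner (star d * p * d)
    refine ⟨c, ?_⟩
    rw [← hc, hy, star_mul, star_mul, hp.proj.isSelfAdjoint.star_eq, hq.proj.isSelfAdjoint.star_eq]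
    simp only [mul_assoc]
    rw [← mul_assoc p p, hp.proj.isIdempotentElem.eq]
  have hne : star y * y ≠ 0 := fun h0 => h ((CStarRing.star_mul_self_eq_zero_iff y).1 h0)
  have hcr : (starRingEnd ℂ) c = c := by
    have h1 := (IsSelfAdjoint.star_mul_self y).star_eq
    rw [hc, star_smul, hq.proj.isSelfAdjoint.star_eq, ← sub_eq_zero, ← sub_smul] at h1
    exact sub_eq_zero.1 ((smul_eq_zero.1 h1).resolve_right hq.ne_zero)
  obtain ⟨t, rfl⟩ := Complex.conj_eq_iff_real.1 hcr
  have ht : 0 < t := by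
    by_contra! hneg
    let := CStarAlgebra.spectralOrder D
    have := CStarAlgebra.spectralOrderedRing D
    have h1 : 0 ≤ star y * y := star_mul_self_nonneg y
    have h2 : 0 ≤ (-t) • q := smul_nonneg (by linarith) hq.proj.nonneg
    have h3 : (-t) • q = -(star y * y) := by rw [hc, neg_smul]; rfl
    rw [h3] at h2
    exact hne (le_antisymm (neg_nonneg.1 h2) h1)
  have hx : star ((√t)⁻¹ • y) * ((√t)⁻¹ • y) = q := by
    rw [star_smul, smul_mul_smul_comm, hc, star_trivial, ← mul_inv, Real.mul_self_sqrt ht.le]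
    change t⁻¹ • t • q = q
    rw [smul_smul, inv_mul_cancel₀ ht.ne', one_smul]
  set x := (√t)⁻¹ • y
  have hpx : p * x = x := by simp only [x, mul_smul_comm, hpy]
  refine ⟨x, hx, ?_⟩
  obtain ⟨c, hc⟩ := hp.corner (x * star x)
  have h1 : p * (x * star x) * p = x * star x := by
    have := congrArg star hpx
    rw [star_mul, hp.proj.isSelfAdjoint.star_eq] at this
    rw [← mul_assoc, hpx, mul_assoc, this]
  rw [h1] at hc
  have hid : IsIdempotentElem (x * star x) :=
    isIdempotentElem_star_mul_self_iff_isIdempotentElem_self_mul_star.1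
      (hx ▸ hq.proj.isIdempotentElem)
  rw [hc] at hid
  have h2 : (c * c - c) • p = 0 := by
    have := hid.eq
    rw [smul_mul_smul_comm, hp.proj.isIdempotentElem.eq] at this
    rw [sub_smul, this, sub_self]
  have h3 := (smul_eq_zero.1 h2).resolve_right hp.ne_zero
  have h4 : c ≠ 0 := by
    rintro rfl
    rw [zero_smul, CStarRing.mul_star_self_eq_zero_iff] at hc
    exact hq.ne_zero (by rw [← hx, hc, mul_zero])
  have h5 : c = 1 := by
    have : c * (c - 1) = 0 := by rw [mul_sub, mul_one]; exact h3
    exact sub_eq_zero.1 ((mul_eq_zero.1 this).resolve_left h4)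
  rw [hc, h5, one_smul]

/-- A finite-dimensional C⋆-algebra is spanned by matrix units. -/
theorem exists_matrixUnits (D : Type u) [NonUnitalCStarAlgebra D] [FiniteDimensional ℂ D] :
    ∃ (m : ℕ) (r : Fin m → Fin m) (p x : Fin m → D), MatrixUnits r p x ∧
      ∀ d, ∃ c : Fin m → Fin m → ℂ, (∀ i j, r i ≠ r j → c i j = 0) ∧
        d = ∑ i, ∑ j, c i j • (x i * star (x j)) := by
  classical
  obtain ⟨m, p, hp, ho, hQ⟩ := exists_minimal_family (D := D)
  let S : Setoid (Fin m) :=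
    { r := fun i j => ∃ x : D, star x * x = p j ∧ x * star x = p i
      iseqv := by
        refine ⟨fun i => ⟨p i, ?_, ?_⟩, ?_, ?_⟩
        · rw [(hp i).proj.isSelfAdjoint.star_eq, (hp i).proj.isIdempotentElem.eq]
        · rw [(hp i).proj.isSelfAdjoint.star_eq, (hp i).proj.isIdempotentElem.eq]
        · rintro i j ⟨x, hx1, hx2⟩
          exact ⟨star x, by rwa [star_star], by rwa [star_star]⟩
        · rintro i j k ⟨x, hx1, hx2⟩ ⟨y, hy1, hy2⟩
          refine ⟨x * y, ?_, ?_⟩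
          · rw [star_mul, mul_assoc, ← mul_assoc (star x), hx1, ← hy2, mul_assoc, ← mul_assoc,
              hy1, (hp k).proj.isIdempotentElem.eq]
          · rw [star_mul, mul_assoc, ← mul_assoc y, hy2, ← hx1, mul_assoc, ← mul_assoc,
              hx2, (hp i).proj.isIdempotentElem.eq] }
  -- The representative of each equivalence class serves as the base point of its matrix block.
  let r : Fin m → Fin m := fun i => (Quotient.mk S i).out
  have hr : ∀ i, S.r i (r i) := fun i => S.symm (Quotient.mk_out i)
  choose x hx1 hx2 using hr
  have hpx : ∀ i, p i * x i = x i := by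
    intro i
    have h1 : star (x i - p i * x i) * (x i - p i * x i) = 0 := by
      have : (x i - p i * x i) * star (x i - p i * x i) = 0 := by
        rw [star_sub, star_mul, (hp i).proj.isSelfAdjoint.star_eq, mul_sub, sub_mul, sub_mul,
          ← mul_assoc, ← mul_assoc, hx2, mul_assoc (p i), hx2]
        simp only [(hp i).proj.isIdempotentElem.eq, sub_self]
      rw [CStarRing.mul_star_self_eq_zero_iff] at this
      rw [this, mul_zero]
    rw [CStarRing.star_mul_self_eq_zero_iff] at h1
    exact (sub_eq_zero.1 h1).symm
  refine ⟨m, r, p, x, ⟨fun i => (hp i).proj, ho, hpx, hx1⟩, fun d => ?_⟩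
  have hQ' : ∀ d, d * (∑ i, p i) = d := by
    intro d
    have h1 := congrArg star (hQ (star d))
    rw [star_mul, star_star, star_sum] at h1
    rwa [Finset.sum_congr rfl fun i _ => (hp i).proj.isSelfAdjoint.star_eq] at h1
  -- Inequivalent minimal projections have `p i * d * p j = 0` by `exists_partialIsometry`. For
  -- equivalent ones, transport to the corner of the common representative yields a scalar.
  have hblock : ∀ i j, ∃ c : ℂ, (r i ≠ r j → c = 0) ∧ p i * d * p j = c • (x i * star (x j)) := by
    intro i j
    by_cases hij : r i = r j
    · obtain ⟨c, hc⟩ := (hp (r i)).corner (star (x i) * d * x j)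
      refine ⟨c, fun h => absurd hij h, ?_⟩
      have h1 : x i * p (r i) = x i := by
        rw [← hx1, ← mul_assoc, hx2, hpx]
      have h2 : p (r i) * star (x j) = star (x j) := by
        rw [hij, ← hx1 j, mul_assoc, hx2]
        have := congrArg star (hpx j)
        rwa [star_mul, (hp j).proj.isSelfAdjoint.star_eq] at this
      calc p i * d * p j = x i * star (x i) * d * (x j * star (x j)) := by rw [hx2, hx2]
        _ = (x i * p (r i)) * star (x i) * d * (x j * (p (r i) * star (x j))) := by rw [h1, h2]
        _ = x i * (p (r i) * (star (x i) * d * x j) * p (r i)) * star (x j) := by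
            simp only [mul_assoc]
        _ = c • (x i * star (x j)) := by
            rw [hc, mul_smul_comm, h1, smul_mul_assoc]
    · refine ⟨0, fun _ => rfl, ?_⟩
      rw [zero_smul]
      by_contra hne
      have : S.r i j := exists_partialIsometry (hp i) (hp j) hne
      exact hij (congrArg Quotient.out (Quotient.sound this))
  choose c hc0 hc using hblock
  refine ⟨c, hc0, ?_⟩
  calc d = (∑ i, p i) * d * ∑ j, p j := by rw [hQ, hQ']
    _ = ∑ i, ∑ j, p i * d * p j := by
        rw [Finset.sum_mul, Finset.sum_mul_sum]
    _ = _ := Finset.sum_congr rfl fun i _ => Finset.sum_congr rfl fun j _ => hc i j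

end FiniteDimensional

end FiberedCStar

namespace FiberedCStar

/-! ### Direct sum decompositions along clopen sets -/

section Decomposition

namespace ClosedIdeal

variable {A : Type u} [NonUnitalCStarAlgebra A]

/-- The quotient map as a ⋆-homomorphism. -/
noncomputable def Quotient.mkHom (I : ClosedIdeal A) : A →⋆ₙₐ[ℂ] I.Quotient where
  toFun := Quotient.mk I
  map_smul' z x := map_smul (Quotient.mk I) z x
  map_zero' := map_zero (Quotient.mk I)
  map_add' x y := map_add (Quotient.mk I) x y
  map_mul' _ _ := rfl
  map_star' _ := rfl

lemma Quotient.mkHom_surjective (I : ClosedIdeal A) : Function.Surjective (Quotient.mkHom I) :=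
  Quotient.mk_surjective I

lemma Quotient.mkHom_eq_zero {I : ClosedIdeal A} {a : A} : Quotient.mkHom I a = 0 ↔ a ∈ I := by
  have : Quotient.mkHom I a = 0 ↔ Quotient.mk I a = Quotient.mk I 0 := by
    rw [map_zero]; rfl
  rw [this, Quotient.mk_eq_mk, sub_zero]

lemma Quotient.mkHom_eq {I : ClosedIdeal A} {a b : A} :
    Quotient.mkHom I a = Quotient.mkHom I b ↔ a - b ∈ I := Quotient.mk_eq_mk I

variable (I : ClosedIdeal A)

lemma zero_mem : (0 : A) ∈ I := I.toSubmodule.zero_mem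
variable {I}
lemma add_mem {a b : A} (ha : a ∈ I) (hb : b ∈ I) : a + b ∈ I := I.toSubmodule.add_mem ha hb
lemma sub_mem {a b : A} (ha : a ∈ I) (hb : b ∈ I) : a - b ∈ I := I.toSubmodule.sub_mem ha hb
lemma smul_mem (c : ℂ) {a : A} (ha : a ∈ I) : c • a ∈ I := I.toSubmodule.smul_mem c ha
lemma mul_mem_left (x : A) {a : A} (ha : a ∈ I) : x * a ∈ I := I.mul_mem_left' x ha
lemma mul_mem_right (x : A) {a : A} (ha : a ∈ I) : a * x ∈ I := I.mul_mem_right' x ha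
lemma star_mem {a : A} (ha : a ∈ I) : star a ∈ I := I.star_mem' ha

/-- The zero ideal. -/
def zero (A : Type u) [NonUnitalCStarAlgebra A] : ClosedIdeal A where
  toSubmodule := ⊥
  mul_mem_left' x {a} ha := by
    have : a = 0 := ha
    rw [this, mul_zero]; rfl
  mul_mem_right' x {a} ha := by
    have : a = 0 := ha
    rw [this, zero_mul]; rfl
  star_mem' {a} ha := by
    have : a = 0 := ha
    rw [this, star_zero]; rfl
  isClosed' := isClosed_singleton

/-- Two closed ideals with intersection zero that generate `A` are complementary. -/
lemma exists_decomposition {I J : ClosedIdeal A} (hinf : ∀ a, a ∈ I → a ∈ J → a = 0)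
    (hsup : ∀ K : ClosedIdeal A, (∀ a ∈ I, a ∈ K) → (∀ a ∈ J, a ∈ K) → ∀ a, a ∈ K) (a : A) :
    ∃ b ∈ I, a - b ∈ J := by
  -- Injective ⋆-homomorphisms are isometric, so the image of `I` in `A / J` is closed. Its preimage
  -- `K` is then a closed ideal that contains both `I` and `J`, hence all of `A`.
  let f : I.toSubalgebra →⋆ₙₐ[ℂ] J.Quotient :=
    (Quotient.mkHom J).comp (NonUnitalStarSubalgebraClass.subtype I.toSubalgebra)
  have hf : Function.Injective f := by
    rw [injective_iff_map_eq_zero]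
    rintro ⟨b, hb⟩ h
    exact Subtype.ext (hinf b hb (Quotient.mkHom_eq_zero.1 h))
  have hiso : Isometry f := NonUnitalStarAlgHom.isometry f hf
  have hclosed : IsClosed (Set.range f) := hiso.isClosedEmbedding.isClosed_range
  let K : ClosedIdeal A :=
    { carrier := {a | Quotient.mkHom J a ∈ Set.range f}
      add_mem' := by
        rintro a b ⟨x, hx⟩ ⟨y, hy⟩
        exact ⟨x + y, by rw [map_add, hx, hy, map_add]⟩
      zero_mem' := ⟨0, by rw [map_zero, map_zero]⟩
      smul_mem' := by
        rintro c a ⟨x, hx⟩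
        exact ⟨c • x, by rw [map_smul, hx, map_smul]⟩
      mul_mem_left' := by
        rintro x a ⟨⟨b, hb⟩, hy⟩
        refine ⟨⟨x * b, mul_mem_left x hb⟩, ?_⟩
        rw [map_mul, ← hy]
        exact map_mul (Quotient.mkHom J) x b
      mul_mem_right' := by
        rintro x a ⟨⟨b, hb⟩, hy⟩
        refine ⟨⟨b * x, mul_mem_right x hb⟩, ?_⟩
        rw [map_mul, ← hy]
        exact map_mul (Quotient.mkHom J) b x
      star_mem' := by
        rintro a ⟨x, hx⟩
        exact ⟨star x, by rw [map_star, hx, map_star]⟩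
      isClosed' := hclosed.preimage (continuous_hom (Quotient.mkHom J)) }
  obtain ⟨⟨b, hb⟩, h⟩ : Quotient.mkHom J a ∈ Set.range f := hsup K
    (fun b hb => ⟨⟨b, hb⟩, rfl⟩)
    (fun b hb => ⟨0, by rw [map_zero, Quotient.mkHom_eq_zero.2 hb]⟩) a
  exact ⟨b, hb, Quotient.mkHom_eq.1 h.symm⟩

end ClosedIdeal

namespace AlgebraOver

variable {X : Type v} [TopologicalSpace X]
variable {A B : Type u} [NonUnitalCStarAlgebra A] [NonUnitalCStarAlgebra B]
variable (𝔄 : AlgebraOver X A)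

lemma mono {U V : TopologicalSpace.Opens X} (h : U ≤ V) {a : A} (ha : a ∈ 𝔄.ideal U) :
    a ∈ 𝔄.ideal V := by
  have := (𝔄.mem_ideal_inf U V a).1 (by rwa [inf_eq_left.2 h])
  exact this.2

lemma eq_zero_of_mem_bot {a : A} (ha : a ∈ 𝔄.ideal ⊥) : a = 0 := by
  have h := 𝔄.isLUB_ideal_sSup ∅
  rw [sSup_empty, Set.image_empty] at h
  exact h.2 (show ClosedIdeal.zero A ∈ upperBounds ∅ from fun _ h => h.elim) a ha

variable {U V : TopologicalSpace.Opens X}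

lemma eq_zero_of_disjoint (h : Disjoint U V) {a : A} (hU : a ∈ 𝔄.ideal U) (hV : a ∈ 𝔄.ideal V) :
    a = 0 :=
  𝔄.eq_zero_of_mem_bot (h.eq_bot ▸ (𝔄.mem_ideal_inf U V a).2 ⟨hU, hV⟩)

lemma mul_eq_zero_of_disjoint (h : Disjoint U V) {a b : A} (hU : a ∈ 𝔄.ideal U)
    (hV : b ∈ 𝔄.ideal V) : a * b = 0 :=
  𝔄.eq_zero_of_disjoint h (ClosedIdeal.mul_mem_right b hU) (ClosedIdeal.mul_mem_left a hV)

lemma exists_proj (h : IsCompl U V) (a : A) : ∃ b ∈ 𝔄.ideal U, a - b ∈ 𝔄.ideal V := by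
  refine ClosedIdeal.exists_decomposition (fun a => 𝔄.eq_zero_of_disjoint h.disjoint) ?_ a
  intro K hU hV a
  have hlub := 𝔄.isLUB_ideal_sSup {U, V}
  rw [sSup_pair, h.sup_eq_top] at hlub
  refine hlub.2 ?_ a (𝔄.mem_ideal_top a)
  rintro _ ⟨W, rfl | rfl, rfl⟩
  · exact hU
  · exact hV

/-- The component in `A(U)` of an element of `A = A(U) ⊕ A(V)`. -/
noncomputable def projFun (h : IsCompl U V) (a : A) : A := (𝔄.exists_proj h a).choose

lemma projFun_eq (h : IsCompl U V) {a b : A} (hb : b ∈ 𝔄.ideal U) (hab : a - b ∈ 𝔄.ideal V) :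
    𝔄.projFun h a = b := by
  obtain ⟨h1, h2⟩ := (𝔄.exists_proj h a).choose_spec
  refine sub_eq_zero.1 (𝔄.eq_zero_of_disjoint h.disjoint (ClosedIdeal.sub_mem h1 hb) ?_)
  have := ClosedIdeal.sub_mem hab h2
  rwa [sub_sub_sub_cancel_left] at this

/-- The projection onto `A(U)` along `A(V)` for complementary `U` and `V`. -/
noncomputable def proj (h : IsCompl U V) : A →⋆ₙₐ[ℂ] A where
  toFun := 𝔄.projFun h
  map_smul' c a := by
    obtain ⟨h1, h2⟩ := (𝔄.exists_proj h a).choose_spec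
    refine 𝔄.projFun_eq h (ClosedIdeal.smul_mem c h1) ?_
    have := ClosedIdeal.smul_mem c h2
    rwa [smul_sub] at this
  map_zero' := 𝔄.projFun_eq h (ClosedIdeal.zero_mem _)
    (by rw [sub_zero]; exact ClosedIdeal.zero_mem _)
  map_add' a b := by
    obtain ⟨h1, h2⟩ := (𝔄.exists_proj h a).choose_spec
    obtain ⟨h3, h4⟩ := (𝔄.exists_proj h b).choose_spec
    refine 𝔄.projFun_eq h (ClosedIdeal.add_mem h1 h3) ?_
    rw [add_sub_add_comm]; exact ClosedIdeal.add_mem h2 h4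
  map_mul' a b := by
    obtain ⟨h1, h2⟩ := (𝔄.exists_proj h a).choose_spec
    obtain ⟨h3, h4⟩ := (𝔄.exists_proj h b).choose_spec
    refine 𝔄.projFun_eq h (ClosedIdeal.mul_mem_left _ h3) ?_
    have : a * b - 𝔄.projFun h a * 𝔄.projFun h b =
        (a - 𝔄.projFun h a) * b + 𝔄.projFun h a * (b - 𝔄.projFun h b) := by
      rw [sub_mul, mul_sub]; abel
    rw [this]
    exact ClosedIdeal.add_mem (ClosedIdeal.mul_mem_right _ h2) (ClosedIdeal.mul_mem_left _ h4)
  map_star' a := by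
    obtain ⟨h1, h2⟩ := (𝔄.exists_proj h a).choose_spec
    refine 𝔄.projFun_eq h (ClosedIdeal.star_mem h1) ?_
    rw [← star_sub]; exact ClosedIdeal.star_mem h2

lemma proj_mem (h : IsCompl U V) (a : A) : 𝔄.proj h a ∈ 𝔄.ideal U :=
  (𝔄.exists_proj h a).choose_spec.1

lemma sub_proj_mem (h : IsCompl U V) (a : A) : a - 𝔄.proj h a ∈ 𝔄.ideal V :=
  (𝔄.exists_proj h a).choose_spec.2

lemma proj_eq (h : IsCompl U V) {a b : A} (hb : b ∈ 𝔄.ideal U) (hab : a - b ∈ 𝔄.ideal V) :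
    𝔄.proj h a = b := 𝔄.projFun_eq h hb hab

lemma proj_of_mem (h : IsCompl U V) {a : A} (ha : a ∈ 𝔄.ideal U) : 𝔄.proj h a = a :=
  𝔄.proj_eq h ha (by rw [sub_self]; exact ClosedIdeal.zero_mem _)

lemma proj_of_mem_compl (h : IsCompl U V) {a : A} (ha : a ∈ 𝔄.ideal V) : 𝔄.proj h a = 0 :=
  𝔄.proj_eq h (ClosedIdeal.zero_mem _) (by rwa [sub_zero])

lemma norm_proj_le (h : IsCompl U V) (a : A) : ‖𝔄.proj h a‖ ≤ ‖a‖ :=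
  NonUnitalStarAlgHom.norm_apply_le (𝔄.proj h) a

end AlgebraOver

end Decomposition

/-! ### Points and tails of the one-point compactification -/

section OnePointNat

open OnePoint TopologicalSpace

lemma isOpen_finset_coe (s : Set ℕ) : IsOpen ((↑) '' s : Set (OnePoint ℕ)) :=
  OnePoint.isOpenEmbedding_coe.isOpenMap s (isOpen_discrete s)

/-- The open set `{n}`. -/
def pointOpen (n : ℕ) : Opens (OnePoint ℕ) := ⟨{(n : OnePoint ℕ)}, by
  have := isOpen_finset_coe {n}; rwa [Set.image_singleton] at this⟩

/-- The complement of `{n}`. -/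
def pointCompl (n : ℕ) : Opens (OnePoint ℕ) := ⟨{(n : OnePoint ℕ)}ᶜ, isOpen_compl_singleton⟩

/-- The open set `{0, …, N - 1}`. -/
def headOpen (N : ℕ) : Opens (OnePoint ℕ) := ⟨(↑) '' Set.Iio N, isOpen_finset_coe _⟩

/-- The complement of `{0, …, N - 1}`. -/
def tailOpen (N : ℕ) : Opens (OnePoint ℕ) := ⟨((↑) '' Set.Iio N)ᶜ,
  (((Set.finite_Iio N).image _).isClosed).isOpen_compl⟩

lemma isCompl_opens {X : Type v} [TopologicalSpace X] {U V : Opens X}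
    (h : (V : Set X) = (U : Set X)ᶜ) : IsCompl U V := by
  refine ⟨?_, ?_⟩
  · rw [disjoint_iff]
    refine Opens.ext ?_
    simp [h]
  · rw [codisjoint_iff]
    refine Opens.ext ?_
    simp [h]

lemma isCompl_point (n : ℕ) : IsCompl (pointOpen n) (pointCompl n) := isCompl_opens rfl
lemma isCompl_tail (N : ℕ) : IsCompl (tailOpen N) (headOpen N) :=
  isCompl_opens (compl_compl _).symm

lemma headOpen_mono {M N : ℕ} (h : M ≤ N) : headOpen M ≤ headOpen N :=
  Set.image_mono (Set.Iio_subset_Iio h)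

lemma tailOpen_anti {M N : ℕ} (h : M ≤ N) : tailOpen N ≤ tailOpen M :=
  Set.compl_subset_compl.2 (headOpen_mono h)

lemma pointOpen_le_head {n N : ℕ} (h : n < N) : pointOpen n ≤ headOpen N := by
  rintro x (rfl : x = n)
  exact ⟨n, h, rfl⟩

lemma pointOpen_le_tail (n : ℕ) : pointOpen n ≤ tailOpen n := by
  rintro x (rfl : x = n) ⟨m, hm, hmn⟩
  have : m = n := OnePoint.coe_injective hmn
  exact absurd hm (by simp [this])

lemma headOpen_le_pointCompl (n : ℕ) : headOpen n ≤ pointCompl n := by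
  rintro x ⟨m, hm, rfl⟩ (h : (m : OnePoint ℕ) = n)
  have : m = n := OnePoint.coe_injective h
  exact absurd hm (by simp [this])

lemma tailOpen_succ (N : ℕ) : tailOpen (N + 1) = tailOpen N ⊓ pointCompl N := by
  refine Opens.ext ?_
  change ((↑) '' Set.Iio (N + 1) : Set (OnePoint ℕ))ᶜ = ((↑) '' Set.Iio N)ᶜ ∩ {(N : OnePoint ℕ)}ᶜ
  rw [← Set.compl_union, ← Set.image_singleton, ← Set.image_union]
  congr 2
  ext m
  simp only [Set.mem_Iio, Set.mem_union, Set.mem_singleton_iff]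
  omega

lemma tailOpen_zero : tailOpen 0 = ⊤ := by
  refine Opens.ext ?_
  simp [tailOpen]

lemma disjoint_point_tail (n : ℕ) : Disjoint (pointOpen n) (tailOpen (n + 1)) :=
  (isCompl_tail (n + 1)).disjoint.symm.mono_left (pointOpen_le_head (Nat.lt_succ_self n))

lemma headOpen_le_compl_infty (N : ℕ) :
    headOpen N ≤ ⟨{(∞ : OnePoint ℕ)}ᶜ, isOpen_compl_singleton⟩ := by
  rintro x ⟨m, hm, rfl⟩
  exact OnePoint.coe_ne_infty m

lemma compl_infty_eq : (⟨{(∞ : OnePoint ℕ)}ᶜ, isOpen_compl_singleton⟩ : Opens (OnePoint ℕ)) =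
    sSup (Set.range headOpen) := by
  refine le_antisymm ?_ (sSup_le ?_)
  · intro x hx
    obtain ⟨n, rfl⟩ := OnePoint.ne_infty_iff_exists.1 hx
    exact (le_sSup (Set.mem_range_self (n + 1)) : headOpen (n + 1) ≤ _)
      ⟨n, Nat.lt_succ_self n, rfl⟩
  · rintro _ ⟨N, rfl⟩
    exact headOpen_le_compl_infty N

namespace AlgebraOver

variable {A B : Type u} [NonUnitalCStarAlgebra A] [NonUnitalCStarAlgebra B]
variable (𝔄 : AlgebraOver (OnePoint ℕ) A)

/-- The projection onto the ideal of the tail `{N, N + 1, …, ∞}`. -/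
noncomputable def tail (N : ℕ) : A →⋆ₙₐ[ℂ] A := 𝔄.proj (isCompl_tail N)

/-- The projection onto the ideal of the point `n`. -/
noncomputable def point (n : ℕ) : A →⋆ₙₐ[ℂ] A := 𝔄.proj (isCompl_point n)

/-- The quotient map onto the fibre at `n`. -/
noncomputable def toFiber (x : OnePoint ℕ) : A →⋆ₙₐ[ℂ] 𝔄.Fiber x :=
  ClosedIdeal.Quotient.mkHom _

lemma toFiber_surjective (x : OnePoint ℕ) : Function.Surjective (𝔄.toFiber x) :=
  ClosedIdeal.Quotient.mkHom_surjective _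

lemma tail_mem (N : ℕ) (a : A) : 𝔄.tail N a ∈ 𝔄.ideal (tailOpen N) := 𝔄.proj_mem _ a
lemma point_mem (N : ℕ) (a : A) : 𝔄.point N a ∈ 𝔄.ideal (pointOpen N) := 𝔄.proj_mem _ a

lemma tail_zero (a : A) : 𝔄.tail 0 a = a :=
  𝔄.proj_of_mem _ (by rw [tailOpen_zero]; exact 𝔄.mem_ideal_top a)

lemma tail_eq_add (N : ℕ) (a : A) : 𝔄.tail N a = 𝔄.point N a + 𝔄.tail (N + 1) a := by
  have h1 := 𝔄.sub_proj_mem (isCompl_tail N) a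
  have h2 := 𝔄.sub_proj_mem (isCompl_point N) a
  have : 𝔄.tail (N + 1) a = 𝔄.tail N a - 𝔄.point N a := by
    refine 𝔄.proj_eq _ ?_ ?_
    · rw [tailOpen_succ, 𝔄.mem_ideal_inf]
      refine ⟨ClosedIdeal.sub_mem (𝔄.tail_mem N a) (𝔄.mono (pointOpen_le_tail N)
        (𝔄.point_mem N a)), ?_⟩
      have := ClosedIdeal.sub_mem h2 (𝔄.mono (headOpen_le_pointCompl N) h1)
      rwa [sub_sub_sub_cancel_left] at this
    · rw [← sub_add]
      exact ClosedIdeal.add_mem (𝔄.mono (headOpen_mono N.le_succ) h1)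
        (𝔄.mono (pointOpen_le_head N.lt_succ_self) (𝔄.point_mem N a))
  rw [this]; abel

/-- The elements with vanishing tails form a closed ideal, because all tail projections are
contractive homomorphisms. It contains the ideal of each finite head, and the complement of `∞` is
the union of the heads. -/
lemma tendsto_tail_of_mem {a : A} (ha : a ∈ 𝔄.idealCompl ∞) :
    Tendsto (fun N => 𝔄.tail N a) atTop (𝓝 0) := by
  let K : ClosedIdeal A :=
    { carrier := {a | Tendsto (fun N => 𝔄.tail N a) atTop (𝓝 0)}
      add_mem' := by
        intro a b ha hb
        have := Tendsto.add ha hb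
        simpa [map_add] using this
      zero_mem' := by simp
      smul_mem' := by
        intro c a ha
        have := Tendsto.const_smul ha c
        simpa [_root_.map_smul] using this
      mul_mem_left' := by
        intro x a ha
        refine squeeze_zero_norm (fun N => ?_) (by simpa using (ha.norm.const_mul ‖x‖))
        rw [map_mul]
        exact (norm_mul_le _ _).trans (by gcongr; exact 𝔄.norm_proj_le _ x)
      mul_mem_right' := by
        intro x a ha
        refine squeeze_zero_norm (fun N => ?_) (by simpa using (ha.norm.mul_const ‖x‖))
        rw [map_mul]
        exact (norm_mul_le _ _).trans (by gcongr; exact 𝔄.norm_proj_le _ x)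
      star_mem' := by
        intro a ha
        have := (continuous_star.tendsto _).comp ha
        simpa [Function.comp_def, map_star] using this
      isClosed' := by
        rw [← isSeqClosed_iff_isClosed]
        intro s x hs hx
        refine Metric.tendsto_atTop.2 fun ε hε => ?_
        obtain ⟨m, hm⟩ := (Metric.tendsto_atTop.1 hx (ε / 2) (half_pos hε))
        obtain ⟨N, hN⟩ := Metric.tendsto_atTop.1 (hs m) (ε / 2) (half_pos hε)
        refine ⟨N, fun n hn => ?_⟩
        have h1 := hN n hn
        have h2 := hm m le_rfl
        rw [dist_zero_right] at h1 ⊢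
        rw [dist_comm, dist_eq_norm] at h2
        calc ‖𝔄.tail n x‖ = ‖𝔄.tail n (x - s m) + 𝔄.tail n (s m)‖ := by
              rw [← map_add, sub_add_cancel]
          _ ≤ ‖𝔄.tail n (x - s m)‖ + ‖𝔄.tail n (s m)‖ := norm_add_le _ _
          _ ≤ ‖x - s m‖ + ‖𝔄.tail n (s m)‖ := by gcongr; exact 𝔄.norm_proj_le _ _
          _ < ε := by linarith }
  have hlub := 𝔄.isLUB_ideal_sSup (Set.range headOpen)
  rw [← compl_infty_eq] at hlub
  refine hlub.2 (show K ∈ _ from ?_) a ha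
  rintro _ ⟨_, ⟨N, rfl⟩, rfl⟩ b hb
  refine tendsto_const_nhds.congr' ?_
  filter_upwards [eventually_ge_atTop N] with M hM
  exact (𝔄.proj_of_mem_compl _ (𝔄.mono (headOpen_mono hM) hb)).symm

lemma toFiber_infty_tail (N : ℕ) (a : A) : 𝔄.toFiber ∞ (𝔄.tail N a) = 𝔄.toFiber ∞ a := by
  refine (ClosedIdeal.Quotient.mkHom_eq.2 ?_).symm
  exact 𝔄.mono (headOpen_le_compl_infty N) (𝔄.sub_proj_mem _ a)

/-- This is the passage from `∞` to a neighbourhood: choose a lift of the fibre element of norm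
below `ε`; it differs from `a` by an element whose tails tend to zero. -/
lemma eventually_norm_tail_lt {a : A} {ε : ℝ} (h : ‖𝔄.toFiber ∞ a‖ < ε) :
    ∀ᶠ N in atTop, ‖𝔄.tail N a‖ < ε := by
  obtain ⟨b, hb, hbn⟩ := ClosedIdeal.Quotient.exists_lift (𝔄.idealCompl ∞) (𝔄.toFiber ∞ a)
    (sub_pos.2 h)
  rw [add_sub_cancel] at hbn
  have hab : a - b ∈ 𝔄.idealCompl ∞ := (ClosedIdeal.Quotient.mk_eq_mk _).1 hb.symm
  have h1 := (𝔄.tendsto_tail_of_mem hab).norm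
  rw [norm_zero] at h1
  filter_upwards [h1.eventually (gt_mem_nhds (sub_pos.2 hbn))] with N hN
  calc ‖𝔄.tail N a‖ = ‖𝔄.tail N (a - b) + 𝔄.tail N b‖ := by rw [← map_add, sub_add_cancel]
    _ ≤ ‖𝔄.tail N (a - b)‖ + ‖𝔄.tail N b‖ := norm_add_le _ _
    _ ≤ ‖𝔄.tail N (a - b)‖ + ‖b‖ := by gcongr; exact 𝔄.norm_proj_le _ b
    _ < ε := by linarith

lemma toFiber_point (n : ℕ) (a : A) : 𝔄.toFiber n (𝔄.point n a) = 𝔄.toFiber n a :=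
  (ClosedIdeal.Quotient.mkHom_eq.2 (𝔄.sub_proj_mem (isCompl_point n) a)).symm

/-- The projection onto the ideal of `{n}` kills the kernel of the fibre map, so any lift of the
fibre element projects back to `a` without increase of norm. -/
lemma norm_of_mem_point {n : ℕ} {a : A} (ha : a ∈ 𝔄.ideal (pointOpen n)) :
    ‖𝔄.toFiber n a‖ = ‖a‖ := by
  refine le_antisymm (NonUnitalStarAlgHom.norm_apply_le (𝔄.toFiber n) a) ?_
  refine le_of_forall_pos_le_add fun ε hε => ?_
  obtain ⟨b, hb, hbn⟩ := ClosedIdeal.Quotient.exists_lift (𝔄.idealCompl n) (𝔄.toFiber n a) hε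
  have hab : a - b ∈ 𝔄.idealCompl n := (ClosedIdeal.Quotient.mk_eq_mk _).1 hb.symm
  have h1 : 𝔄.point n a - 𝔄.point n b = 0 := by
    rw [← map_sub]
    exact 𝔄.proj_of_mem_compl _ hab
  have h2 : 𝔄.point n a = a := 𝔄.proj_of_mem _ ha
  rw [← h2, sub_eq_zero.1 h1]
  refine (𝔄.norm_proj_le _ b).trans ?_
  rw [← sub_eq_zero.1 h1, h2]
  exact hbn.le

lemma eq_of_toFiber_eq {n : ℕ} {a b : A} (ha : a ∈ 𝔄.ideal (pointOpen n))
    (hb : b ∈ 𝔄.ideal (pointOpen n)) (h : 𝔄.toFiber n a = 𝔄.toFiber n b) : a = b := by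
  rw [← sub_eq_zero, ← norm_eq_zero, ← 𝔄.norm_of_mem_point (ClosedIdeal.sub_mem ha hb), map_sub, h,
    sub_self, norm_zero]

end AlgebraOver

end OnePointNat

end FiberedCStar

namespace FiberedCStar

/-! ### Lifting matrix units from the fibre at infinity -/

section Lifting

open OnePoint

namespace MatrixUnits

variable {A B : Type u} [NonUnitalCStarAlgebra A] [NonUnitalCStarAlgebra B]
variable {ι : Type} {r : ι → ι} {p x : ι → A}

lemma map (h : MatrixUnits r p x) (π : A →⋆ₙₐ[ℂ] B) :
    MatrixUnits r (fun i => π (p i)) (fun i => π (x i)) where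
  proj i := (h.proj i).map π
  orth i j hij := by rw [← map_mul, h.orth i j hij, map_zero]
  left i := by rw [← map_mul, h.left]
  star_mul_self i := by rw [← map_star, ← map_mul, h.star_mul_self]

lemma right (h : MatrixUnits r p x) (i : ι) : x i * p (r i) = x i := by
  have hs := (h.proj (r i)).isSelfAdjoint.star_eq
  have hi := (h.proj (r i)).isIdempotentElem.eq
  have : star (x i * p (r i) - x i) * (x i * p (r i) - x i) = 0 := by
    rw [star_sub, star_mul, hs, mul_sub, sub_mul, sub_mul, mul_assoc (p (r i)), ← mul_assoc (star (x i)),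
      h.star_mul_self, hi, hi, mul_assoc (p (r i)), h.star_mul_self, hi, sub_self]
  exact sub_eq_zero.1 ((CStarRing.star_mul_self_eq_zero_iff _).1 this)

lemma star_left (h : MatrixUnits r p x) (i : ι) : star (x i) * p i = star (x i) := by
  have := congrArg star (h.left i)
  rwa [star_mul, (h.proj i).isSelfAdjoint.star_eq] at this

lemma star_mul (h : MatrixUnits r p x) {i j : ι} (hij : i ≠ j) : star (x i) * x j = 0 := by
  rw [← h.star_left i, ← h.left j, mul_assoc, ← mul_assoc (p i), h.orth i j hij, zero_mul, mul_zero]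

end MatrixUnits

variable {A : Type u} [NonUnitalCStarAlgebra A] (𝔄 : AlgebraOver (OnePoint ℕ) A)

/-- Projections are lifted one at a time. A self-adjoint lift of the next one is compressed to the
complement of those already found, is almost idempotent on a far tail, and is corrected there.
Restricting the earlier lifts to that tail leaves their values at `∞` unchanged. -/
lemma exists_lift_projections {ι : Type} {p : ι → 𝔄.Fiber ∞} (hp : ∀ i, IsStarProjection (p i))
    (ho : ∀ i j, i ≠ j → p i * p j = 0) (s : Finset ι) :
    ∃ P : ι → A, (∀ i ∈ s, IsStarProjection (P i)) ∧
      (∀ i ∈ s, ∀ j ∈ s, i ≠ j → P i * P j = 0) ∧ ∀ i ∈ s, 𝔄.toFiber ∞ (P i) = p i := by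
  classical
  induction s using Finset.induction_on with
  | empty => exact ⟨0, by simp, by simp, by simp⟩
  | insert i s hi ih =>
    obtain ⟨P, hP, hPo, hPf⟩ := ih
    set Q := ∑ j ∈ s, P j with hQ
    have hQp : IsStarProjection Q := isStarProjection_sum s hP hPo
    have hQs := hQp.isSelfAdjoint.star_eq
    have hQP : ∀ j ∈ s, Q * P j = P j := by
      intro j hj
      rw [hQ, Finset.sum_mul, Finset.sum_eq_single_of_mem j hj fun k hk hkj => hPo k hk j hj hkj,
        (hP j hj).isIdempotentElem.eq]
    have hQf : 𝔄.toFiber ∞ Q * p i = 0 := by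
      rw [hQ, map_sum, Finset.sum_mul]
      refine Finset.sum_eq_zero fun j hj => ?_
      rw [hPf j hj]
      exact ho j i fun h => hi (h ▸ hj)
    have hQf' : p i * 𝔄.toFiber ∞ Q = 0 := by
      have := congrArg star hQf
      rwa [star_mul, ← map_star, hQs, (hp i).isSelfAdjoint.star_eq, star_zero] at this
    obtain ⟨y, hy⟩ := 𝔄.toFiber_surjective ∞ (p i)
    set y1 := (2⁻¹ : ℂ) • (y + star y) with hy1
    have hy1s : star y1 = y1 := by
      rw [hy1, star_smul, star_add, star_star, add_comm]
      congr 1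
      simp
    have hy1f : 𝔄.toFiber ∞ y1 = p i := by
      rw [hy1, _root_.map_smul, map_add, map_star, hy, (hp i).isSelfAdjoint.star_eq, ← two_smul ℂ,
        smul_smul]
      norm_num
    -- This is `(1 - Q) * y1 * (1 - Q)` written without a unit.
    set z := y1 - Q * y1 - (y1 * Q - Q * y1 * Q) with hz
    have hzs : IsSelfAdjoint z := by
      rw [isSelfAdjoint_iff, hz]
      simp only [star_sub, star_mul, hQs, hy1s, mul_assoc]
      abel
    have hzQ : z * Q = 0 := by
      rw [hz]
      simp only [sub_mul, mul_assoc, hQp.isIdempotentElem.eq]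
      abel
    have hzf : 𝔄.toFiber ∞ z = p i := by
      rw [hz]
      simp only [map_sub, map_mul, hy1f, hQf, hQf', zero_mul, sub_zero]
    have hsmall : ‖𝔄.toFiber ∞ (z * z - z)‖ < 3 / 16 := by
      rw [map_sub, map_mul, hzf, (hp i).isIdempotentElem.eq, sub_self, norm_zero]
      norm_num
    obtain ⟨N, hN⟩ := (𝔄.eventually_norm_tail_lt hsmall).exists
    rw [map_sub, map_mul] at hN
    set h := 𝔄.tail N z with hh
    have hhs : IsSelfAdjoint h := hzs.map _
    have hC := isStarProjection_cutoff hhs hN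
    obtain ⟨k, hk⟩ := exists_cutoff_eq_mul hhs
    have hCP : ∀ j ∈ s, cfcₙ cutoff h * 𝔄.tail N (P j) = 0 := by
      intro j hj
      rw [hk, mul_assoc, hh, ← map_mul, ← hQP j hj, ← mul_assoc z, hzQ, zero_mul, map_zero,
        mul_zero]
    have hPC : ∀ j ∈ s, 𝔄.tail N (P j) * cfcₙ cutoff h = 0 := by
      intro j hj
      have := congrArg star (hCP j hj)
      rwa [star_mul, hC.isSelfAdjoint.star_eq, ← map_star, (hP j hj).isSelfAdjoint.star_eq,
        star_zero] at this
    have hCf : 𝔄.toFiber ∞ (cfcₙ cutoff h) = p i := by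
      have hhf : 𝔄.toFiber ∞ h = p i := by rw [hh, 𝔄.toFiber_infty_tail, hzf]
      rw [map_cutoff _ hhs (hhf ▸ hp i), hhf]
    have hne : ∀ j ∈ s, j ≠ i := fun j hj h => hi (h ▸ hj)
    refine ⟨fun j => if j = i then cfcₙ cutoff h else 𝔄.tail N (P j), ?_, ?_, ?_⟩
    · intro j hj
      rcases Finset.mem_insert.1 hj with rfl | hj
      · simpa using hC
      · simpa [hne j hj] using (hP j hj).map (𝔄.tail N)
    · intro j hj l hl hjl
      rcases Finset.mem_insert.1 hj with hji | hj <;>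
        rcases Finset.mem_insert.1 hl with hli | hl
      · exact absurd (hji.trans hli.symm) hjl
      · simpa [hji, hne l hl] using hCP l hl
      · simpa [hli, hne j hj] using hPC j hj
      · simp only [hne j hj, hne l hl, if_false]
        rw [← map_mul, hPo j hj l hl hjl, map_zero]
    · intro j hj
      rcases Finset.mem_insert.1 hj with rfl | hj
      · simpa using hCf
      · simp only [hne j hj, if_false]
        rw [𝔄.toFiber_infty_tail, hPf j hj]

/-- Matrix units lift from the fibre at infinity. -/
theorem exists_lift_matrixUnits {ι : Type} [Finite ι] {r : ι → ι} {p x : ι → 𝔄.Fiber ∞}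
    (h : MatrixUnits r p x) :
    ∃ P Y : ι → A, MatrixUnits r P Y ∧ ∀ i, 𝔄.toFiber ∞ (Y i) = x i := by
  have := Fintype.ofFinite ι
  obtain ⟨P, hP, hPo, hPf⟩ := exists_lift_projections 𝔄 h.proj h.orth Finset.univ
  simp only [Finset.mem_univ, true_implies] at hP hPo hPf
  have hlift : ∀ i, ∃ y, P i * y = y ∧ y * P (r i) = y ∧ 𝔄.toFiber ∞ y = x i := by
    intro i
    obtain ⟨y, hy⟩ := 𝔄.toFiber_surjective ∞ (x i)
    refine ⟨P i * y * P (r i), ?_, ?_, ?_⟩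
    · rw [← mul_assoc, ← mul_assoc, (hP i).isIdempotentElem.eq]
    · rw [mul_assoc, (hP (r i)).isIdempotentElem.eq]
    · rw [map_mul, map_mul, hy, hPf, hPf, h.left, h.right]
  choose y hy1 hy2 hy3 using hlift
  -- The relation `star (x i) * x i = p (r i)` is exact at `∞`, so on a far tail it holds within the
  -- tolerance of `exists_polar`. Final projections need no correction, as `MatrixUnits` only
  -- requires `p i * x i = x i`.
  have hev : ∀ᶠ N in atTop, ∀ i, ‖𝔄.tail N (star (y i) * y i - P (r i))‖ < 1 / 8 := by
    rw [Filter.eventually_all]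
    intro i
    refine 𝔄.eventually_norm_tail_lt ?_
    rw [map_sub, map_mul, map_star, hy3, hPf, h.star_mul_self, sub_self, norm_zero]
    norm_num
  obtain ⟨N, hN⟩ := hev.exists
  have hpol : ∀ i, ∃ k : A, star (𝔄.tail N (y i) * k) * (𝔄.tail N (y i) * k) = 𝔄.tail N (P (r i)) ∧
      𝔄.toFiber ∞ (𝔄.tail N (y i) * k) = x i := by
    intro i
    have h1 : 𝔄.tail N (y i) * 𝔄.tail N (P (r i)) = 𝔄.tail N (y i) := by rw [← map_mul, hy2]
    have h2 := (hN i).le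
    rw [map_sub, map_mul, map_star] at h2
    obtain ⟨k, hk, hk'⟩ := exists_polar ((hP (r i)).map (𝔄.tail N)) h1 h2
    refine ⟨k, hk, ?_⟩
    rw [hk' (𝔄.toFiber ∞) (by
      rw [𝔄.toFiber_infty_tail, 𝔄.toFiber_infty_tail, hy3, hPf, h.star_mul_self]),
      𝔄.toFiber_infty_tail, hy3]
  choose k hk hk' using hpol
  refine ⟨fun i => 𝔄.tail N (P i), fun i => 𝔄.tail N (y i) * k i,
    ⟨fun i => (hP i).map _, fun i j hij => ?_, fun i => ?_, hk⟩, hk'⟩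
  · rw [← map_mul, hPo i j hij, map_zero]
  · rw [← mul_assoc, ← map_mul, hy1]

/-- A single finite-dimensional subalgebra of the fibre approximates all of `F`. After lifting its
matrix units, the approximation error is small at `∞` and hence on all far tails. -/
theorem exists_matrixUnits_approx (hAF : IsAF (𝔄.Fiber ∞)) (F : Finset A) {ε : ℝ} (hε : 0 < ε) :
    ∃ (m : ℕ) (r : Fin m → Fin m) (p x : Fin m → A), MatrixUnits r p x ∧
      ∀ f ∈ F, ∃ c : Fin m → Fin m → ℂ, (∀ i j, r i ≠ r j → c i j = 0) ∧
        ∀ᶠ N in atTop, ‖𝔄.tail N (f - ∑ i, ∑ j, c i j • (x i * star (x j)))‖ < ε := by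
  classical
  obtain ⟨S, hS, hfin, hdense⟩ := hAF
  have hex : ∃ n, ∀ f ∈ F, ∃ d ∈ S n, ‖𝔄.toFiber ∞ f - d‖ < ε := by
    have h1 : ∀ f : A, ∀ᶠ n in atTop, ∃ d ∈ S n, ‖𝔄.toFiber ∞ f - d‖ < ε := by
      intro f
      obtain ⟨d, hd, hfd⟩ := Metric.mem_closure_iff.1 (hdense (𝔄.toFiber ∞ f)) ε hε
      obtain ⟨n, hn⟩ := Set.mem_iUnion.1 hd
      filter_upwards [eventually_ge_atTop n] with k hk
      exact ⟨d, hS hk hn, by rwa [← dist_eq_norm]⟩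
    exact ((Filter.eventually_all_finset F).2 fun f _ => h1 f).exists
  obtain ⟨n, hn⟩ := hex
  have := hfin n
  have : IsClosed (S n : Set (𝔄.Fiber ∞)) := by
    have : FiniteDimensional ℂ (S n).toSubmodule := hfin n
    exact Submodule.closed_of_finiteDimensional (S n).toSubmodule
  obtain ⟨m, r, p, x, hmu, hspan⟩ := exists_matrixUnits (S n)
  obtain ⟨P, Y, hPY, hY⟩ := exists_lift_matrixUnits 𝔄
    (hmu.map (NonUnitalStarSubalgebraClass.subtype (S n)))
  refine ⟨m, r, P, Y, hPY, fun f hf => ?_⟩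
  obtain ⟨d, hd, hfd⟩ := hn f hf
  obtain ⟨c, hc0, hc⟩ := hspan ⟨d, hd⟩
  refine ⟨c, hc0, 𝔄.eventually_norm_tail_lt ?_⟩
  have h1 : 𝔄.toFiber ∞ (∑ i, ∑ j, c i j • (Y i * star (Y j))) = d := by
    simp only [map_sum, _root_.map_smul, map_mul, map_star, hY]
    have := congrArg (NonUnitalStarSubalgebraClass.subtype (S n)) hc
    simp only [map_sum, _root_.map_smul, map_mul, map_star] at this
    exact this.symm
  rwa [map_sub, h1]

end Lifting

end FiberedCStar

namespace FiberedCStar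

/-! ### Stable algebras: shifts, isometries and quotients -/

section Stable

/-- Inner products of formal combinations depend only on those of the generators; this gives
isometry and well-definedness of maps prescribed on generators. -/
lemma star_linearCombination_mul {α A : Type u} [NonUnitalCStarAlgebra A] {g k u v : α → A}
    (h : ∀ a b, star (g a) * k b = star (u a) * v b) (f f' : α →₀ ℂ) :
    star (Finsupp.linearCombination ℂ g f) * Finsupp.linearCombination ℂ k f' =
      star (Finsupp.linearCombination ℂ u f) * Finsupp.linearCombination ℂ v f' := by
  simp only [Finsupp.linearCombination_apply, Finsupp.sum, star_sum, Finset.sum_mul_sum, star_smul,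
    smul_mul_smul_comm, h]

lemma ClosedIdeal.mem_of_forall_mul_mem {A : Type u} [NonUnitalCStarAlgebra A] {I : ClosedIdeal A}
    {t : A} (h : ∀ x y, x * t * y ∈ I) : t ∈ I := by
  change t ∈ (I.toSubmodule : Set A)
  rw [← (ClosedIdeal.isClosed_toSubmodule I).closure_eq]
  refine Metric.mem_closure_iff.2 fun ε hε => ?_
  obtain ⟨k, -, hk1, hk2, hk3⟩ := exists_approx_unit {t} (half_pos hε)
  have hk2 := hk2 t (by simp)
  have hk3 := hk3 t (by simp)
  refine ⟨k * t * k, h k k, ?_⟩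
  rw [dist_eq_norm]
  calc ‖t - k * t * k‖ = ‖(t - k * t) + k * (t - t * k)‖ := by
        congr 1; simp only [mul_sub, mul_assoc]; abel
    _ ≤ ‖t - k * t‖ + ‖k‖ * ‖t - t * k‖ :=
        (norm_add_le _ _).trans (by gcongr; exact norm_mul_le _ _)
    _ ≤ ‖t - k * t‖ + 1 * ‖t - t * k‖ := by gcongr
    _ < ε := by linarith

namespace CompactTensor

variable {B T : Type u} [NonUnitalCStarAlgebra B] [NonUnitalCStarAlgebra T]
variable (t : CompactTensor B T)

lemma induction_closed {P : T → Prop} (hP : IsClosed {x | P x}) (h0 : P 0)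
    (hu : ∀ i j b, P (t.unit i j b))
    (ha : ∀ x y, P x → P y → P (x + y)) (hs : ∀ (c : ℂ) x, P x → P (c • x)) (x : T) : P x := by
  refine t.dense_span.induction ?_ hP x
  intro y hy
  refine Submodule.span_induction ?_ h0 (fun x y _ _ => ha x y) (fun c x _ => hs c x) hy
  rintro _ ⟨i, j, b, rfl⟩
  exact hu i j b

/-- The diagonal embedding `b ↦ ∑ b ⊗ e i i`. -/
noncomputable def diag (n : ℕ) : B →⋆ₙₐ[ℂ] T where
  toFun b := ∑ i ∈ Finset.range n, t.unit i i b
  map_smul' c b := by simp [Finset.smul_sum]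
  map_zero' := by simp
  map_add' a b := by simp [Finset.sum_add_distrib]
  map_mul' a b := by
    rw [Finset.sum_mul_sum]
    refine Finset.sum_congr rfl fun i hi => ?_
    rw [Finset.sum_eq_single_of_mem i hi fun j _ hj => by rw [t.unit_mul_unit, if_neg hj.symm],
      t.unit_mul_unit, if_pos rfl]
  map_star' b := by
    rw [star_sum]
    exact Finset.sum_congr rfl fun i _ => (t.star_unit i i b).symm

lemma diag_apply (n : ℕ) (b : B) : t.diag n b = ∑ i ∈ Finset.range n, t.unit i i b := rfl

lemma diag_mul_unit {n k : ℕ} (hk : k < n) (l : ℕ) (a b : B) :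
    t.diag n a * t.unit k l b = t.unit k l (a * b) := by
  rw [diag_apply, Finset.sum_mul, Finset.sum_eq_single_of_mem k (Finset.mem_range.2 hk)
    fun j _ hj => by rw [t.unit_mul_unit, if_neg hj], t.unit_mul_unit, if_pos rfl]

/-- The C⋆-identity reduces an off-diagonal unit to a diagonal one, which is a ⋆-homomorphism in
`b`. -/
lemma norm_unit_le (k l : ℕ) (b : B) : ‖t.unit k l b‖ ≤ ‖b‖ := by
  let f : B →⋆ₙₐ[ℂ] T :=
    { t.unit l l with
      map_zero' := (t.unit l l).map_zero
      map_mul' := fun a b => by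
        change t.unit l l (a * b) = t.unit l l a * t.unit l l b
        rw [t.unit_mul_unit, if_pos rfl]
      map_star' := fun a => (t.star_unit l l a).symm }
  have h1 : ‖t.unit k l b‖ * ‖t.unit k l b‖ ≤ ‖b‖ * ‖b‖ := by
    rw [← CStarRing.norm_star_mul_self, t.star_unit, t.unit_mul_unit, if_pos rfl,
      ← CStarRing.norm_star_mul_self]
    exact NonUnitalStarAlgHom.norm_apply_le f (star b * b)
  exact abs_le_of_sq_le_sq' (by simpa only [sq] using h1) (norm_nonneg _) |>.2

/-- An approximation of the shift by `n`. -/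
noncomputable def shift (n : ℕ) (e : B) : T := ∑ i ∈ Finset.range n, t.unit (n + i) i e

lemma star_shift_mul_shift (n : ℕ) (e : B) :
    star (t.shift n e) * t.shift n e = t.diag n (star e * e) := by
  rw [shift, star_sum, Finset.sum_mul_sum, diag_apply]
  refine Finset.sum_congr rfl fun i hi => ?_
  rw [Finset.sum_eq_single_of_mem i hi fun j _ hj => by
    rw [t.star_unit, t.unit_mul_unit, if_neg (by omega)], t.star_unit, t.unit_mul_unit, if_pos rfl]

lemma norm_shift_le {n : ℕ} {e : B} (he : ‖e‖ ≤ 1) : ‖t.shift n e‖ ≤ 1 := by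
  have h1 : ‖t.shift n e‖ * ‖t.shift n e‖ ≤ 1 := by
    rw [← CStarRing.norm_star_mul_self, star_shift_mul_shift]
    refine (NonUnitalStarAlgHom.norm_apply_le (t.diag n) _).trans ?_
    rw [CStarRing.norm_star_mul_self]
    nlinarith [norm_nonneg e]
  nlinarith [norm_nonneg (t.shift n e)]

/-- Approximate isometries which move given elements away. -/
theorem exists_shift (t : CompactTensor B T) (F : Finset T) {ε : ℝ} (hε : 0 < ε) :
    ∃ s : T, ‖s‖ ≤ 1 ∧ ∀ a ∈ F, ‖star s * s * a - a‖ < ε ∧ ‖a * s‖ < ε := by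
  let := CStarAlgebra.spectralOrder B
  have := CStarAlgebra.spectralOrderedRing B
  have hl := CStarAlgebra.increasingApproximateUnit B
  have := hl.neBot
  -- The shift length and the approximate unit of `B` vary independently, so each estimate can use
  -- its own eventual condition.
  let l : Filter (ℕ × B) := atTop ×ˢ CStarAlgebra.approximateUnit B
  have hnorm : ∀ᶠ z in l, ‖t.shift z.1 z.2‖ ≤ 1 :=
    (hl.eventually_norm.prod_inr atTop).mono fun z hz => t.norm_shift_le hz
  let P : T → Prop := fun a => ∀ ε > 0, ∀ᶠ z in l,
    ‖star (t.shift z.1 z.2) * t.shift z.1 z.2 * a - a‖ < ε ∧ ‖a * t.shift z.1 z.2‖ < ε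
  -- `P` is closed and linear in `a`, and the shifts are eventually contractive; only the elements
  -- `b ⊗ e i j` need a computation.
  have key : ∀ a : T, P a := by
    refine t.induction_closed ?_ ?_ ?_ ?_ ?_
    · rw [← isSeqClosed_iff_isClosed]
      intro f x hf hx ε hε
      obtain ⟨m, hm⟩ := Metric.tendsto_atTop.1 hx (ε / 3) (by positivity)
      have hm := hm m le_rfl
      rw [dist_comm, dist_eq_norm] at hm
      filter_upwards [hf m (ε / 3) (by positivity), hnorm] with z hz hz1
      set s := t.shift z.1 z.2
      have hss : ‖star s * s‖ ≤ 1 := by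
        rw [CStarRing.norm_star_mul_self]; nlinarith [norm_nonneg s]
      constructor
      · calc ‖star s * s * x - x‖
            = ‖star s * s * (x - f m) + (star s * s * f m - f m) - (x - f m)‖ := by
              congr 1; simp only [mul_sub]; abel
          _ ≤ ‖star s * s‖ * ‖x - f m‖ + ‖star s * s * f m - f m‖ + ‖x - f m‖ :=
              (norm_sub_le _ _).trans (by
                gcongr; exact (norm_add_le _ _).trans (by gcongr; exact norm_mul_le _ _))
          _ ≤ 1 * ‖x - f m‖ + ‖star s * s * f m - f m‖ + ‖x - f m‖ := by gcongr
          _ < ε := by linarith [hz.1]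
      · calc ‖x * s‖ = ‖(x - f m) * s + f m * s‖ := by rw [← add_mul, sub_add_cancel]
          _ ≤ ‖x - f m‖ * ‖s‖ + ‖f m * s‖ :=
              (norm_add_le _ _).trans (by gcongr; exact norm_mul_le _ _)
          _ ≤ ‖x - f m‖ * 1 + ‖f m * s‖ := by gcongr
          _ < ε := by linarith [hz.2]
    · intro ε hε
      simp [hε]
    · intro i j b ε hε
      have h1 : ∀ᶠ e : B in CStarAlgebra.approximateUnit B, ‖e * b - b‖ < ε / 2 := by
        have := ((hl.tendsto_mul_right b).sub (tendsto_const_nhds (x := b))).norm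
        rw [sub_self, norm_zero] at this
        exact this.eventually (gt_mem_nhds (half_pos hε))
      filter_upwards [(h1.and (hl.eventually_norm.and hl.eventually_star_eq)).prod_inr atTop,
        ((eventually_gt_atTop i).and (eventually_gt_atTop j)).prod_inl _] with z hz hz'
      obtain ⟨hz1, hz2, hz3⟩ := hz
      constructor
      · rw [star_shift_mul_shift, t.diag_mul_unit hz'.1, hz3, ← map_sub]
        refine (t.norm_unit_le _ _ _).trans_lt ?_
        calc ‖z.2 * z.2 * b - b‖ = ‖z.2 * (z.2 * b - b) + (z.2 * b - b)‖ := by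
              congr 1; simp only [mul_sub, mul_assoc]; abel
          _ ≤ ‖z.2‖ * ‖z.2 * b - b‖ + ‖z.2 * b - b‖ :=
              (norm_add_le _ _).trans (by gcongr; exact norm_mul_le _ _)
          _ ≤ 1 * ‖z.2 * b - b‖ + ‖z.2 * b - b‖ := by gcongr
          _ < ε := by linarith
      · have : t.unit i j b * t.shift z.1 z.2 = 0 := by
          rw [shift, Finset.mul_sum]
          refine Finset.sum_eq_zero fun k _ => ?_
          rw [t.unit_mul_unit, if_neg (by have := hz'.2; omega)]
        rw [this, norm_zero]; exact hε
    · intro x y hx hy ε hε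
      filter_upwards [hx (ε / 2) (half_pos hε), hy (ε / 2) (half_pos hε)] with z h1 h2
      constructor
      · rw [mul_add, add_sub_add_comm]
        exact (norm_add_le _ _).trans_lt (by linarith [h1.1, h2.1])
      · rw [add_mul]
        exact (norm_add_le _ _).trans_lt (by linarith [h1.2, h2.2])
    · intro c x hx ε hε
      have hc : 0 < ‖c‖ + 1 := by positivity
      filter_upwards [hx (ε / (‖c‖ + 1)) (by positivity)] with z h
      rw [mul_smul_comm, ← smul_sub, smul_mul_assoc, norm_smul, norm_smul]
      have h1 := (lt_div_iff₀ hc).1 h.1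
      have h2 := (lt_div_iff₀ hc).1 h.2
      constructor
      · nlinarith [norm_nonneg (star (t.shift z.1 z.2) * t.shift z.1 z.2 * x - x)]
      · nlinarith [norm_nonneg (x * t.shift z.1 z.2)]
  have : l.NeBot := inferInstance
  obtain ⟨z, hz, hz1⟩ :=
    (((Filter.eventually_all_finset F).2 fun a _ => key a ε hε).and hnorm).exists
  exact ⟨_, hz1, hz⟩

/-- Isometries `W i` on `B ⊗ 𝕂` with orthogonal ranges: `W i (b ⊗ e k l) = b ⊗ e ⟨i, k⟩ l`. -/
theorem exists_isometries : ∃ W : ℕ → T →L[ℂ] T,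
    (∀ i k l b, W i (t.unit k l b) = t.unit (Nat.pair i k) l b) ∧
    (∀ i x y, star (W i x) * W i y = star x * y) ∧
    (∀ i j x y, i ≠ j → star (W i x) * W j y = 0) ∧
    ∀ i x y, W i (x * y) = W i x * y := by
  -- Formal combinations of matrix units map densely to `T`. Defining `H i` on them needs no check
  -- of relations: the equality of norms of `H i f` and `G f` lets it descend and extend to `T`.
  let G : (ULift.{u} ℕ × ULift.{u} ℕ × B →₀ ℂ) →ₗ[ℂ] T :=
    Finsupp.linearCombination ℂ fun a => t.unit a.1.down a.2.1.down a.2.2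
  let H : ℕ → (ULift.{u} ℕ × ULift.{u} ℕ × B →₀ ℂ) →ₗ[ℂ] T := fun i =>
    Finsupp.linearCombination ℂ fun a => t.unit (Nat.pair i a.1.down) a.2.1.down a.2.2
  have hG : DenseRange G := by
    refine t.dense_span.mono ?_
    intro x hx
    change x ∈ LinearMap.range G
    refine (Submodule.span_le.2 ?_) hx
    rintro _ ⟨i, j, b, rfl⟩
    exact ⟨Finsupp.single (⟨i⟩, ⟨j⟩, b) 1, by simp [G]⟩
  have hH : ∀ i f f', star (H i f) * H i f' = star (G f) * G f' := by
    intro i f f'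
    refine star_linearCombination_mul (fun a b => ?_) f f'
    simp only [t.star_unit, t.unit_mul_unit, Nat.pair_eq_pair, true_and]
  have hH0 : ∀ i j, i ≠ j → ∀ f f', star (H i f) * H j f' = 0 := by
    intro i j hij f f'
    have : star (H i f) * H j f' =
        star (Finsupp.linearCombination ℂ (fun _ => (0 : T)) f) *
          Finsupp.linearCombination ℂ (fun _ => (0 : T)) f' := by
      refine star_linearCombination_mul (fun a b => ?_) f f'
      rw [t.star_unit, t.unit_mul_unit, if_neg (by simp [Nat.pair_eq_pair, hij]), mul_zero]
    rw [this]
    simp [Finsupp.linearCombination_apply]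
  have hnorm : ∀ i f, ‖H i f‖ ≤ 1 * ‖G f‖ := by
    intro i f
    have h1 : ‖H i f‖ * ‖H i f‖ = ‖G f‖ * ‖G f‖ := by
      rw [← CStarRing.norm_star_mul_self, hH, CStarRing.norm_star_mul_self]
    rw [one_mul]
    exact abs_le_of_sq_le_sq' (by simpa only [sq] using h1.le) (norm_nonneg _) |>.2
  let W : ℕ → T →L[ℂ] T := fun i => (H i).extendOfNorm G
  have hW : ∀ i f, W i (G f) = H i f := fun i f =>
    LinearMap.extendOfNorm_eq hG ⟨1, hnorm i⟩ f
  have hinner : ∀ i x y, star (W i x) * W i y = star x * y := by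
    intro i x y
    refine hG.induction_on₂ (p := fun x y => star (W i x) * W i y = star x * y) ?_ ?_ x y
    · exact isClosed_eq (by fun_prop) (by fun_prop)
    · intro f f'
      rw [hW, hW, hH]
  refine ⟨W, ?_, hinner, ?_, ?_⟩
  · intro i k l b
    have h1 : t.unit k l b = G (Finsupp.single (⟨k⟩, ⟨l⟩, b) 1) := by simp [G]
    rw [h1, hW]
    simp [H]
  · intro i j x y hij
    refine hG.induction_on₂ (p := fun x y => star (W i x) * W j y = 0) ?_ ?_ x y
    · exact isClosed_eq (by fun_prop) (by fun_prop)
    · intro f f'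
      rw [hW, hW, hH0 i j hij]
  · intro i x y
    -- Right linearity follows from preservation of inner products: expanding `star d * d` for the
    -- difference `d` gives zero.
    have h1 : star (W i (x * y) - W i x * y) * (W i (x * y) - W i x * y) = 0 := by
      have h2 : ∀ a b : T, star (W i a) * (W i x * b) = star a * x * b := by
        intro a b; rw [← mul_assoc, hinner]
      rw [star_sub, star_mul, mul_sub, sub_mul, sub_mul, hinner, mul_assoc (star y), hinner,
        h2, mul_assoc (star y), h2]
      simp only [star_mul, mul_assoc, sub_self]
    exact sub_eq_zero.1 ((CStarRing.star_mul_self_eq_zero_iff _).1 h1)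

end CompactTensor

/-- Quotients of stable C⋆-algebras are stable. -/
theorem IsStable.quotient {A : Type u} [NonUnitalCStarAlgebra A] (h : IsStable A)
    (I : ClosedIdeal A) : IsStable I.Quotient := by
  obtain ⟨t⟩ := h
  obtain ⟨W, hWu, hWi, hWo, hWm⟩ := t.exists_isometries
  -- Right linearity writes `W i (a * k)` as `W i a * k`, which is in `I` for `k` in `I`;
  -- approximate units of `I` then give `W i a` in `I`.
  have hWI : ∀ i, ∀ a ∈ I, W i a ∈ I := by
    intro i a ha
    change W i a ∈ (I.toSubmodule : Set A)
    rw [← (ClosedIdeal.isClosed_toSubmodule I).closure_eq]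
    refine Metric.mem_closure_iff.2 fun ε hε => ?_
    have hc : 0 < ‖W i‖ + 1 := by positivity
    obtain ⟨k, hk, hak, -⟩ := ClosedIdeal.Quotient.exists_approx I ha (div_pos hε hc)
    refine ⟨W i (a * k), ?_, ?_⟩
    · rw [hWm]; exact ClosedIdeal.mul_mem_left _ hk
    · rw [dist_eq_norm, ← map_sub]
      have := (lt_div_iff₀ hc).1 hak
      have := (W i).le_opNorm (a - a * k)
      nlinarith [norm_nonneg (a - a * k)]
  -- The given units of `t` need not map `I` into itself. Their replacement `V i j a`, morally `W i
  -- a (W j)⋆`, preserves every closed ideal and hence descends to the quotient.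
  let V : ℕ → ℕ → A →ₗ[ℂ] A := fun i j =>
    { toFun := fun a => W i (star (W j (star a)))
      map_add' := fun a b => by simp
      map_smul' := fun c a => by simp }
  have hV : ∀ i j a, V i j a = W i (star (W j (star a))) := fun _ _ _ => rfl
  have hVI : ∀ i j, ∀ a ∈ I, V i j a ∈ I := fun i j a ha =>
    hWI _ _ (ClosedIdeal.star_mem (hWI _ _ (ClosedIdeal.star_mem ha)))
  have hVc : ∀ i j, Continuous (V i j) := by
    intro i j
    change Continuous fun a => W i (star (W j (star a)))
    fun_prop
  have hVu : ∀ i j k l b, V i j (t.unit k l b) = t.unit (Nat.pair i k) (Nat.pair j l) b := by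
    intro i j k l b
    rw [hV, t.star_unit, hWu, t.star_unit, hWu, star_star]
  have hVs : ∀ i j a, star (V i j a) = V j i (star a) := by
    intro i j a
    refine t.induction_closed (P := fun a => star (V i j a) = V j i (star a)) ?_ ?_ ?_ ?_ ?_ a
    · exact isClosed_eq (continuous_star.comp (hVc i j)) ((hVc j i).comp continuous_star)
    · simp
    · intro k l b
      rw [hVu, t.star_unit, t.star_unit, hVu]
    · intro x y hx hy
      rw [map_add, star_add, hx, hy, star_add, map_add]
    · intro c x hx
      rw [map_smul, star_smul, hx, star_smul, map_smul]
  have hVm : ∀ i j k l a b, V i j a * V k l b = if j = k then V i l (a * b) else 0 := by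
    intro i j k l a b
    rw [hV, hV, ← hWm]
    split_ifs with h
    · subst h
      rw [hWi, star_star, hV, star_mul, hWm, hWm, star_mul, star_star, hWm]
    · rw [hWo _ _ _ _ h, map_zero]
  -- `V i j` can be undone by multiplying with elements of `A` on both sides, up to factors `x` and
  -- `y` that an approximate unit removes.
  have hVinj : ∀ i j a, V i j a ∈ I → a ∈ I := by
    intro i j a ha
    refine ClosedIdeal.mem_of_forall_mul_mem fun x y => ?_
    have h1 : star (W i (star x)) * V i j a * W j y = x * a * y := by
      rw [hV, hWi, star_star, mul_assoc, hWi, star_star, mul_assoc]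
    rw [← h1]
    exact ClosedIdeal.mul_mem_right _ (ClosedIdeal.mul_mem_left _ ha)
  let q := ClosedIdeal.Quotient.mkHom I
  let un : ℕ → ℕ → I.Quotient →ₗ[ℂ] I.Quotient := fun i j =>
    I.toSubmodule.mapQ I.toSubmodule (V i j) (hVI i j)
  have hun : ∀ i j a, un i j (q a) = q (V i j a) := fun _ _ _ => rfl
  have hq : Function.Surjective q := ClosedIdeal.Quotient.mkHom_surjective I
  refine ⟨⟨un, ?_, ?_, ?_, ?_⟩⟩
  · intro i j k l x y
    obtain ⟨a, rfl⟩ := hq x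
    obtain ⟨b, rfl⟩ := hq y
    rw [hun, hun, ← map_mul, ← map_mul, hun, hVm]
    split_ifs
    · rfl
    · rw [map_zero]
  · intro i j x
    obtain ⟨a, rfl⟩ := hq x
    rw [hun, ← map_star q, ← map_star q, hun, hVs]
  · intro i j
    rw [injective_iff_map_eq_zero]
    intro x hx
    obtain ⟨a, rfl⟩ := hq x
    rw [hun] at hx
    exact ClosedIdeal.Quotient.mkHom_eq_zero.2 (hVinj i j a (ClosedIdeal.Quotient.mkHom_eq_zero.1 hx))
  · have h1 := hq.denseRange.dense_image (continuous_hom q) t.dense_span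
    refine h1.mono ?_
    rintro _ ⟨y, hy, rfl⟩
    refine Submodule.span_induction (p := fun y _ => q y ∈ Submodule.span ℂ _) ?_ ?_ ?_ ?_ hy
    · rintro _ ⟨n, m, b, rfl⟩
      -- Unpairing both indices exhibits each original matrix unit as a value of some `V i j`.
      refine Submodule.subset_span ⟨n.unpair.1, m.unpair.1, q (t.unit n.unpair.2 m.unpair.2 b), ?_⟩
      rw [hun, hVu, Nat.pair_unpair, Nat.pair_unpair]
    · rw [map_zero]; exact Submodule.zero_mem _
    · intro x y _ _ hx hy
      rw [map_add]; exact Submodule.add_mem _ hx hy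
    · intro c x _ hx
      rw [map_smul]; exact Submodule.smul_mem _ _ hx

end Stable

end FiberedCStar

namespace FiberedCStar

/-! ### From partial isometries to unitary multipliers -/

section Unitaries

lemma isStarProjection_star_mul_self {A : Type u} [NonUnitalCStarAlgebra A] {v : A}
    (hv : v * star v * v = v) : IsStarProjection (star v * v) := by
  refine ⟨?_, IsSelfAdjoint.star_mul_self v⟩
  change star v * v * (star v * v) = star v * v
  rw [mul_assoc, ← mul_assoc v, hv]

lemma norm_le_one_of_partialIsometry {A : Type u} [NonUnitalCStarAlgebra A] {v : A}
    (hv : v * star v * v = v) : ‖v‖ ≤ 1 := by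
  have := norm_le_one_of_isStarProjection (isStarProjection_star_mul_self hv)
  rw [CStarRing.norm_star_mul_self] at this
  nlinarith [norm_nonneg v]

lemma mul_star_mul_self_of_isStarProjection {A : Type u} [NonUnitalCStarAlgebra A] {v : A}
    (hv : IsStarProjection (star v * v)) : v * star v * v = v := by
  have hi := hv.isIdempotentElem.eq
  have : star (v * star v * v - v) * (v * star v * v - v) = 0 := by
    simp only [star_sub, star_mul, star_star, sub_mul, mul_sub]
    simp only [mul_assoc] at hi ⊢
    simp only [hi, sub_self]
  exact sub_eq_zero.1 ((CStarRing.star_mul_self_eq_zero_iff _).1 this)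

lemma norm_mul_le_left {A : Type u} [NonUnitalNormedRing A] {a b : A} (ha : ‖a‖ ≤ 1) :
    ‖a * b‖ ≤ ‖b‖ :=
  (norm_mul_le a b).trans (mul_le_of_le_one_left (norm_nonneg b) ha)

lemma norm_mul_le_right {A : Type u} [NonUnitalNormedRing A] {a b : A} (hb : ‖b‖ ≤ 1) :
    ‖a * b‖ ≤ ‖a‖ :=
  (norm_mul_le a b).trans (mul_le_of_le_one_right (norm_nonneg a) hb)

/-- An approximate partial isometry `y` with `y² ≈ 0` is implemented by a unitary. -/
lemma exists_unitary_of_norm_le {M : Type u} [CStarAlgebra M] {y : M} {δ : ℝ}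
    (hy : ‖y‖ ≤ 1) (hpi : ‖y * star y * y - y‖ ≤ δ) (hsq : ‖y * y‖ ≤ δ) :
    ∃ u : unitary M, ‖(u : M) * star y - y * star y‖ ≤ 9 * δ + √(84 * δ) := by
  let := CStarAlgebra.spectralOrder M
  have := CStarAlgebra.spectralOrderedRing M
  have hδ0 : 0 ≤ δ := (norm_nonneg _).trans hsq
  have hys : ‖star y‖ ≤ 1 := by rwa [norm_star]
  have hpi' : ‖star y * y * star y - star y‖ ≤ δ := by
    rw [← norm_star]
    simpa [mul_assoc] using hpi
  have hsq' : ‖star y * star y‖ ≤ δ := by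
    rw [← star_mul, norm_star]; exact hsq
  -- For an exact partial isometry with `y² = 0` this is a self-adjoint partial isometry exchanging
  -- the initial and final projections, with `h³ = h` and `h * star y = y * star y`.
  set h := y + star y with hh
  have hs : IsSelfAdjoint h := IsSelfAdjoint.add_star_self y
  have hn2 : ‖h‖ ≤ 2 := (norm_add_le _ _).trans (by linarith)
  have hcube : ‖h * h * h - h‖ ≤ 8 * δ := by
    have e : h * h * h - h = (y * y + star y * star y) * h + ((y * star y * y - y) +
        y * (star y * star y) + star y * (y * y) + (star y * y * star y - star y)) := by
      rw [hh]; noncomm_ring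
    rw [e]
    calc _ ≤ ‖y * y + star y * star y‖ * ‖h‖ + (‖y * star y * y - y‖ + ‖y * (star y * star y)‖ +
          ‖star y * (y * y)‖ + ‖star y * y * star y - star y‖) :=
          (norm_add_le _ _).trans (add_le_add (norm_mul_le _ _) ((norm_add_le _ _).trans
            (add_le_add_left ((norm_add_le _ _).trans (add_le_add_left (norm_add_le _ _) _)) _)))
      _ ≤ (δ + δ) * 2 + (δ + δ + δ + δ) := by
          gcongr
          · exact (norm_add_le _ _).trans (add_le_add hsq hsq')
          · exact (norm_mul_le_left hy).trans hsq'
          · exact (norm_mul_le_left hys).trans hsq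
      _ = 8 * δ := by ring
  set c : ℝ := 1 + 8 * δ with hc
  have hc1 : 1 ≤ c := by linarith
  -- From `‖h‖⁴ = ‖h⁴‖ ≤ ‖h³‖ ‖h‖` one gets `‖h‖³ ≤ ‖h‖ + 8δ`, which fails when `‖h‖ > 1 + 8δ`.
  have hnc : ‖h‖ ≤ c := by
    have h1 : ‖h * h‖ = ‖h‖ * ‖h‖ := by
      conv_lhs => enter [1, 1]; rw [← hs.star_eq]
      exact CStarRing.norm_star_mul_self
    have h2 : ‖h * h * (h * h)‖ = ‖h * h‖ * ‖h * h‖ := by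
      have : star (h * h) = h * h := by rw [star_mul, hs.star_eq]
      conv_lhs => enter [1, 1]; rw [← this]
      exact CStarRing.norm_star_mul_self
    have h3 : ‖h * h * (h * h)‖ ≤ ‖h * h * h‖ * ‖h‖ := by
      rw [← mul_assoc]; exact norm_mul_le _ _
    have h4 : ‖h * h * h‖ ≤ ‖h‖ + 8 * δ := by
      have := norm_add_le (h * h * h - h) h
      rw [sub_add_cancel] at this
      linarith
    by_contra! hlt
    have h5 : 1 < ‖h‖ := by linarith
    have h6 : (‖h‖ * ‖h‖) * (‖h‖ * ‖h‖) ≤ (‖h‖ + 8 * δ) * ‖h‖ := by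
      rw [← h1, ← h2]; exact h3.trans (by gcongr)
    have h7 : ‖h‖ * ‖h‖ * ‖h‖ ≤ ‖h‖ + 8 * δ := by
      have : (‖h‖ * ‖h‖ * ‖h‖) * ‖h‖ ≤ (‖h‖ + 8 * δ) * ‖h‖ := by linarith
      exact le_of_mul_le_mul_right this (by linarith)
    nlinarith [mul_pos (show 0 < ‖h‖ - 1 by linarith) (show 0 < ‖h‖ by linarith)]
  have hc0 : 0 < c := by linarith
  set h' : M := c⁻¹ • h with hh'
  have hs' : IsSelfAdjoint h' := by
    rw [isSelfAdjoint_iff, hh', star_smul, hs.star_eq, star_trivial]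
  have hn' : ‖h'‖ ≤ 1 := by
    rw [hh', norm_smul, norm_inv, Real.norm_of_nonneg hc0.le, inv_mul_le_iff₀ hc0, mul_one]
    exact hnc
  -- The unitary is `h' + i √(1 - h'²)`. Its second summand is small on `star y` because `h'²`
  -- almost fixes `star y`.
  have hu := IsSelfAdjoint.self_add_I_smul_cfcSqrt_sub_sq_mem_unitary h' hs' hn'
  set k := CFC.sqrt (1 - h' ^ 2) with hk
  have hkk : k * k = 1 - h' ^ 2 := by
    refine CFC.sqrt_mul_sqrt_self _ ?_
    rw [sub_nonneg, ← CStarAlgebra.norm_le_one_iff_of_nonneg (h' ^ 2) (by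
      rw [sq]; exact hs'.mul_self_nonneg), sq]
    exact (norm_mul_le_left hn').trans hn'
  have hks : star k = k := (IsSelfAdjoint.of_nonneg (CFC.sqrt_nonneg _)).star_eq
  have hdiff : h - h' = (1 - c⁻¹) • h := by rw [sub_smul, one_smul]
  have hci : 0 ≤ 1 - c⁻¹ := sub_nonneg.2 (inv_le_one_of_one_le₀ hc1)
  have hdn : ‖h - h'‖ ≤ 8 * δ := by
    rw [hdiff, norm_smul, Real.norm_of_nonneg hci]
    calc (1 - c⁻¹) * ‖h‖ ≤ (1 - c⁻¹) * c := by gcongr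
      _ = c - 1 := by field_simp
      _ = 8 * δ := by rw [hc]; ring
  have hmid : ‖star y - h' ^ 2 * star y‖ ≤ 84 * δ := by
    have e : star y - h' ^ 2 * star y = (h - h') * h * star y + h' * (h - h') * star y -
        ((star y * y * star y - star y) + y * y * star y + y * (star y * star y) +
          star y * star y * star y) := by
      rw [sq, hh]; noncomm_ring
    rw [e]
    calc _ ≤ ‖(h - h') * h * star y‖ + ‖h' * (h - h') * star y‖ +
          (‖star y * y * star y - star y‖ + ‖y * y * star y‖ + ‖y * (star y * star y)‖ +
            ‖star y * star y * star y‖) :=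
          (norm_sub_le _ _).trans (add_le_add (norm_add_le _ _) ((norm_add_le _ _).trans
            (add_le_add_left ((norm_add_le _ _).trans (add_le_add_left (norm_add_le _ _) _)) _)))
      _ ≤ 8 * δ * 2 + 8 * δ + (δ + δ + δ + δ) := by
          gcongr
          · refine (norm_mul_le_right hys).trans ((norm_mul_le _ _).trans ?_)
            gcongr
          · exact (norm_mul_le_right hys).trans ((norm_mul_le_left hn').trans hdn)
          · exact (norm_mul_le_right hys).trans hsq
          · exact (norm_mul_le_left hy).trans hsq'
          · exact (norm_mul_le_right hys).trans hsq'
      _ ≤ 84 * δ := by linarith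
  have hky : ‖k * star y‖ ≤ √(84 * δ) := by
    refine Real.le_sqrt_of_sq_le ?_
    rw [sq, ← CStarRing.norm_star_mul_self, star_mul, star_star, hks]
    have e : y * k * (k * star y) = y * (star y - h' ^ 2 * star y) := by
      rw [mul_assoc, ← mul_assoc k, hkk, sub_mul, one_mul]
    rw [e]
    exact (norm_mul_le_left hy).trans hmid
  refine ⟨⟨_, hu⟩, ?_⟩
  have e : (h' + Complex.I • k) * star y - y * star y =
      star y * star y - (h - h') * star y + Complex.I • (k * star y) := by
    rw [hh]
    simp only [add_mul, sub_mul, smul_mul_assoc]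
    abel
  change ‖(h' + Complex.I • k) * star y - y * star y‖ ≤ _
  rw [e]
  calc _ ≤ ‖star y * star y‖ + ‖(h - h') * star y‖ + ‖Complex.I • (k * star y)‖ :=
        (norm_add_le _ _).trans (add_le_add_left (norm_sub_le _ _) _)
    _ ≤ δ + 8 * δ + √(84 * δ) := by
        gcongr
        · exact (norm_mul_le_right hys).trans hdn
        · rw [norm_smul, Complex.norm_I, one_mul]; exact hky
    _ = _ := by ring

lemma exists_unitary_approx {ε : ℝ} (hε : 0 < ε) : ∃ δ > 0, ∀ {M : Type u} [CStarAlgebra M] (y : M),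
    ‖y‖ ≤ 1 → ‖y * star y * y - y‖ ≤ δ → ‖y * y‖ ≤ δ →
      ∃ u : unitary M, ‖(u : M) * star y - y * star y‖ ≤ ε := by
  set e := min ε 1 with he
  have he0 : 0 < e := lt_min hε one_pos
  have he1 : e ≤ 1 := min_le_right _ _
  have heε : e ≤ ε := min_le_left _ _
  -- Both `9 * δ` and `√(84 * δ)` are then at most `e / 2`, as `√84 < 10` and `e ≤ 1`.
  refine ⟨(e / 20) ^ 2, by positivity, fun y h1 h2 h3 => ?_⟩
  obtain ⟨u, hu⟩ := exists_unitary_of_norm_le h1 h2 h3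
  refine ⟨u, hu.trans ?_⟩
  have : √(84 * (e / 20) ^ 2) ≤ e / 2 := by
    rw [Real.sqrt_le_left (by positivity)]
    nlinarith
  nlinarith

open DoubleCentralizer in
/-- Partial isometries in a stable C⋆-algebra are approximately implemented by unitary
multipliers. -/
theorem exists_unitary_multiplier {A : Type u} [NonUnitalCStarAlgebra A] (hA : IsStable A) {v : A}
    (hv : v * star v * v = v) {ε : ℝ} (hε : 0 < ε) :
    ∃ u : unitary (DoubleCentralizer ℂ A),
      ‖(u : DoubleCentralizer ℂ A) * DoubleCentralizer.coe ℂ (star v * v) -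
        DoubleCentralizer.coe ℂ v‖ < ε := by
  classical
  obtain ⟨t⟩ := hA
  obtain ⟨δ, hδ, H⟩ := exists_unitary_approx.{u} (ε := ε / 4) (by positivity)
  set η := min δ (ε / 8) with hη
  have hη0 : 0 < η := lt_min hδ (by positivity)
  have hηδ : η ≤ δ := min_le_left _ _
  have hηε : η ≤ ε / 8 := min_le_right _ _
  set q := v * star v with hq
  have hvn := norm_le_one_of_partialIsometry hv
  have hvn' : ‖star v‖ ≤ 1 := by rwa [norm_star]
  have hqs : star q = q := by rw [hq, star_mul, star_star]
  have hqq : q * q = q := by rw [hq, ← mul_assoc, hv]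
  have hqn : ‖q‖ ≤ 1 := (norm_mul_le_left hvn).trans hvn'
  -- `s` carries the range of `v` almost isometrically to a place that `v` and `q` almost
  -- annihilate.
  obtain ⟨s, hsn, hs⟩ := t.exists_shift {v, q} hη0
  obtain ⟨hv1, hv2⟩ := hs v (by simp)
  obtain ⟨hq1, hq2⟩ := hs q (by simp)
  have hsn' : ‖star s‖ ≤ 1 := by rwa [norm_star]
  let j : A →⋆ₙₐ[ℂ] DoubleCentralizer ℂ A := DoubleCentralizer.coeHom
  have hj : ∀ a, ‖j a‖ ≤ ‖a‖ := fun a => NonUnitalStarAlgHom.norm_apply_le j a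
  have hunit : ∀ u : unitary (DoubleCentralizer ℂ A), ‖(u : DoubleCentralizer ℂ A)‖ ≤ 1 := by
    intro u
    rcases subsingleton_or_nontrivial (DoubleCentralizer ℂ A) with h | h
    · rw [Subsingleton.elim (u : DoubleCentralizer ℂ A) 0, norm_zero]; exact zero_le_one
    · exact (CStarRing.norm_coe_unitary u).le
  -- First half of the route: `s * v` moves the initial space of `v` away, and its square almost
  -- vanishes because `v * s` is small.
  obtain ⟨u₁, hu₁⟩ := H (j (s * v))
    ((hj _).trans ((norm_mul_le_left hsn).trans hvn)) (by
      rw [← map_star, ← map_mul, ← map_mul, ← map_sub]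
      refine (hj _).trans (le_trans ?_ hηδ)
      have e : s * v * star (s * v) * (s * v) - s * v =
          s * (v * (star v * (star s * s * v - v))) := by
        have h1 : s * v = s * (v * (star v * v)) := by rw [← mul_assoc v, ← hq, hv]
        conv_lhs => enter [2]; rw [h1]
        simp only [star_mul, mul_sub, mul_assoc]
      rw [e]
      exact (norm_mul_le_left hsn).trans ((norm_mul_le_left hvn).trans
        ((norm_mul_le_left hvn').trans hv1.le))) (by
      rw [← map_mul]
      refine (hj _).trans (le_trans ?_ hηδ)
      have e : s * v * (s * v) = s * (v * s * v) := by simp only [mul_assoc]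
      rw [e]
      exact (norm_mul_le_left hsn).trans ((norm_mul_le_right hvn).trans hv2.le))
  -- Second half: `q * star s` moves the shifted copy back onto the range of `v`; its square is
  -- small because `q * s` is.
  obtain ⟨u₂, hu₂⟩ := H (j (q * star s))
    ((hj _).trans ((norm_mul_le_left hqn).trans hsn')) (by
      rw [← map_star, ← map_mul, ← map_mul, ← map_sub]
      refine (hj _).trans (le_trans ?_ hηδ)
      have e : q * star s * star (q * star s) * (q * star s) - q * star s =
          q * ((star s * s * q - q) * star s) := by
        have h2 : q * (q * star s) = q * star s := by rw [← mul_assoc, hqq]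
        simp only [star_mul, star_star, hqs, mul_sub, sub_mul, mul_assoc, h2]
      rw [e]
      exact (norm_mul_le_left hqn).trans ((norm_mul_le_right hsn').trans hq1.le)) (by
      rw [← map_mul]
      refine (hj _).trans (le_trans ?_ hηδ)
      have e : q * star s * (q * star s) = q * star (q * s) * star s := by
        simp only [star_mul, hqs, mul_assoc]
      rw [e]
      refine (norm_mul_le_right hsn').trans ((norm_mul_le_left hqn).trans ?_)
      rw [norm_star]; exact hq2.le)
  refine ⟨u₂ * u₁, ?_⟩
  set U₁ : DoubleCentralizer ℂ A := u₁.1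
  set U₂ : DoubleCentralizer ℂ A := u₂.1
  have hU₁ : ‖U₁‖ ≤ 1 := hunit u₁
  have hU₂ : ‖U₂‖ ≤ 1 := hunit u₂
  change ‖U₂ * U₁ * j (star v * v) - j v‖ < ε
  rw [← map_star, ← map_mul] at hu₁ hu₂
  -- The terms account for `U₁ (star v * v) ≈ U₁ star (s * v) (s * v) ≈ s * v` and then `U₂ (s * v)
  -- = U₂ star (q * star s) v ≈ v`.
  have e : U₂ * U₁ * j (star v * v) - j v =
      U₂ * (U₁ * j (star v * (v - star s * s * v))) +
      U₂ * ((U₁ * j (star (s * v)) - j (s * v * star (s * v))) * j (s * v)) +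
      U₂ * j (s * (v * (star v * (star s * s * v - v)))) +
      (U₂ * j (star (q * star s)) - j (q * star s * star (q * star s))) * j v +
      j (q * (star s * s * v - v)) := by
    have hqv : q * v = v := hv
    have h1 : s * (v * (star v * v)) = s * v := by rw [← mul_assoc v, ← hq, hv]
    simp only [mul_sub, sub_mul, mul_assoc, ← map_mul, star_mul, star_star, hqs, map_sub, hqv, h1]
    abel
  rw [e]
  have b1 : ‖U₂ * (U₁ * j (star v * (v - star s * s * v)))‖ ≤ ε / 8 := by
    refine (norm_mul_le_left hU₂).trans ((norm_mul_le_left hU₁).trans ((hj _).trans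
      ((norm_mul_le_left hvn').trans ?_)))
    rw [norm_sub_rev]; exact hv1.le.trans hηε
  have b2 : ‖U₂ * ((U₁ * j (star (s * v)) - j (s * v * star (s * v))) * j (s * v))‖ ≤ ε / 4 :=
    (norm_mul_le_left hU₂).trans ((norm_mul_le_right ((hj _).trans
      ((norm_mul_le_left hsn).trans hvn))).trans hu₁)
  have b3 : ‖U₂ * j (s * (v * (star v * (star s * s * v - v))))‖ ≤ ε / 8 :=
    (norm_mul_le_left hU₂).trans ((hj _).trans ((norm_mul_le_left hsn).trans
      ((norm_mul_le_left hvn).trans ((norm_mul_le_left hvn').trans (hv1.le.trans hηε)))))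
  have b4 : ‖(U₂ * j (star (q * star s)) - j (q * star s * star (q * star s))) * j v‖ ≤ ε / 4 :=
    (norm_mul_le_right ((hj _).trans hvn)).trans hu₂
  have b5 : ‖j (q * (star s * s * v - v))‖ ≤ ε / 8 :=
    (hj _).trans ((norm_mul_le_left hqn).trans (hv1.le.trans hηε))
  refine (norm_add_le _ _).trans_lt ?_
  refine (add_le_add_left (norm_add₄_le ..) _).trans_lt ?_
  linarith

end Unitaries

end FiberedCStar

namespace FiberedCStar

/-! ### Intertwining partial isometries and the proof of the theorem -/

section Intertwining

open OnePoint

variable {A B : Type u} [NonUnitalCStarAlgebra A] [NonUnitalCStarAlgebra B]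

/-- A partial isometry in the ideal `J` intertwines `φ ∘ π` and `ψ ∘ π` on `F` up to `η`. -/
def Intertwines (φ ψ : A →⋆ₙₐ[ℂ] B) (F : Finset A) (J : ClosedIdeal B) (π : A →⋆ₙₐ[ℂ] A)
    (η : ℝ) : Prop :=
  ∃ v ∈ J, v * star v * v = v ∧ ∀ f ∈ F, ‖v * φ (π f) * star v - ψ (π f)‖ ≤ η ∧
    ‖star v * v * φ (π f) * (star v * v) - φ (π f)‖ ≤ η

section Fibre

variable {𝔄 : AlgebraOver (OnePoint ℕ) A} {𝔅 : AlgebraOver (OnePoint ℕ) B} {φ ψ : A →⋆ₙₐ[ℂ] B}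

lemma AlgebraOver.Equivariant.fiberMap_toFiber (hφ : AlgebraOver.Equivariant 𝔄 𝔅 φ)
    (x : OnePoint ℕ) (a : A) : hφ.fiberMap x (𝔄.toFiber x a) = 𝔅.toFiber x (φ a) := rfl

/-- The uniqueness property, applied in the fibre to a projection that is almost a unit for `F`,
gives a partial isometry with initial projection exactly `φ(e)`. This transfers to the ideal of
`{n}`, which is isometric to the fibre. -/
theorem intertwines_point {C : ∀ (A : Type u) [NonUnitalCStarAlgebra A], Prop}
    (hC : HasUniquenessProperty C) (hrr : RealRankZero A) (n : ℕ)
    (hC₁ : C (𝔄.Fiber (n : OnePoint ℕ))) (hstable : IsStable B)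
    (hC₂ : C (𝔅.Fiber (n : OnePoint ℕ)))
    (hφ : AlgebraOver.Equivariant 𝔄 𝔅 φ) (hψ : AlgebraOver.Equivariant 𝔄 𝔅 ψ)
    (hK : AgreeOnTotalK (hφ.fiberMap (n : OnePoint ℕ)) (hψ.fiberMap (n : OnePoint ℕ)))
    (hφ_full : IsFullHom (hφ.fiberMap (n : OnePoint ℕ)))
    (hψ_full : IsFullHom (hψ.fiberMap (n : OnePoint ℕ))) (F : Finset A) {η : ℝ} (hη : 0 < η) :
    Intertwines φ ψ F (𝔅.ideal (pointOpen n)) (𝔄.point n) η := by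
  obtain ⟨e, he, heF⟩ := hrr.exists_projection F (ε := η / 3) (by positivity)
  set q := 𝔄.toFiber n with hq
  have hef : ∀ f ∈ F, ‖q f - q e * q f * q e‖ ≤ η / 3 := by
    intro f hf
    rw [← map_mul, ← map_mul, ← map_sub]
    exact (NonUnitalStarAlgHom.norm_apply_le q _).trans (heF f hf).le
  have hmem : ∀ {χ : A →⋆ₙₐ[ℂ] B}, AlgebraOver.Equivariant 𝔄 𝔅 χ → ∀ a,
      χ (𝔄.point n a) ∈ 𝔅.ideal (pointOpen n) := fun hχ a => hχ _ _ (𝔄.point_mem n a)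
  have hfib : ∀ {χ : A →⋆ₙₐ[ℂ] B} (hχ : AlgebraOver.Equivariant 𝔄 𝔅 χ) (a : A),
      𝔅.toFiber n (χ (𝔄.point n a)) = hχ.fiberMap n (q a) := by
    intro χ hχ a
    rw [← hχ.fiberMap_toFiber, 𝔄.toFiber_point]
  -- The uniqueness property requires a nonzero projection; if `e` vanishes in the fibre, then all
  -- of `F` is small there and `v = 0` works.
  by_cases he0 : q e = 0
  · refine ⟨0, ClosedIdeal.zero_mem _, by simp, fun f hf => ?_⟩
    have hsmall : ∀ {χ : A →⋆ₙₐ[ℂ] B}, AlgebraOver.Equivariant 𝔄 𝔅 χ →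
        ‖χ (𝔄.point n f)‖ ≤ η := by
      intro χ hχ
      rw [← 𝔅.norm_of_mem_point (hmem hχ f), hfib hχ]
      have h1 := hef f hf
      rw [he0, mul_zero, sub_zero] at h1
      exact (NonUnitalStarAlgHom.norm_apply_le (hχ.fiberMap n) _).trans (by linarith)
    simpa using ⟨hsmall hψ, hsmall hφ⟩
  -- The fibre of the target is stable, so it is itself admissible as the realization `T` of its
  -- stabilization.
  obtain ⟨v, hv, hvlim⟩ := hC _ _ _ hC₁ hC₂ (hstable.quotient _) _ _ hφ_full hψ_full hK
    (q e) (he.map q) he0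
  have hev : ∀ᶠ k in atTop, ∀ f ∈ F, ‖v k * hφ.fiberMap n (q e * q f * q e) * star (v k) -
      hψ.fiberMap n (q e * q f * q e)‖ < η / 3 :=
    (Filter.eventually_all_finset F).2 fun f _ =>
      (hvlim (q f)).eventually (gt_mem_nhds (by positivity))
  obtain ⟨k, hk⟩ := hev.exists
  obtain ⟨hv1, hv2⟩ := hv k
  set w := v k
  have hwpi : w * star w * w = w :=
    mul_star_mul_self_of_isStarProjection (hv1 ▸ (he.map q).map (hφ.fiberMap n))
  have hwn := norm_le_one_of_partialIsometry hwpi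
  obtain ⟨w', hw'⟩ := 𝔅.toFiber_surjective n w
  set V := 𝔅.point n w' with hV
  have hVm : V ∈ 𝔅.ideal (pointOpen n) := 𝔅.point_mem n w'
  have hVw : 𝔅.toFiber n V = w := by rw [hV, 𝔅.toFiber_point, hw']
  refine ⟨V, hVm, ?_, fun f hf => ⟨?_, ?_⟩⟩
  · refine 𝔅.eq_of_toFiber_eq (ClosedIdeal.mul_mem_left _ hVm) hVm ?_
    rw [map_mul, map_mul, map_star, hVw, hwpi]
  · rw [← 𝔅.norm_of_mem_point (ClosedIdeal.sub_mem
      (ClosedIdeal.mul_mem_right _ (ClosedIdeal.mul_mem_right _ hVm)) (hmem hψ f)), map_sub, map_mul,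
      map_mul, map_star, hVw, hfib hφ, hfib hψ]
    have key : w * hφ.fiberMap n (q f) * star w - hψ.fiberMap n (q f) =
        w * hφ.fiberMap n (q f - q e * q f * q e) * star w +
        (w * hφ.fiberMap n (q e * q f * q e) * star w - hψ.fiberMap n (q e * q f * q e)) -
        hψ.fiberMap n (q f - q e * q f * q e) := by
      simp only [map_sub, mul_sub, sub_mul]; abel
    rw [key]
    have h1 : ‖w * hφ.fiberMap n (q f - q e * q f * q e) * star w‖ ≤ η / 3 :=
      (norm_mul_le_right (by rwa [norm_star])).trans ((norm_mul_le_left hwn).trans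
        ((NonUnitalStarAlgHom.norm_apply_le (hφ.fiberMap n) _).trans (hef f hf)))
    have h2 : ‖hψ.fiberMap n (q f - q e * q f * q e)‖ ≤ η / 3 :=
      (NonUnitalStarAlgHom.norm_apply_le (hψ.fiberMap n) _).trans (hef f hf)
    have h3 := hk f hf
    refine (norm_sub_le _ _).trans ?_
    have := norm_add_le (w * hφ.fiberMap n (q f - q e * q f * q e) * star w)
      (w * hφ.fiberMap n (q e * q f * q e) * star w - hψ.fiberMap n (q e * q f * q e))
    linarith
  · rw [← 𝔅.norm_of_mem_point (ClosedIdeal.sub_mem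
      (ClosedIdeal.mul_mem_left _ (ClosedIdeal.mul_mem_left _ hVm)) (hmem hφ f)), map_sub, map_mul,
      map_mul, map_mul, map_star, hVw, hfib hφ, hv1, ← map_mul, ← map_mul, norm_sub_rev, ← map_sub]
    exact (NonUnitalStarAlgHom.norm_apply_le (hφ.fiberMap n) _).trans
      ((hef f hf).trans (by linarith))

/-- All cross terms are products of elements from ideals over disjoint open sets, so they vanish. -/
theorem Intertwines.glue (hφ : AlgebraOver.Equivariant 𝔄 𝔅 φ)
    {F : Finset A} {n : ℕ} {η δ : ℝ}
    (h1 : Intertwines φ ψ F (𝔅.ideal (pointOpen n)) (𝔄.point n) δ)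
    (h2 : Intertwines φ ψ F (𝔅.ideal (tailOpen (n + 1))) (𝔄.tail (n + 1)) η) :
    Intertwines φ ψ F (𝔅.ideal (tailOpen n)) (𝔄.tail n) (δ + η) := by
  obtain ⟨v, hv, hvp, hvF⟩ := h1
  obtain ⟨w, hw, hwp, hwF⟩ := h2
  have hdis := disjoint_point_tail n
  have hvw : ∀ {a b : B}, a ∈ 𝔅.ideal (pointOpen n) → b ∈ 𝔅.ideal (tailOpen (n + 1)) →
      a * b = 0 := fun ha hb => 𝔅.mul_eq_zero_of_disjoint hdis ha hb
  have hwv : ∀ {a b : B}, a ∈ 𝔅.ideal (pointOpen n) → b ∈ 𝔅.ideal (tailOpen (n + 1)) →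
      b * a = 0 := fun ha hb => 𝔅.mul_eq_zero_of_disjoint hdis.symm hb ha
  have hvs := ClosedIdeal.star_mem hv
  have hws := ClosedIdeal.star_mem hw
  have e1 : star (v + w) * (v + w) = star v * v + star w * w := by
    rw [star_add, add_mul, mul_add, mul_add, hvw hvs hw, hwv hv hws, add_zero, zero_add]
  refine ⟨v + w, ClosedIdeal.add_mem (𝔅.mono (pointOpen_le_tail n) hv)
    (𝔅.mono (tailOpen_anti n.le_succ) hw), ?_, fun f hf => ?_⟩
  · rw [mul_assoc, e1, add_mul, mul_add, mul_add, hvw hv (ClosedIdeal.mul_mem_left _ hw),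
      hwv (ClosedIdeal.mul_mem_left _ hv) hw, add_zero, zero_add, ← mul_assoc, ← mul_assoc, hvp, hwp]
  · obtain ⟨hf1, hf2⟩ := hvF f hf
    obtain ⟨hf3, hf4⟩ := hwF f hf
    have hx := hφ _ _ (𝔄.point_mem n f)
    have hy := hφ _ _ (𝔄.tail_mem (n + 1) f)
    rw [𝔄.tail_eq_add, map_add, map_add]
    set x := φ (𝔄.point n f)
    set y := φ (𝔄.tail (n + 1) f)
    constructor
    · have e : (v + w) * (x + y) * star (v + w) = v * x * star v + w * y * star w := by
        rw [star_add, add_mul v w, mul_add v, mul_add w, hvw hv hy, hwv hx hw, add_zero, zero_add,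
          add_mul, mul_add, mul_add, hvw (ClosedIdeal.mul_mem_left _ hx) hws,
          hwv hvs (ClosedIdeal.mul_mem_left _ hy), add_zero, zero_add]
      rw [e, add_sub_add_comm]
      exact (norm_add_le _ _).trans (add_le_add hf1 hf3)
    · have e : (star v * v + star w * w) * (x + y) * (star v * v + star w * w) =
          star v * v * x * (star v * v) + star w * w * y * (star w * w) := by
        rw [add_mul _ _ (x + y), mul_add (star v * v), mul_add (star w * w),
          hvw (ClosedIdeal.mul_mem_left _ hv) hy, hwv hx (ClosedIdeal.mul_mem_left _ hw), add_zero,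
          zero_add, add_mul, mul_add, mul_add, hvw (ClosedIdeal.mul_mem_left _ hx)
          (ClosedIdeal.mul_mem_left _ hw), hwv (ClosedIdeal.mul_mem_left _ hv)
          (ClosedIdeal.mul_mem_left _ hy), add_zero, zero_add]
      rw [e1, e, add_sub_add_comm]
      exact (norm_add_le _ _).trans (add_le_add hf2 hf4)

end Fibre

/-- Equivalences between the images of the projections of a system of matrix units extend to a
partial isometry that intertwines the two representations. -/
lemma MatrixUnits.exists_intertwiner {m : ℕ} {r : Fin m → Fin m} {p x : Fin m → A}
    (h : MatrixUnits r p x) (φ ψ : A →⋆ₙₐ[ℂ] B)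
    (hp : ∀ i, MurrayVonNeumannEquiv (φ (p i)) (ψ (p i))) :
    ∃ v : B, (∀ J : ClosedIdeal B, (∀ i, φ (x i) ∈ J) → v ∈ J) ∧ v * star v * v = v ∧
      ∀ c : Fin m → Fin m → ℂ, (∀ i j, r i ≠ r j → c i j = 0) →
        v * φ (∑ i, ∑ j, c i j • (x i * star (x j))) * star v =
          ψ (∑ i, ∑ j, c i j • (x i * star (x j))) ∧
        star v * ψ (∑ i, ∑ j, c i j • (x i * star (x j))) * v =
          φ (∑ i, ∑ j, c i j • (x i * star (x j))) := by
  choose w hw1 hw2 using hp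
  have hwp : ∀ i, w i * star (w i) * w i = w i := fun i =>
    mul_star_mul_self_of_isStarProjection (hw1 i ▸ (h.proj i).map φ)
  have hwφ : ∀ i, w i * φ (p i) = w i := fun i => by rw [← hw1, ← mul_assoc, hwp]
  have hwψ : ∀ i, star (w i) * ψ (p i) = star (w i) := fun i => by
    have := congrArg star (hwp i)
    rw [StarMul.star_mul, StarMul.star_mul, star_star] at this
    rw [← hw2, this]
  -- Each matrix block is moved to its representative by `star (φ (x i))`, transferred by `w (r i)`,
  -- and moved back by `ψ (x i)`.
  set v := ∑ i, ψ (x i) * w (r i) * star (φ (x i)) with hv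
  have hvs : star v = ∑ i, φ (x i) * star (w (r i)) * star (ψ (x i)) := by
    rw [hv, star_sum]
    exact Finset.sum_congr rfl fun i _ => by simp only [StarMul.star_mul, star_star, mul_assoc]
  have hvx : ∀ i, v * φ (x i) = ψ (x i) * w (r i) := by
    intro i
    rw [hv, Finset.sum_mul, Finset.sum_eq_single i]
    · rw [mul_assoc, ← map_star, ← map_mul, h.star_mul_self, mul_assoc, hwφ]
    · intro j _ hj
      rw [mul_assoc, ← map_star, ← map_mul, h.star_mul hj, map_zero, mul_zero]
    · simp
  have hvx' : ∀ i, star v * ψ (x i) = φ (x i) * star (w (r i)) := by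
    intro i
    rw [hvs, Finset.sum_mul, Finset.sum_eq_single i]
    · rw [mul_assoc, ← map_star, ← map_mul, h.star_mul_self, mul_assoc, hwψ]
    · intro j _ hj
      rw [mul_assoc, ← map_star, ← map_mul, h.star_mul hj, map_zero, mul_zero]
    · simp
  refine ⟨v, fun J hJ => ?_, ?_, fun c hc => ⟨?_, ?_⟩⟩
  · exact J.toSubmodule.sum_mem fun i _ => ClosedIdeal.mul_mem_left _ (ClosedIdeal.star_mem (hJ i))
  · have h1 : star v * v = ∑ i, φ (x i) * star (φ (x i)) := by
      conv_lhs => enter [2]; rw [hv]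
      rw [Finset.mul_sum]
      refine Finset.sum_congr rfl fun i _ => ?_
      rw [← mul_assoc, ← mul_assoc, hvx', mul_assoc (φ (x i)), hw1, ← map_mul, h.right]
    rw [mul_assoc, h1, Finset.mul_sum]
    conv_rhs => rw [hv]
    exact Finset.sum_congr rfl fun i _ => by rw [← mul_assoc, hvx]
  · simp only [map_sum, _root_.map_smul, map_mul, map_star, Finset.mul_sum, Finset.sum_mul]
    refine Finset.sum_congr rfl fun i _ => Finset.sum_congr rfl fun j _ => ?_
    by_cases hij : r i = r j
    · rw [mul_smul_comm, smul_mul_assoc]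
      congr 1
      have h2 := congrArg star (hvx j)
      rw [StarMul.star_mul, StarMul.star_mul] at h2
      rw [← mul_assoc, hvx, mul_assoc, h2, ← hij, mul_assoc, ← mul_assoc (w (r i)), hw2, ← mul_assoc,
        ← map_mul, h.right]
    · simp [hc i j hij]
  · simp only [map_sum, _root_.map_smul, map_mul, map_star, Finset.mul_sum, Finset.sum_mul]
    refine Finset.sum_congr rfl fun i _ => Finset.sum_congr rfl fun j _ => ?_
    by_cases hij : r i = r j
    · rw [mul_smul_comm, smul_mul_assoc]
      congr 1
      have h2 := congrArg star (hvx' j)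
      rw [StarMul.star_mul, StarMul.star_mul, star_star, star_star] at h2
      rw [← mul_assoc, hvx', mul_assoc, h2, ← hij, mul_assoc, ← mul_assoc (star (w (r i))), hw1,
        ← mul_assoc, ← map_mul, h.right]
    · simp [hc i j hij]

/-- Restricted to a tail, matrix units remain matrix units and still nearly span `F`. Their
projections belong to `A`, so the Murray–von Neumann hypothesis applies to them directly. -/
theorem exists_intertwines_tail {𝔄 : AlgebraOver (OnePoint ℕ) A} {𝔅 : AlgebraOver (OnePoint ℕ) B}
    {φ ψ : A →⋆ₙₐ[ℂ] B} (hAF : IsAF (𝔄.Fiber ∞)) (hφ : AlgebraOver.Equivariant 𝔄 𝔅 φ)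
    (hMvN : ∀ e : A, IsStarProjection e → MurrayVonNeumannEquiv (φ e) (ψ e)) (F : Finset A)
    {η : ℝ} (hη : 0 < η) :
    ∃ N, Intertwines φ ψ F (𝔅.ideal (tailOpen N)) (𝔄.tail N) η := by
  obtain ⟨m, r, p, x, hmu, hF⟩ := exists_matrixUnits_approx 𝔄 hAF F (half_pos hη)
  have hF' : ∀ f : F, ∃ c : Fin m → Fin m → ℂ, (∀ i j, r i ≠ r j → c i j = 0) ∧
        ∀ᶠ N in atTop, ‖𝔄.tail N (f - ∑ i, ∑ j, c i j • (x i * star (x j)))‖ < η / 2 :=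
    fun f => hF f f.2
  choose c hc0 hc using hF'
  obtain ⟨N, hN⟩ := (Filter.eventually_all.2 hc).exists
  have hmu' := hmu.map (𝔄.tail N)
  obtain ⟨v, hvJ, hvp, hvc⟩ := hmu'.exists_intertwiner φ ψ fun i => hMvN _ (hmu'.proj i)
  have hvn := norm_le_one_of_partialIsometry hvp
  have hvn' : ‖star v‖ ≤ 1 := by rwa [norm_star]
  refine ⟨N, v, hvJ _ fun i => hφ _ _ (𝔄.tail_mem N _), hvp, fun f hf => ?_⟩
  obtain ⟨h1, h2⟩ := hvc (c ⟨f, hf⟩) (hc0 ⟨f, hf⟩)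
  have h3 := (hN ⟨f, hf⟩).le
  simp only [map_sub, map_sum, _root_.map_smul, map_mul, map_star (𝔄.tail N)] at h3
  set d := ∑ i, ∑ j, c ⟨f, hf⟩ i j • (𝔄.tail N (x i) * star (𝔄.tail N (x j)))
  set g := 𝔄.tail N f
  have hχ : ∀ χ : A →⋆ₙₐ[ℂ] B, ‖χ (g - d)‖ ≤ η / 2 := fun χ =>
    (NonUnitalStarAlgHom.norm_apply_le χ _).trans h3
  constructor
  · have e : v * φ g * star v - ψ g = v * φ (g - d) * star v - ψ (g - d) := by
      simp only [map_sub, mul_sub, sub_mul, h1]; abel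
    rw [e]
    have h4 : ‖v * φ (g - d) * star v‖ ≤ η / 2 :=
      (norm_mul_le_right hvn').trans ((norm_mul_le_left hvn).trans (hχ φ))
    exact (norm_sub_le _ _).trans (by linarith [hχ ψ])
  · have e : star v * v * φ g * (star v * v) - φ g =
        star v * (v * φ (g - d) * star v) * v - φ (g - d) := by
      have h5 : star v * (v * φ d * star v) * v = φ d := by rw [h1, h2]
      simp only [map_sub, mul_sub, sub_mul, h5]
      simp only [mul_assoc]
      abel
    rw [e]
    have h4 : ‖star v * (v * φ (g - d) * star v) * v‖ ≤ η / 2 :=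
      (norm_mul_le_right hvn).trans ((norm_mul_le_left hvn').trans
        ((norm_mul_le_right hvn').trans ((norm_mul_le_left hvn).trans (hχ φ))))
    exact (norm_sub_le _ _).trans (by linarith [hχ φ])

open DoubleCentralizer in
-- With `p = star v * v` and `u p ≈ v`, conjugation by `u` satisfies `u φ(f) star u ≈ u p φ(f) p
-- star u ≈ v φ(f) star v ≈ ψ(f)`.
lemma exists_unitary_of_partialIsometry (hB : IsStable B) (φ ψ : A →⋆ₙₐ[ℂ] B) (F : Finset A)
    {η : ℝ} (hη : 0 < η) {v : B} (hv : v * star v * v = v)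
    (hF : ∀ f ∈ F, ‖v * φ f * star v - ψ f‖ ≤ η ∧
      ‖star v * v * φ f * (star v * v) - φ f‖ ≤ η) :
    ∃ u : unitary (DoubleCentralizer ℂ B), ∀ f ∈ F,
      ‖(u : DoubleCentralizer ℂ B) * DoubleCentralizer.coe ℂ (φ f) *
        star (u : DoubleCentralizer ℂ B) - DoubleCentralizer.coe ℂ (ψ f)‖ ≤ 3 * η := by
  obtain ⟨C, hC, hCF⟩ : ∃ C : ℝ, 0 < C ∧ ∀ f ∈ F, ‖f‖ ≤ C := by
    refine ⟨1 + ∑ f ∈ F, ‖f‖, by positivity, fun f hf => ?_⟩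
    have := Finset.single_le_sum (f := fun f : A => ‖f‖) (fun f _ => norm_nonneg f) hf
    linarith
  -- Replacing `u p` by `v` on either side of `φ f` costs `C * η / (2 * C) = η / 2`; together with
  -- the two errors `η` of the hypothesis this makes `3 * η`.
  obtain ⟨u, hu⟩ := exists_unitary_multiplier hB hv (ε := η / (2 * C)) (by positivity)
  refine ⟨u, fun f hf => ?_⟩
  let j : B →⋆ₙₐ[ℂ] DoubleCentralizer ℂ B := DoubleCentralizer.coeHom
  have hj : ∀ a, ‖j a‖ ≤ ‖a‖ := fun a => NonUnitalStarAlgHom.norm_apply_le j a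
  have hvn := norm_le_one_of_partialIsometry hv
  obtain ⟨h1, h2⟩ := hF f hf
  have hX : ‖φ f‖ ≤ C := (NonUnitalStarAlgHom.norm_apply_le φ f).trans (hCF f hf)
  have hun : ‖u.1‖ ≤ 1 := by
    rcases subsingleton_or_nontrivial (DoubleCentralizer ℂ B) with h | h
    · rw [Subsingleton.elim u.1 0, norm_zero]; exact zero_le_one
    · exact (CStarRing.norm_coe_unitary u).le
  have hus : ‖star u.1‖ ≤ 1 := by rwa [norm_star]
  change ‖u.1 * j (star v * v) - j v‖ < η / (2 * C) at hu
  change ‖u.1 * j (φ f) * star u.1 - j (ψ f)‖ ≤ 3 * η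
  set U := u.1
  set X := φ f
  set p := star v * v with hp
  have hps : star p = p := by rw [hp, star_mul, star_star]
  have hpn : ‖p‖ ≤ 1 := (norm_mul_le_left (by rwa [norm_star])).trans hvn
  have e : U * j X * star U - j (ψ f) =
      (U * j p - j v) * j X * star (U * j p) + j v * j X * star (U * j p - j v) +
      j (v * X * star v - ψ f) - U * j (p * X * p - X) * star U := by
    simp only [star_sub, star_mul, map_sub, map_mul, ← map_star, hps, sub_mul, mul_sub, mul_assoc]
    abel
  rw [e]
  have b1 : ‖(U * j p - j v) * j X * star (U * j p)‖ ≤ η / 2 := by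
    refine (norm_mul_le_right ?_).trans ?_
    · rw [norm_star]; exact (norm_mul_le_left hun).trans ((hj _).trans hpn)
    · calc _ ≤ η / (2 * C) * C := (norm_mul_le _ _).trans (by
            gcongr; exact (hj _).trans hX)
        _ = η / 2 := by field_simp
  have b2 : ‖j v * j X * star (U * j p - j v)‖ ≤ η / 2 := by
    calc _ ≤ ‖j v * j X‖ * ‖star (U * j p - j v)‖ := norm_mul_le _ _
      _ ≤ C * (η / (2 * C)) := by
          rw [norm_star]
          gcongr
          exact (norm_mul_le_left ((hj _).trans hvn)).trans ((hj _).trans hX)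
      _ = η / 2 := by field_simp
  have b3 : ‖j (v * X * star v - ψ f)‖ ≤ η := (hj _).trans h1
  have b4 : ‖U * j (p * X * p - X) * star U‖ ≤ η :=
    (norm_mul_le_right hus).trans ((norm_mul_le_left hun).trans ((hj _).trans h2))
  refine (norm_sub_le _ _).trans ?_
  have := norm_add₃_le (a := (U * j p - j v) * j X * star (U * j p))
    (b := j v * j X * star (U * j p - j v)) (c := j (v * X * star v - ψ f))
  linarith

/-- The `n`-th unitary is chosen for the first `n` terms of a dense sequence and tolerance `1 / (n +
1)`; contractivity of all maps extends convergence to the closure. -/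
lemma approxUnitarilyEquivalent_of_finset [TopologicalSpace.SeparableSpace A]
    {φ ψ : A →⋆ₙₐ[ℂ] B}
    (h : ∀ (F : Finset A) (ε : ℝ), 0 < ε → ∃ u : unitary (DoubleCentralizer ℂ B), ∀ f ∈ F,
      ‖(u : DoubleCentralizer ℂ B) * DoubleCentralizer.coe ℂ (φ f) *
        star (u : DoubleCentralizer ℂ B) - DoubleCentralizer.coe ℂ (ψ f)‖ ≤ ε) :
    ApproxUnitarilyEquivalent φ ψ := by
  classical
  let s : ℕ → A := TopologicalSpace.denseSeq A
  choose u hu using fun n : ℕ => h ((Finset.range n).image s) (1 / ((n : ℝ) + 1)) (by positivity)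
  refine ⟨u, fun a => ?_⟩
  let j : B →⋆ₙₐ[ℂ] DoubleCentralizer ℂ B := DoubleCentralizer.coeHom
  have hj : ∀ a, ‖j a‖ ≤ ‖a‖ := fun a => NonUnitalStarAlgHom.norm_apply_le j a
  refine Metric.tendsto_atTop.2 fun ε hε => ?_
  obtain ⟨k, hk⟩ : ∃ k, ‖a - s k‖ < ε / 3 := by
    obtain ⟨_, ⟨k, rfl⟩, hk⟩ := Metric.mem_closure_iff.1
      (TopologicalSpace.denseRange_denseSeq A a) (ε / 3) (by positivity)
    exact ⟨k, by rwa [← dist_eq_norm]⟩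
  obtain ⟨N, hN⟩ := exists_nat_one_div_lt (show 0 < ε / 3 by positivity)
  refine ⟨max N (k + 1), fun n hn => ?_⟩
  have hkn : k < n := lt_of_lt_of_le (Nat.lt_succ_self k) ((le_max_right _ _).trans hn)
  have h1 := hu n (s k) (Finset.mem_image_of_mem _ (Finset.mem_range.2 hkn))
  have h2 : 1 / ((n : ℝ) + 1) ≤ 1 / ((N : ℝ) + 1) := by
    have : (N : ℝ) ≤ n := by exact_mod_cast (le_max_left _ _).trans hn
    gcongr
  have hun : ‖(u n).1‖ ≤ 1 := by
    rcases subsingleton_or_nontrivial (DoubleCentralizer ℂ B) with h | h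
    · rw [Subsingleton.elim (u n).1 0, norm_zero]; exact zero_le_one
    · exact (CStarRing.norm_coe_unitary (u n)).le
  have hus : ‖star (u n).1‖ ≤ 1 := by rwa [norm_star]
  rw [dist_zero_right, norm_norm]
  change ‖(u n).1 * j (φ (s k)) * star (u n).1 - j (ψ (s k))‖ ≤ _ at h1
  change ‖(u n).1 * j (φ a) * star (u n).1 - j (ψ a)‖ < ε
  have e : (u n).1 * j (φ a) * star (u n).1 - j (ψ a) =
      (u n).1 * j (φ (a - s k)) * star (u n).1 +
        ((u n).1 * j (φ (s k)) * star (u n).1 - j (ψ (s k))) - j (ψ (a - s k)) := by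
    simp only [map_sub, mul_sub, sub_mul]; abel
  rw [e]
  have b1 : ‖(u n).1 * j (φ (a - s k)) * star (u n).1‖ ≤ ‖a - s k‖ :=
    (norm_mul_le_right hus).trans ((norm_mul_le_left hun).trans ((hj _).trans
      (NonUnitalStarAlgHom.norm_apply_le φ _)))
  have b2 : ‖j (ψ (a - s k))‖ ≤ ‖a - s k‖ :=
    (hj _).trans (NonUnitalStarAlgHom.norm_apply_le ψ _)
  refine (norm_sub_le _ _).trans_lt ?_
  have := norm_add_le ((u n).1 * j (φ (a - s k)) * star (u n).1)
    ((u n).1 * j (φ (s k)) * star (u n).1 - j (ψ (s k)))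
  linarith

end Intertwining

end FiberedCStar

theorem theoremt
    (C : ℕ → ∀ (A : Type u) [NonUnitalCStarAlgebra A], Prop)
    (hC : ∀ n, HasUniquenessProperty (C n))
    (A₁ A₂ : Type u) [NonUnitalCStarAlgebra A₁] [NonUnitalCStarAlgebra A₂]
    [TopologicalSpace.SeparableSpace A₁] [TopologicalSpace.SeparableSpace A₂]
    (𝔄₁ : AlgebraOver (OnePoint ℕ) A₁) (𝔄₂ : AlgebraOver (OnePoint ℕ) A₂)
    (hrr : RealRankZero A₁) (hAF : IsAF (𝔄₁.Fiber OnePoint.infty))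
    (hC₁ : ∀ n : ℕ, C n (𝔄₁.Fiber (n : OnePoint ℕ)))
    (hstable : IsStable A₂)
    (hC₂ : ∀ n : ℕ, C n (𝔄₂.Fiber (n : OnePoint ℕ)))
    (φ ψ : A₁ →⋆ₙₐ[ℂ] A₂)
    (hφ : AlgebraOver.Equivariant 𝔄₁ 𝔄₂ φ) (hψ : AlgebraOver.Equivariant 𝔄₁ 𝔄₂ ψ)
    (hK : ∀ n : ℕ, AgreeOnTotalK (hφ.fiberMap (n : OnePoint ℕ)) (hψ.fiberMap (n : OnePoint ℕ)))
    (hφ_full : ∀ n : ℕ, IsFullHom (hφ.fiberMap (n : OnePoint ℕ)))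
    (hψ_full : ∀ n : ℕ, IsFullHom (hψ.fiberMap (n : OnePoint ℕ)))
    (hMvN : ∀ e : A₁, IsStarProjection e → MurrayVonNeumannEquiv (φ e) (ψ e)) :
    ApproxUnitarilyEquivalent φ ψ := by
  refine approxUnitarilyEquivalent_of_finset fun F ε hε => ?_
  have hpoint : ∀ n : ℕ, ∀ δ : ℝ, 0 < δ →
      Intertwines φ ψ F (𝔄₂.ideal (pointOpen n)) (𝔄₁.point n) δ := fun n δ hδ =>
    intertwines_point (hC n) hrr n (hC₁ n) hstable (hC₂ n) hφ hψ (hK n) (hφ_full n) (hψ_full n) F hδ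
  -- The points below `N` are glued on in decreasing order. Each step spends half of the remaining
  -- allowance, so the total extra error stays within `δ` whatever `N` is.
  have hdown : ∀ N : ℕ, ∀ η δ : ℝ, 0 < δ →
      Intertwines φ ψ F (𝔄₂.ideal (tailOpen N)) (𝔄₁.tail N) η →
      Intertwines φ ψ F (𝔄₂.ideal (tailOpen 0)) (𝔄₁.tail 0) (δ + η) := by
    intro N
    induction N with
    | zero =>
      rintro η δ hδ ⟨v, hv, hvp, hvF⟩
      exact ⟨v, hv, hvp, fun f hf => ⟨(hvF f hf).1.trans (by linarith),
        (hvF f hf).2.trans (by linarith)⟩⟩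
    | succ N ih =>
      intro η δ hδ h
      have h1 := Intertwines.glue hφ (hpoint N (δ / 2) (half_pos hδ)) h
      have h2 := ih _ (δ / 2) (half_pos hδ) h1
      rwa [← add_assoc, add_halves] at h2
  -- The tail and the points contribute `ε / 6` each, and passing to a unitary triples the sum.
  obtain ⟨N, hN⟩ := exists_intertwines_tail hAF hφ hMvN F (show 0 < ε / 6 by positivity)
  obtain ⟨v, -, hvp, hvF⟩ := hdown N (ε / 6) (ε / 6) (by positivity) hN
  obtain ⟨u, hu⟩ := exists_unitary_of_partialIsometry hstable φ ψ F
    (show 0 < ε / 6 + ε / 6 by positivity) hvp (by simpa only [𝔄₁.tail_zero] using hvF)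
  exact ⟨u, fun f hf => (hu f hf).trans (by linarith)⟩
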